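/- Let $M$ be a complete smooth $n$-dimensional Riemannian manifold (without boundary, second countable) with Riemannian volume measure $\mu$, and let $\alpha$ be a smooth harmonic 1-form on $M$, i.e. $\Delta\alpha=(d\delta+\delta d)\alpha=0$, such that $|\alpha|\in L^2(M,\mu)\cap L^4(M,\mu)$. Let $v=\alpha^\sharp$ be the dual vector field, $v^\flat=\alpha$. Then $v$ is a (smooth) steady solution of the Euler equations: there is a smooth function $p$ on $M$ such that the time-independent pair $(v,p)$ satisfies $$\partial_t v+\nabla_v v=-\operatorname{grad}p,\qquad \operatorname{div}v=0 .$$ Moreover, $L_v\alpha=d(\iota_v\alpha)$, where $\iota_v\alpha=\alpha(v)$ is a smooth function in $L^2(M,\mu)$; thus $L_v\alpha$ lies in $d\Omega^0_{L^2}$, the differentials of smooth $L^2$ functions. Consequently $L_v\alpha$ vanishes in the dual space $\Omega^1_{L^2}/\overline{d\Omega^0_{L^2}}$, where $\Omega^1_{L^2}$ is the space of square-integrable 1-forms and the closure is that of $d\Omega^0_{L^2}\cap\Omega^1_{L^2}$ in $L^2$, in the following sense: $\alpha\in\Omega^1_{L^2}$; if $L_v\alpha\in\Omega^1_{L^2}$,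 then its coset in $\Omega^1_{L^2}/\overline{d\Omega^0_{L^2}}$ is zero; and, without that assumption, its pairing with divergence-free fields is zero, that is $\int_M \iota_w(L_v\alpha)\,d\mu=0$ for every smooth divergence-free vector field $w$ with $|w|\in L^2(M,\mu)$ for which $\iota_w(L_v\alpha)$ is integrable. -/

import Mathlib

open Bundle Manifold MeasureTheory Set
open scoped ContDiff ENNReal

noncomputable section

namespace Riem

/-- The model space `ℝⁿ`. -/
abbrev Euc (n : ℕ) : Type := EuclideanSpace ℝ (Fin n)

section Charts

variable {n : ℕ} {M : Type*} [TopologicalSpace M] [ChartedSpace (Euc n) M]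
  [IsManifold (𝓡 n) ∞ M]

/-- The coordinate vector field `∂ᵢ` of the preferred chart at `x₀`, at the point `y`
(meaningful for `y` in the domain of that chart). -/
def frame (x₀ : M) (i : Fin n) (y : M) : TangentSpace (𝓡 n) y :=
  (trivializationAt (Euc n) (TangentSpace (𝓡 n)) x₀).symmL ℝ y (EuclideanSpace.single i 1)

/-- The coordinate 1-form `dxⁱ` of the preferred chart at `x₀`, at the point `y`. -/
def coframe (x₀ : M) (i : Fin n) (y : M) : TangentSpace (𝓡 n) y →L[ℝ] ℝ :=
  (EuclideanSpace.proj i : Euc n →L[ℝ] ℝ) ∘L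
    (trivializationAt (Euc n) (TangentSpace (𝓡 n)) x₀).continuousLinearMapAt ℝ y

/-- The partial derivative `∂ᵢ f` at `y`, in the preferred chart at `x₀`. -/
def pd (x₀ : M) (i : Fin n) (f : M → ℝ) (y : M) : ℝ :=
  mvfderiv (𝓡 n) f y (frame x₀ i y)

variable (n M) in
/-- The vector space of all (not necessarily continuous) 1-forms on `M`. -/
def OneForm : Type _ := (x : M) → TangentSpace (𝓡 n) x →L[ℝ] ℝ

instance : AddCommGroup (OneForm n M) :=
  inferInstanceAs (AddCommGroup ((x : M) → TangentSpace (𝓡 n) x →L[ℝ] ℝ))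

instance : Module ℝ (OneForm n M) :=
  inferInstanceAs (Module ℝ ((x : M) → TangentSpace (𝓡 n) x →L[ℝ] ℝ))

/-- `α` is a smooth (`C^∞`) differential 1-form on `M`. -/
def IsSmoothForm (α : OneForm n M) : Prop :=
  ContMDiff (𝓡 n) ((𝓡 n).prod 𝓘(ℝ, Euc n →L[ℝ] ℝ)) ∞
    (fun x ↦ TotalSpace.mk' (Euc n →L[ℝ] ℝ)
      (E := fun x : M ↦ TangentSpace (𝓡 n) x →L[ℝ] Bundle.Trivial M ℝ x) x (α x))

/-- `v` is a smooth (`C^∞`) vector field on `M`. -/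
def IsSmoothField (v : (x : M) → TangentSpace (𝓡 n) x) : Prop :=
  ContMDiff (𝓡 n) (𝓡 n).tangent ∞ (fun x ↦ (⟨x, v x⟩ : TangentBundle (𝓡 n) M))

/-- The exterior derivative of a 1-form, `dα = ∑ (∂ᵢ αⱼ - ∂ⱼ αᵢ) dxⁱ ⊗ dxʲ` (sum over all
`i, j`), evaluated on two tangent vectors. -/
def extD (α : OneForm n M) (x : M)
    (u w : TangentSpace (𝓡 n) x) : ℝ :=
  ∑ i, ∑ j, (pd x i (fun y ↦ α y (frame x j y)) x - pd x j (fun y ↦ α y (frame x i y)) x)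
    * coframe x i x u * coframe x j x w

/-- The Lie derivative of a 1-form along a vector field,
`(L_v α)ⱼ = ∑ᵢ (vⁱ ∂ᵢ αⱼ + αᵢ ∂ⱼ vⁱ)`. -/
def lieD (v : (x : M) → TangentSpace (𝓡 n) x)
    (α : OneForm n M) : OneForm n M := fun x ↦
  ∑ j, (∑ i, (coframe x i x (v x) * pd x i (fun y ↦ α y (frame x j y)) x
    + α x (frame x i x) * pd x j (fun y ↦ coframe x i y (v y)) x)) • coframe x j x

/-- The contraction `ι_v α`. -/
def contract (v : (x : M) → TangentSpace (𝓡 n) x)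
    (α : OneForm n M) (x : M) : ℝ := α x (v x)

end Charts

section Fiber

variable {n : ℕ} {M : Type*} [TopologicalSpace M] [ChartedSpace (Euc n) M]
  [RiemannianBundle (fun x : M ↦ TangentSpace (𝓡 n) x)]

theorem norm_smul_form (x : M) (β : TangentSpace (𝓡 n) x →L[ℝ] ℝ) (c : ℝ) :
    ‖c • β‖ ≤ |c| * ‖β‖ := by
  refine ContinuousLinearMap.opNorm_le_bound _ (by positivity) fun w ↦ ?_
  have h : (c • β) w = c * β w := rfl
  rw [h, norm_mul, mul_assoc]
  exact mul_le_mul_of_nonneg_left (β.le_opNorm w) (abs_nonneg c)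

end Fiber

section Metric

variable {n : ℕ} {M : Type*} [TopologicalSpace M] [ChartedSpace (Euc n) M]
  [IsManifold (𝓡 n) ∞ M] [RiemannianBundle (fun x : M ↦ TangentSpace (𝓡 n) x)]

/-- The matrix `(g_ij)` of the metric in the preferred chart at `x₀`, at the point `y`. -/
def gram (x₀ y : M) : Matrix (Fin n) (Fin n) ℝ :=
  Matrix.of fun i j ↦ inner ℝ (frame x₀ i y) (frame x₀ j y)

variable (n) in
/-- The volume density `√det (g_ij)` in the preferred chart at `x₀`. -/
def dens (x₀ y : M) : ℝ := √(gram (n := n) x₀ y).det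

/-- `v = α^♯`, the vector field that is dual to the 1-form `α`: `⟪v x, w⟫ = α x w`. -/
def sharp (α : OneForm n M) (x : M) : TangentSpace (𝓡 n) x :=
  haveI : FiniteDimensional ℝ (TangentSpace (𝓡 n) x) :=
    inferInstanceAs (FiniteDimensional ℝ (Euc n))
  haveI : CompleteSpace (TangentSpace (𝓡 n) x) := FiniteDimensional.complete ℝ _
  (InnerProductSpace.toDual ℝ (TangentSpace (𝓡 n) x)).symm (α x)

/-- The gradient of a function. -/
def grad (p : M → ℝ) (x : M) : TangentSpace (𝓡 n) x :=
  sharp (mvfderiv (𝓡 n) p) x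

/-- The Riemannian divergence, `div v = (det g)^(-1/2) ∑ᵢ ∂ᵢ ((det g)^(1/2) vⁱ)`. -/
def dvg (v : (x : M) → TangentSpace (𝓡 n) x) (x : M) : ℝ :=
  (dens n x x)⁻¹ * ∑ i, pd x i (fun y ↦ dens n x y * coframe x i y (v y)) x

/-- The codifferential of a 1-form, `δ α = - div α^♯`. -/
def codiff₁ (α : OneForm n M) (x : M) : ℝ := - dvg (sharp α) x

/-- The components `η^ij = ∑ g^ia g^jb η_ab` of a 2-form in the preferred chart at `x₀`. -/
def raised (η : (x : M) → TangentSpace (𝓡 n) x → TangentSpace (𝓡 n) x → ℝ)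
    (x₀ : M) (i j : Fin n) (y : M) : ℝ :=
  ∑ a, ∑ b, (gram x₀ y)⁻¹ i a * (gram x₀ y)⁻¹ j b * η y (frame x₀ a y) (frame x₀ b y)

/-- The codifferential of a 2-form,
`(δ η)_k = - ∑ g_kj (det g)^(-1/2) ∂ᵢ ((det g)^(1/2) η^ij)`, that is `(δ η)_k = - ∇^i η_ik`. -/
def codiff₂ (η : (x : M) → TangentSpace (𝓡 n) x → TangentSpace (𝓡 n) x → ℝ) :
    OneForm n M := fun x ↦
  ∑ k, (- ∑ j, gram x x k j * ((dens n x x)⁻¹ *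
    ∑ i, pd x i (fun y ↦ dens n x y * raised η x i j y) x)) • coframe x k x

/-- The Laplace-de Rham operator `Δ = dδ + δd` on 1-forms. -/
def hodgeLaplacian (α : OneForm n M) : OneForm n M := fun x ↦
  mvfderiv (𝓡 n) (codiff₁ α) x + codiff₂ (extD α) x

/-- `α` is a harmonic 1-form: it is smooth and `Δ α = 0`. -/
def IsHarmonicForm (α : OneForm n M) : Prop :=
  IsSmoothForm α ∧ ∀ x, hodgeLaplacian α x = 0

/-- The Christoffel symbol `Γ^k_ij` of the Levi-Civita connection in the preferred chart
at `x`, at the point `x`. -/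
def christoffel (x : M) (k i j : Fin n) : ℝ :=
  (1 / 2) * ∑ l, (gram x x)⁻¹ k l *
    (pd x i (fun y ↦ gram x y j l) x + pd x j (fun y ↦ gram x y i l) x
      - pd x l (fun y ↦ gram x y i j) x)

/-- The Levi-Civita covariant derivative `∇_u v`,
`(∇_u v)^k = ∑ uⁱ ∂ᵢ v^k + ∑ Γ^k_ij uⁱ vʲ`. -/
def covD (u v : (x : M) → TangentSpace (𝓡 n) x) (x : M) : TangentSpace (𝓡 n) x :=
  ∑ k, (∑ i, coframe x i x (u x) * pd x i (fun y ↦ coframe x k y (v y)) x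
    + ∑ i, ∑ j, christoffel x k i j * coframe x i x (u x) * coframe x j x (v x)) • frame x k x

/-- The time-dependent vector field `v` and the pressure `p` satisfy the Euler equations
`∂ₜ v + ∇_v v = - grad p`, `div v = 0` at all times. -/
def IsEulerSolution (v : ℝ → (x : M) → TangentSpace (𝓡 n) x) (p : ℝ → M → ℝ) : Prop :=
  ∀ t x, DifferentiableAt ℝ (fun s ↦ v s x) t ∧
    deriv (fun s ↦ v s x) t + covD (v t) (v t) x = - grad (p t) x ∧ dvg (v t) x = 0

/-- The smooth vector field `v` is a steady solution of the Euler equations. -/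
def IsSteadyEulerSolution (v : (x : M) → TangentSpace (𝓡 n) x) : Prop :=
  IsSmoothField v ∧
    ∃ p : M → ℝ, ContMDiff (𝓡 n) 𝓘(ℝ, ℝ) ∞ p ∧ IsEulerSolution (fun _ ↦ v) (fun _ ↦ p)

section Volume

variable [MeasurableSpace M]

variable (n) in
/-- The Riemannian volume of the domain of the preferred chart at `x₀`, as a measure on `M`:
the image of `√det (g_ij) dx¹ … dxⁿ`. -/
def chartVol (x₀ : M) : Measure M :=
  (((volume : Measure (Euc n)).restrict (extChartAt (𝓡 n) x₀).target).withDensity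
    (fun z ↦ ENNReal.ofReal (dens n x₀ ((extChartAt (𝓡 n) x₀).symm z)))).map
      (extChartAt (𝓡 n) x₀).symm

variable (n M) in
/-- The Riemannian volume measure `μ`: the least measure that dominates the chart measures
`chartVol x₀`. As these agree on overlaps, `μ` coincides with `chartVol x₀` on the domain of the
chart at `x₀` (on a second countable manifold). -/
def vol : Measure M := ⨆ x₀ : M, chartVol n x₀

/-- `‖β‖_{L²} ≤ r` for a 1-form `β`: the pointwise norm is bounded almost everywhere by a
(measurable) function of `L²` norm at most `r`. -/
def L2Bound (β : OneForm n M) (r : ℝ) : Prop :=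
  ∃ g : M → ℝ, MemLp g 2 (vol n M) ∧ eLpNorm g 2 (vol n M) ≤ ENNReal.ofReal r ∧
    ∀ᵐ x ∂(vol n M), ‖β x‖ ≤ g x

theorem L2Bound.add {β γ : OneForm n M} {r s : ℝ}
    (hr : 0 ≤ r) (hs : 0 ≤ s) (hβ : L2Bound β r) (hγ : L2Bound γ s) :
    L2Bound (β + γ) (r + s) := by
  obtain ⟨f, hf, hfr, hfb⟩ := hβ
  obtain ⟨g, hg, hgs, hgb⟩ := hγ
  refine ⟨f + g, hf.add hg, ?_, ?_⟩
  · rw [ENNReal.ofReal_add hr hs]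
    exact (eLpNorm_add_le hf.1 hg.1 (by norm_num)).trans (add_le_add hfr hgs)
  · filter_upwards [hfb, hgb] with x h1 h2
    exact (norm_add_le (β x) (γ x)).trans (add_le_add h1 h2)

theorem L2Bound.smul {β : OneForm n M} {r : ℝ}
    (c : ℝ) (hβ : L2Bound β r) : L2Bound (c • β) (|c| * r) := by
  obtain ⟨f, hf, hfr, hfb⟩ := hβ
  refine ⟨|c| • f, hf.const_smul |c|, ?_, ?_⟩
  · rw [eLpNorm_const_smul, ENNReal.ofReal_mul (abs_nonneg c)]
    gcongr
    rw [Real.enorm_eq_ofReal_abs, abs_abs]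
  · filter_upwards [hfb] with x h1
    exact (norm_smul_form x (β x) c).trans (mul_le_mul_of_nonneg_left h1 (abs_nonneg c))

theorem L2Bound.zero {r : ℝ} :
    L2Bound (0 : OneForm n M) r :=
  ⟨0, MemLp.zero, by simp, Filter.Eventually.of_forall fun _ ↦
    ContinuousLinearMap.opNorm_zero.le⟩

variable (n M) in
/-- `Ω¹_{L²}`: the measurable square-integrable 1-forms. Measurability means that the components
in each chart are measurable functions. Forms are not identified almost everywhere here; forms
that vanish almost everywhere are zero in the quotient `EulerDual` below. -/
def L2Form : Submodule ℝ (OneForm n M) where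
  carrier := {β | (∀ (x₀ : M) (i : Fin n), AEMeasurable (fun y ↦ β y (frame x₀ i y))
    ((vol n M).restrict (chartAt (Euc n) x₀).source)) ∧ ∃ r, 0 ≤ r ∧ L2Bound β r}
  add_mem' := by
    rintro β γ ⟨h1, r, hr, h2⟩ ⟨h3, s, hs, h4⟩
    exact ⟨fun x₀ i ↦ (h1 x₀ i).add (h3 x₀ i), r + s, add_nonneg hr hs, h2.add hr hs h4⟩
  zero_mem' := ⟨fun _ _ ↦ aemeasurable_const, 0, le_rfl, L2Bound.zero⟩
  smul_mem' := by
    rintro c β ⟨h1, r, hr, h2⟩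
    exact ⟨fun x₀ i ↦ (h1 x₀ i).const_smul c, |c| * r, mul_nonneg (abs_nonneg c) hr, h2.smul c⟩

/-- `β ∈ dΩ⁰_{L²}`: `β` is the differential of a smooth function in `L²`. -/
def IsL2Exact (β : OneForm n M) : Prop :=
  ∃ f : M → ℝ, ContMDiff (𝓡 n) 𝓘(ℝ, ℝ) ∞ f ∧ MemLp f 2 (vol n M) ∧
    ∀ x, β x = mvfderiv (𝓡 n) f x

theorem IsL2Exact.add {β γ : OneForm n M}
    (hβ : IsL2Exact β) (hγ : IsL2Exact γ) : IsL2Exact (β + γ) := by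
  obtain ⟨f, hf, hf2, hfd⟩ := hβ
  obtain ⟨g, hg, hg2, hgd⟩ := hγ
  refine ⟨f + g, hf.add hg, hf2.add hg2, fun x ↦ ?_⟩
  have h1 : (β + γ) x = β x + γ x := rfl
  rw [mvfderiv_add (hf.mdifferentiable (by simp) x) (hg.mdifferentiable (by simp) x)]
  exact h1.trans (by rw [hfd, hgd])

theorem IsL2Exact.smul {β : OneForm n M} (c : ℝ)
    (hβ : IsL2Exact β) : IsL2Exact (c • β) := by
  obtain ⟨f, hf, hf2, hfd⟩ := hβ
  refine ⟨(fun _ : M ↦ c) • f, ContMDiff.smul (contMDiff_const (I' := 𝓘(ℝ, ℝ))) hf,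
    hf2.const_smul c, fun x ↦ ?_⟩
  have h1 : (c • β) x = c • β x := rfl
  rw [mvfderiv_smul mdifferentiableAt_const (hf.mdifferentiable (by simp) x)]
  refine h1.trans ?_
  rw [hfd]
  simp [mvfderiv, mfderiv_const]

theorem IsL2Exact.zero : IsL2Exact (0 : OneForm n M) :=
  ⟨0, contMDiff_const, MemLp.zero, fun _ ↦ mvfderiv_zero.symm⟩

variable (n M) in
/-- The closure of `dΩ⁰_{L²}` in `Ω¹_{L²}` for the `L²` norm. -/
def closureExact : Submodule ℝ (L2Form n M) where
  carrier := {β | ∀ ε : ℝ, 0 < ε → ∃ γ : L2Form n M, IsL2Exact γ.1 ∧ L2Bound (β.1 - γ.1) ε}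
  add_mem' := by
    intro β β' h h' ε hε
    obtain ⟨γ, hγ, hb⟩ := h (ε / 2) (half_pos hε)
    obtain ⟨γ', hγ', hb'⟩ := h' (ε / 2) (half_pos hε)
    refine ⟨γ + γ', hγ.add hγ', ?_⟩
    have h3 := L2Bound.add (half_pos hε).le (half_pos hε).le hb hb'
    have h4 : β.1 - γ.1 + (β'.1 - γ'.1) = (β + β').1 - (γ + γ').1 :=
      (add_sub_add_comm β.1 β'.1 γ.1 γ'.1).symm
    rw [add_halves, h4] at h3
    exact h3
  zero_mem' := by
    intro ε hε
    have h3 : L2Bound (0 - 0 : OneForm n M) ε := by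
      rw [sub_zero]
      exact L2Bound.zero
    exact ⟨0, IsL2Exact.zero, h3⟩
  smul_mem' := by
    intro c β h ε hε
    have hc : 0 < |c| + 1 := by positivity
    obtain ⟨γ, hγ, g, hg, hgε, hgb⟩ := h (ε / (|c| + 1)) (div_pos hε hc)
    have hb : L2Bound (β.1 - γ.1) (ε / (|c| + 1)) := ⟨g, hg, hgε, hgb⟩
    obtain ⟨k, hk, hkε, hkb⟩ := hb.smul c
    refine ⟨c • γ, hγ.smul c, k, hk, hkε.trans (ENNReal.ofReal_le_ofReal ?_), ?_⟩
    · rw [← mul_div_assoc, div_le_iff₀ hc]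
      nlinarith [abs_nonneg c]
    · have h3 : (c • β : L2Form n M).1 - (c • γ : L2Form n M).1 = c • (β.1 - γ.1) :=
        (smul_sub c β.1 γ.1).symm
      rw [h3]
      exact hkb

variable (n M) in
/-- The space `Ω¹_{L²} / closure (dΩ⁰_{L²})`, in which the Euler equation reads
`d/dt [v^♭] = - L_v [v^♭]`. -/
abbrev EulerDual := L2Form n M ⧸ closureExact n M

end Volume

end Metric

end Riem

end

/-!
Let `α` be harmonic and `v = α^♯`. The divergence of `ι_v dα + (div v) v` (up to signs) is the
energy density `|dα|² + |δα|²`, and the norm of this field is at most `2 |α|` times the square root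
of the energy density. On a complete manifold there are compactly supported cutoff functions `φ`
converging to `1` with slopes `K` tending to `0`; integrating against `φ²` and absorbing half of the
energy gives `∫ φ² (|dα|² + |δα|²) ≤ 16 K² ∫ |α|²`. Hence `α ∈ L²` forces `dα = 0` and `δα = 0`.

For a closed form `L_v α = d |α|²` and `∇_v v = grad |α|² / 2`, so that `-|α|² / 2` is a pressure.
The same cutoff functions give Gaffney's theorem: `∫ div X = 0` if `X` and `div X` are integrable.
For `X = |α|² w` with `div w = 0` this says that the pairing of `L_v α` with `w` vanishes.
-/

noncomputable section

namespace Riem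

section ChartCalculus

variable {n : ℕ} {M : Type*} [TopologicalSpace M] [ChartedSpace (Euc n) M]

/-- Smoothness of a real-valued function at a point of a manifold modelled on `ℝⁿ`; the dimension
is explicit because it cannot be inferred from `f`. -/
abbrev SmoothAt (n : ℕ) {M : Type*} [TopologicalSpace M] [ChartedSpace (Euc n) M]
    (f : M → ℝ) (y : M) : Prop := ContMDiffAt (𝓡 n) 𝓘(ℝ, ℝ) ∞ f y

theorem SmoothAt.mdifferentiableAt {f : M → ℝ} {y : M} (hf : SmoothAt n f y) :
    MDifferentiableAt (𝓡 n) 𝓘(ℝ, ℝ) f y :=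
  ContMDiffAt.mdifferentiableAt hf (by simp)

theorem SmoothAt.mul {f g : M → ℝ} {y : M} (hf : SmoothAt n f y) (hg : SmoothAt n g y) :
    SmoothAt n (fun z ↦ f z * g z) y :=
  ContMDiffAt.mul hf hg

theorem SmoothAt.sum {ι : Type*} {s : Finset ι} {f : ι → M → ℝ} {y : M}
    (hf : ∀ i ∈ s, SmoothAt n (f i) y) : SmoothAt n (fun z ↦ ∑ i ∈ s, f i z) y :=
  contMDiffAt_finsetSum hf

theorem mem_extChartAt_source_of_mem {x₀ y : M} (hy : y ∈ (chartAt (Euc n) x₀).source) :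
    y ∈ (extChartAt (𝓡 n) x₀).source := by
  rwa [extChartAt_source]

theorem mvfderiv_congr {f g : M → ℝ} {y : M} (h : f =ᶠ[nhds y] g) :
    mvfderiv (𝓡 n) f y = mvfderiv (𝓡 n) g y := by
  ext w
  change mfderiv (𝓡 n) 𝓘(ℝ, ℝ) f y w = mfderiv (𝓡 n) 𝓘(ℝ, ℝ) g y w
  rw [h.mfderiv_eq]
  rfl

theorem mvfderiv_eq_zero_of_notMem_tsupport {f : M → ℝ} {y : M} (hy : y ∉ tsupport f) :
    mvfderiv (𝓡 n) f y = 0 := by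
  rw [mvfderiv_congr (g := fun _ ↦ 0) (notMem_tsupport_iff_eventuallyEq.1 hy), mvfderiv_const]

theorem mvfderiv_sum {ι : Type*} (s : Finset ι) {f : ι → M → ℝ} {y : M}
    (h : ∀ i ∈ s, MDifferentiableAt (𝓡 n) 𝓘(ℝ, ℝ) (f i) y) (w : TangentSpace (𝓡 n) y) :
    mvfderiv (𝓡 n) (fun z ↦ ∑ i ∈ s, f i z) y w = ∑ i ∈ s, mvfderiv (𝓡 n) (f i) y w := by
  classical
  suffices hsum : MDifferentiableAt (𝓡 n) 𝓘(ℝ, ℝ) (fun z ↦ ∑ i ∈ s, f i z) y ∧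
      mvfderiv (𝓡 n) (fun z ↦ ∑ i ∈ s, f i z) y w = ∑ i ∈ s, mvfderiv (𝓡 n) (f i) y w from hsum.2
  induction s using Finset.induction_on with
  | empty =>
    simp only [Finset.sum_empty, mvfderiv_const]
    exact ⟨mdifferentiableAt_const, rfl⟩
  | insert a s ha ih =>
    obtain ⟨hs, hw⟩ := ih fun i hi ↦ h i (Finset.mem_insert_of_mem hi)
    have hfa := h a (Finset.mem_insert_self a s)
    simp only [Finset.sum_insert ha, mvfderiv_fun_add hfa hs, ← hw]
    exact ⟨hfa.add hs, rfl⟩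

variable [IsManifold (𝓡 n) ∞ M]

theorem continuousLinearMapAt_frame {x₀ y : M} (hy : y ∈ (chartAt (Euc n) x₀).source)
    (i : Fin n) :
    (trivializationAt (Euc n) (TangentSpace (𝓡 n)) x₀).continuousLinearMapAt ℝ y (frame x₀ i y)
      = EuclideanSpace.single i 1 :=
  Trivialization.continuousLinearMapAt_symmL _ hy _

theorem continuousLinearMapAt_eq_sum_coframe (x₀ : M) {y : M} (w : TangentSpace (𝓡 n) y) :
    (trivializationAt (Euc n) (TangentSpace (𝓡 n)) x₀).continuousLinearMapAt ℝ y w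
      = ∑ i, coframe x₀ i y w • EuclideanSpace.single i (1 : ℝ) :=
  ((EuclideanSpace.basisFun (Fin n) ℝ).sum_repr _).symm.trans
    (Finset.sum_congr rfl fun i _ ↦ by rw [EuclideanSpace.basisFun_apply]; rfl)

theorem coframe_frame {x₀ y : M} (hy : y ∈ (chartAt (Euc n) x₀).source) (i j : Fin n) :
    coframe x₀ i y (frame x₀ j y) = if i = j then 1 else 0 := by
  rw [coframe, ContinuousLinearMap.comp_apply, continuousLinearMapAt_frame hy]
  simp

theorem sum_coframe_smul_frame {x₀ y : M} (hy : y ∈ (chartAt (Euc n) x₀).source)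
    (w : TangentSpace (𝓡 n) y) : ∑ i, coframe x₀ i y w • frame x₀ i y = w := by
  rw [← (trivializationAt (Euc n) (TangentSpace (𝓡 n)) x₀).symmL_continuousLinearMapAt
    (R := ℝ) (b := y) hy w]
  conv_rhs => rw [continuousLinearMapAt_eq_sum_coframe, map_sum]
  exact Finset.sum_congr rfl fun i _ ↦ by
    rw [map_smul, Trivialization.symmL_continuousLinearMapAt _ hy]
    rfl

theorem clm_apply_eq_sum {x₀ y : M} (hy : y ∈ (chartAt (Euc n) x₀).source)
    (β : TangentSpace (𝓡 n) y →L[ℝ] ℝ) (w : TangentSpace (𝓡 n) y) :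
    β w = ∑ i, coframe x₀ i y w * β (frame x₀ i y) := by
  conv_lhs => rw [← sum_coframe_smul_frame hy w, map_sum]
  exact Finset.sum_congr rfl fun i _ ↦ map_smul _ _ _

theorem clm_ext_frame {x₀ y : M} (hy : y ∈ (chartAt (Euc n) x₀).source)
    {β γ : TangentSpace (𝓡 n) y →L[ℝ] ℝ} (h : ∀ i, β (frame x₀ i y) = γ (frame x₀ i y)) :
    β = γ := by
  ext w
  rw [clm_apply_eq_sum hy β, clm_apply_eq_sum hy γ]
  simp only [h]

theorem mdifferentiableAt_iff_differentiableAt_chart {x₀ y : M}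
    (hy : y ∈ (chartAt (Euc n) x₀).source) {f : M → ℝ} :
    MDifferentiableAt (𝓡 n) 𝓘(ℝ, ℝ) f y ↔
      DifferentiableAt ℝ (f ∘ (extChartAt (𝓡 n) x₀).symm) (extChartAt (𝓡 n) x₀ y) := by
  rw [mdifferentiableAt_iff_source_of_mem_source hy, ← mdifferentiableAt_iff_differentiableAt,
    modelWithCornersSelf_coe, range_id, mdifferentiableWithinAt_univ]

theorem smoothAt_iff_contDiffAt_chart {x₀ y : M} (hy : y ∈ (chartAt (Euc n) x₀).source)
    {f : M → ℝ} :
    SmoothAt n f y ↔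
      ContDiffAt ℝ ∞ (f ∘ (extChartAt (𝓡 n) x₀).symm) (extChartAt (𝓡 n) x₀ y) := by
  rw [SmoothAt, contMDiffAt_iff_source_of_mem_source hy, ← contMDiffAt_iff_contDiffAt,
    modelWithCornersSelf_coe, range_id, contMDiffWithinAt_univ]

-- Where `f` is not differentiable, both sides are `0`.
theorem mvfderiv_eq_fderiv_chart {x₀ y : M} (hy : y ∈ (chartAt (Euc n) x₀).source) (f : M → ℝ)
    (w : TangentSpace (𝓡 n) y) :
    mvfderiv (𝓡 n) f y w = fderiv ℝ (f ∘ (extChartAt (𝓡 n) x₀).symm) (extChartAt (𝓡 n) x₀ y)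
      ((trivializationAt (Euc n) (TangentSpace (𝓡 n)) x₀).continuousLinearMapAt ℝ y w) := by
  by_cases hf : MDifferentiableAt (𝓡 n) 𝓘(ℝ, ℝ) f y
  · have hfc := (mdifferentiableAt_iff_differentiableAt_chart hy).1 hf
    have hev : f =ᶠ[nhds y] (f ∘ (extChartAt (𝓡 n) x₀).symm) ∘ extChartAt (𝓡 n) x₀ := by
      filter_upwards [(isOpen_extChartAt_source x₀).mem_nhds (mem_extChartAt_source_of_mem hy)]
        with z hz
      exact (congrArg f ((extChartAt (𝓡 n) x₀).left_inv hz)).symm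
    rw [mvfderiv_congr hev, mvfderiv_comp_apply y hfc.mdifferentiableAt
      (mdifferentiableAt_extChartAt hy), TangentBundle.continuousLinearMapAt_trivializationAt hy]
    change mfderiv _ _ _ _ _ = _
    rw [mfderiv_eq_fderiv]
    rfl
  · have hfc := mt (mdifferentiableAt_iff_differentiableAt_chart hy).2 hf
    rw [fderiv_zero_of_not_differentiableAt hfc]
    change mfderiv _ _ _ _ _ = _
    rw [mfderiv_zero_of_not_mdifferentiableAt hf]
    rfl

theorem pd_eq_fderiv {x₀ y : M} (hy : y ∈ (chartAt (Euc n) x₀).source) (i : Fin n) (f : M → ℝ) :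
    pd x₀ i f y = fderiv ℝ (f ∘ (extChartAt (𝓡 n) x₀).symm) (extChartAt (𝓡 n) x₀ y)
      (EuclideanSpace.single i 1) := by
  rw [pd, mvfderiv_eq_fderiv_chart hy, continuousLinearMapAt_frame hy]

theorem mvfderiv_eq_sum_pd {x₀ y : M} (hy : y ∈ (chartAt (Euc n) x₀).source) (f : M → ℝ)
    (w : TangentSpace (𝓡 n) y) :
    mvfderiv (𝓡 n) f y w = ∑ i, coframe x₀ i y w * pd x₀ i f y :=
  clm_apply_eq_sum hy _ w

theorem pd_comp_symm_eventuallyEq {x₀ y : M} (hy : y ∈ (chartAt (Euc n) x₀).source) (i : Fin n)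
    (f : M → ℝ) :
    pd x₀ i f ∘ (extChartAt (𝓡 n) x₀).symm =ᶠ[nhds (extChartAt (𝓡 n) x₀ y)]
      fun z ↦ fderiv ℝ (f ∘ (extChartAt (𝓡 n) x₀).symm) z (EuclideanSpace.single i 1) := by
  filter_upwards [(isOpen_extChartAt_target x₀).mem_nhds
    ((extChartAt (𝓡 n) x₀).map_source (mem_extChartAt_source_of_mem hy))] with z hz
  have hz' : (extChartAt (𝓡 n) x₀).symm z ∈ (chartAt (Euc n) x₀).source := by
    simpa only [extChartAt_source] using (extChartAt (𝓡 n) x₀).map_target hz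
  rw [Function.comp_apply, pd_eq_fderiv hz', (extChartAt (𝓡 n) x₀).right_inv hz]

theorem SmoothAt.pd {x₀ y : M} (hy : y ∈ (chartAt (Euc n) x₀).source) {f : M → ℝ}
    (hf : SmoothAt n f y) (i : Fin n) : SmoothAt n (pd x₀ i f) y := by
  rw [smoothAt_iff_contDiffAt_chart hy] at hf ⊢
  exact ((hf.fderiv_right (m := ∞) (by simp)).clm_apply contDiffAt_const).congr_of_eventuallyEq
    (pd_comp_symm_eventuallyEq hy i f)

theorem pd_pd_comm {x₀ y : M} (hy : y ∈ (chartAt (Euc n) x₀).source) {f : M → ℝ}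
    (hf : SmoothAt n f y) (i j : Fin n) : pd x₀ i (pd x₀ j f) y = pd x₀ j (pd x₀ i f) y := by
  rw [smoothAt_iff_contDiffAt_chart hy] at hf
  have pd_pd : ∀ a b : Fin n, pd x₀ a (pd x₀ b f) y
      = fderiv ℝ (fderiv ℝ (f ∘ (extChartAt (𝓡 n) x₀).symm)) (extChartAt (𝓡 n) x₀ y)
        (EuclideanSpace.single a 1) (EuclideanSpace.single b 1) := by
    intro a b
    rw [pd_eq_fderiv hy, (pd_comp_symm_eventuallyEq hy b f).fderiv_eq,
      fderiv_clm_apply ((hf.fderiv_right (m := ∞) (by simp)).differentiableAt (by simp))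
        (differentiableAt_const _)]
    simp
  rw [pd_pd, pd_pd]
  exact hf.isSymmSndFDerivAt (by simpa using ENat.LEInfty.out) _ _

theorem pd_congr {x₀ y : M} {f g : M → ℝ} (h : f =ᶠ[nhds y] g) (i : Fin n) :
    pd x₀ i f y = pd x₀ i g y := by
  rw [pd, pd, mvfderiv_congr h]

theorem pd_const (x₀ y : M) (c : ℝ) (i : Fin n) : pd x₀ i (fun _ ↦ c) y = 0 := by
  rw [pd, mvfderiv_const]
  rfl

theorem pd_add {x₀ y : M} {f g : M → ℝ} (hf : MDifferentiableAt (𝓡 n) 𝓘(ℝ, ℝ) f y)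
    (hg : MDifferentiableAt (𝓡 n) 𝓘(ℝ, ℝ) g y) (i : Fin n) :
    pd x₀ i (fun z ↦ f z + g z) y = pd x₀ i f y + pd x₀ i g y := by
  change mvfderiv (𝓡 n) (f + g) y _ = _
  rw [mvfderiv_add hf hg]
  rfl

theorem pd_mul {x₀ y : M} {f g : M → ℝ} (hf : MDifferentiableAt (𝓡 n) 𝓘(ℝ, ℝ) f y)
    (hg : MDifferentiableAt (𝓡 n) 𝓘(ℝ, ℝ) g y) (i : Fin n) :
    pd x₀ i (fun z ↦ f z * g z) y = f y * pd x₀ i g y + g y * pd x₀ i f y := by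
  change mvfderiv (𝓡 n) (f * g) y _ = _
  rw [mvfderiv_mul hf hg]
  rfl

theorem pd_sum {ι : Type*} (s : Finset ι) {f : ι → M → ℝ} {x₀ y : M}
    (h : ∀ i ∈ s, MDifferentiableAt (𝓡 n) 𝓘(ℝ, ℝ) (f i) y) (j : Fin n) :
    pd x₀ j (fun z ↦ ∑ i ∈ s, f i z) y = ∑ i ∈ s, pd x₀ j (f i) y :=
  mvfderiv_sum s h _

end ChartCalculus

section SmoothSections

variable {n : ℕ} {M : Type*} [TopologicalSpace M] [ChartedSpace (Euc n) M]
  [IsManifold (𝓡 n) ∞ M]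

theorem eventually_trivialization_eq_continuousLinearMapAt {x₀ y : M}
    (hy : y ∈ (chartAt (Euc n) x₀).source) (v : (x : M) → TangentSpace (𝓡 n) x) :
    (fun z ↦ (trivializationAt (Euc n) (TangentSpace (𝓡 n)) x₀
        (⟨z, v z⟩ : TangentBundle (𝓡 n) M)).2) =ᶠ[nhds y]
      fun z ↦ (trivializationAt (Euc n) (TangentSpace (𝓡 n)) x₀).continuousLinearMapAt ℝ z
        (v z) := by
  filter_upwards [(chartAt (Euc n) x₀).open_source.mem_nhds hy] with z hz
  exact (Trivialization.continuousLinearMapAt_apply_of_mem (R := ℝ) _ hz _).symm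

theorem contMDiffAt_field_iff {x₀ y : M} (hy : y ∈ (chartAt (Euc n) x₀).source)
    (v : (x : M) → TangentSpace (𝓡 n) x) :
    ContMDiffAt (𝓡 n) (𝓡 n).tangent ∞ (fun z ↦ (⟨z, v z⟩ : TangentBundle (𝓡 n) M)) y ↔
      ∀ i, SmoothAt n (fun z ↦ coframe x₀ i z (v z)) y := by
  have hsection := (trivializationAt (Euc n) (TangentSpace (𝓡 n)) x₀).contMDiffAt_section_iff
    (IB := 𝓡 n) (n := ∞) (s := v) hy
  rw [hsection, (eventually_trivialization_eq_continuousLinearMapAt hy v).contMDiffAt_iff]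
  constructor
  · exact fun h i ↦
      ((EuclideanSpace.proj i : Euc n →L[ℝ] ℝ).contMDiff.contMDiffAt).comp y h
  · intro h
    simp only [continuousLinearMapAt_eq_sum_coframe]
    exact contMDiffAt_finsetSum fun i _ ↦ (h i).smul contMDiffAt_const

theorem contMDiffAt_frame {x₀ y : M} (hy : y ∈ (chartAt (Euc n) x₀).source) (i : Fin n) :
    ContMDiffAt (𝓡 n) (𝓡 n).tangent ∞
      (fun z ↦ (⟨z, frame x₀ i z⟩ : TangentBundle (𝓡 n) M)) y := by
  refine (contMDiffAt_field_iff hy _).2 fun j ↦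
    (contMDiffAt_const (c := if j = i then 1 else 0)).congr_of_eventuallyEq ?_
  filter_upwards [(chartAt (Euc n) x₀).open_source.mem_nhds hy] with z hz
  exact coframe_frame hz j i

theorem IsSmoothField.smoothAt_coframe {v : (x : M) → TangentSpace (𝓡 n) x}
    (hv : IsSmoothField v) {x₀ y : M} (hy : y ∈ (chartAt (Euc n) x₀).source) (i : Fin n) :
    SmoothAt n (fun z ↦ coframe x₀ i z (v z)) y :=
  (contMDiffAt_field_iff hy v).1 (hv y) i

theorem isSmoothField_of_coframe {v : (x : M) → TangentSpace (𝓡 n) x}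
    (h : ∀ (y : M) (i : Fin n), SmoothAt n (fun z ↦ coframe y i z (v z)) y) :
    IsSmoothField v :=
  fun y ↦ (contMDiffAt_field_iff (mem_chart_source _ y) v).2 (h y)

theorem IsSmoothForm.smoothAt_frame {α : OneForm n M}
    (hα : IsSmoothForm α) {x₀ y : M} (hy : y ∈ (chartAt (Euc n) x₀).source) (i : Fin n) :
    SmoothAt n (fun z ↦ α z (frame x₀ i z)) y :=
  (contMDiffAt_section (F := ℝ) (E := Bundle.Trivial M ℝ) _).1 <|
    ContMDiffAt.clm_bundle_apply (F₁ := Euc n) (F₂ := ℝ) (IB := 𝓡 n) (IM := 𝓡 n)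
      (E₁ := fun x : M ↦ TangentSpace (𝓡 n) x) (E₂ := Bundle.Trivial M ℝ) (b := fun x : M ↦ x)
      (hα y) (contMDiffAt_frame hy i)

end SmoothSections

section ExteriorDerivative

variable {n : ℕ} {M : Type*} [TopologicalSpace M] [ChartedSpace (Euc n) M]
  [IsManifold (𝓡 n) ∞ M]

variable (n) in
/-- The `k`-th coordinate function of the preferred chart at `x₀`. -/
def coord (x₀ : M) (k : Fin n) (y : M) : ℝ :=
  extChartAt (𝓡 n) x₀ y k

theorem smoothAt_coord {x₀ y : M} (hy : y ∈ (chartAt (Euc n) x₀).source) (k : Fin n) :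
    SmoothAt n (coord n x₀ k) y :=
  ((EuclideanSpace.proj k : Euc n →L[ℝ] ℝ).contMDiff.contMDiffAt).comp y
    (contMDiffAt_extChartAt' hy)

theorem pd_coord {x₀ y : M} (hy : y ∈ (chartAt (Euc n) x₀).source) (j k : Fin n) :
    pd x₀ j (coord n x₀ k) y = if k = j then 1 else 0 := by
  have hproj : coord n x₀ k ∘ (extChartAt (𝓡 n) x₀).symm =ᶠ[nhds (extChartAt (𝓡 n) x₀ y)]
      (EuclideanSpace.proj k : Euc n →L[ℝ] ℝ) := by
    filter_upwards [(isOpen_extChartAt_target x₀).mem_nhds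
      ((extChartAt (𝓡 n) x₀).map_source (mem_extChartAt_source_of_mem hy))] with z hz
    exact congrArg (fun u : Euc n ↦ u k) ((extChartAt (𝓡 n) x₀).right_inv hz)
  rw [pd_eq_fderiv hy, hproj.fderiv_eq, ContinuousLinearMap.fderiv]
  simp

theorem mvfderiv_coord {x₀ y : M} (hy : y ∈ (chartAt (Euc n) x₀).source) (k : Fin n) :
    mvfderiv (𝓡 n) (coord n x₀ k) y = coframe x₀ k y := by
  ext w
  rw [mvfderiv_eq_sum_pd hy]
  simp [pd_coord hy]

/-- The exterior derivative of a 1-form, computed at `y` in the preferred chart at `x₀`; `extD`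
is the case `x₀ = y`. -/
def chartExtD (α : OneForm n M) (x₀ y : M) (u w : TangentSpace (𝓡 n) y) : ℝ :=
  ∑ i, ∑ j, (pd x₀ i (fun z ↦ α z (frame x₀ j z)) y - pd x₀ j (fun z ↦ α z (frame x₀ i z)) y)
    * coframe x₀ i y u * coframe x₀ j y w

theorem form_frame_eq_sum_coord (α : OneForm n M) {x₀ x₁ y : M}
    (hy : y ∈ (chartAt (Euc n) x₀).source) (j : Fin n) :
    α y (frame x₁ j y) = ∑ k, α y (frame x₀ k y) * pd x₁ j (coord n x₀ k) y := by
  rw [clm_apply_eq_sum hy (α y)]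
  exact Finset.sum_congr rfl fun k _ ↦ by rw [pd, mvfderiv_coord hy, mul_comm]

theorem pd_form_frame {α : OneForm n M} (hα : IsSmoothForm α) {x₀ x₁ y : M}
    (hy : y ∈ (chartAt (Euc n) x₀).source) (hy₁ : y ∈ (chartAt (Euc n) x₁).source)
    (i j : Fin n) :
    pd x₁ i (fun z ↦ α z (frame x₁ j z)) y =
      ∑ k, (α y (frame x₀ k y) * pd x₁ i (pd x₁ j (coord n x₀ k)) y +
        pd x₁ j (coord n x₀ k) y * pd x₁ i (fun z ↦ α z (frame x₀ k z)) y) := by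
  have hexpand : (fun z ↦ α z (frame x₁ j z)) =ᶠ[nhds y]
      fun z ↦ ∑ k, α z (frame x₀ k z) * pd x₁ j (coord n x₀ k) z := by
    filter_upwards [(chartAt (Euc n) x₀).open_source.mem_nhds hy] with z hz
    exact form_frame_eq_sum_coord α hz j
  have hα' := fun k ↦ hα.smoothAt_frame hy k
  have hcoord := fun k ↦ (smoothAt_coord hy k).pd hy₁ j
  rw [pd_congr hexpand, pd_sum _ fun k _ ↦ ((hα' k).mul (hcoord k)).mdifferentiableAt]
  exact Finset.sum_congr rfl fun k _ ↦
    pd_mul (hα' k).mdifferentiableAt (hcoord k).mdifferentiableAt i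

-- The right-hand side is `∑ₖ dαₖ ∧ dxᵏ` in the chart at `x₀`: it does not mention `x₁`.
theorem chartExtD_eq_sum_wedge {α : OneForm n M} (hα : IsSmoothForm α) {x₀ x₁ y : M}
    (hy : y ∈ (chartAt (Euc n) x₀).source) (hy₁ : y ∈ (chartAt (Euc n) x₁).source)
    (u w : TangentSpace (𝓡 n) y) :
    chartExtD α x₁ y u w = ∑ k,
      (mvfderiv (𝓡 n) (fun z ↦ α z (frame x₀ k z)) y u * mvfderiv (𝓡 n) (coord n x₀ k) y w -
       mvfderiv (𝓡 n) (fun z ↦ α z (frame x₀ k z)) y w * mvfderiv (𝓡 n) (coord n x₀ k) y u) := by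
  have hcoeff : ∀ i j, pd x₁ i (fun z ↦ α z (frame x₁ j z)) y
      - pd x₁ j (fun z ↦ α z (frame x₁ i z)) y =
      ∑ k, (pd x₁ j (coord n x₀ k) y * pd x₁ i (fun z ↦ α z (frame x₀ k z)) y -
        pd x₁ i (coord n x₀ k) y * pd x₁ j (fun z ↦ α z (frame x₀ k z)) y) := by
    intro i j
    rw [pd_form_frame hα hy hy₁, pd_form_frame hα hy hy₁, ← Finset.sum_sub_distrib]
    refine Finset.sum_congr rfl fun k _ ↦ ?_
    rw [pd_pd_comm hy₁ (smoothAt_coord hy k) i j]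
    ring
  simp only [chartExtD, hcoeff, mvfderiv_eq_sum_pd hy₁, Finset.sum_mul_sum]
  simp only [Finset.sum_mul]
  rw [Finset.sum_congr rfl fun i _ ↦ Finset.sum_comm, Finset.sum_comm]
  refine Finset.sum_congr rfl fun k _ ↦ ?_
  rw [Finset.sum_comm (f := fun i j ↦ coframe x₁ i y w * _ * _), ← Finset.sum_sub_distrib]
  refine Finset.sum_congr rfl fun i _ ↦ ?_
  rw [← Finset.sum_sub_distrib]
  exact Finset.sum_congr rfl fun j _ ↦ by ring

theorem extD_eq_chartExtD {α : OneForm n M} (hα : IsSmoothForm α) {x₀ y : M}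
    (hy : y ∈ (chartAt (Euc n) x₀).source) (u w : TangentSpace (𝓡 n) y) :
    extD α y u w = chartExtD α x₀ y u w :=
  (chartExtD_eq_sum_wedge hα hy (mem_chart_source _ y) u w).trans
    (chartExtD_eq_sum_wedge hα hy hy u w).symm

theorem extD_frame {α : OneForm n M} (hα : IsSmoothForm α) {x₀ y : M}
    (hy : y ∈ (chartAt (Euc n) x₀).source) (a b : Fin n) :
    extD α y (frame x₀ a y) (frame x₀ b y) =
      pd x₀ a (fun z ↦ α z (frame x₀ b z)) y - pd x₀ b (fun z ↦ α z (frame x₀ a z)) y := by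
  rw [extD_eq_chartExtD hα hy, chartExtD]
  simp [coframe_frame hy]

theorem smoothAt_extD_frame {α : OneForm n M} (hα : IsSmoothForm α) {x₀ y : M}
    (hy : y ∈ (chartAt (Euc n) x₀).source) (a b : Fin n) :
    SmoothAt n (fun z ↦ extD α z (frame x₀ a z) (frame x₀ b z)) y := by
  refine (ContMDiffAt.sub ((hα.smoothAt_frame hy b).pd hy a)
    ((hα.smoothAt_frame hy a).pd hy b)).congr_of_eventuallyEq ?_
  filter_upwards [(chartAt (Euc n) x₀).open_source.mem_nhds hy] with z hz
  exact extD_frame hα hz a b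

/-- The 1-form `u ↦ dα(u, w)`, which makes the linearity of `extD` in its first argument
available. -/
def extDLeft (α : OneForm n M) (x : M) (w : TangentSpace (𝓡 n) x) :
    TangentSpace (𝓡 n) x →L[ℝ] ℝ :=
  ∑ i, (∑ j, (pd x i (fun y ↦ α y (frame x j y)) x - pd x j (fun y ↦ α y (frame x i y)) x)
    * coframe x j x w) • coframe x i x

theorem extDLeft_apply (α : OneForm n M) (x : M) (u w : TangentSpace (𝓡 n) x) :
    extDLeft α x w u = extD α x u w := by
  rw [extDLeft, sum_apply, extD]
  refine Finset.sum_congr rfl fun i _ ↦ ?_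
  rw [smul_apply, smul_eq_mul, Finset.sum_mul]
  exact Finset.sum_congr rfl fun j _ ↦ mul_right_comm ..

theorem extD_antisymm (α : OneForm n M) (x : M) (u w : TangentSpace (𝓡 n) x) :
    extD α x u w = - extD α x w u := by
  rw [extD, extD, Finset.sum_comm, ← Finset.sum_neg_distrib]
  refine Finset.sum_congr rfl fun i _ ↦ ?_
  rw [← Finset.sum_neg_distrib]
  exact Finset.sum_congr rfl fun j _ ↦ by ring

end ExteriorDerivative

section SmoothMatrices

variable {n : ℕ} {M : Type*} [TopologicalSpace M] [ChartedSpace (Euc n) M]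

theorem SmoothAt.matrix_det {m : ℕ} {A : M → Matrix (Fin m) (Fin m) ℝ} {y : M}
    (hA : ∀ i j, SmoothAt n (fun z ↦ A z i j) y) : SmoothAt n (fun z ↦ (A z).det) y := by
  simp only [Matrix.det_apply']
  exact SmoothAt.sum fun σ _ ↦ SmoothAt.mul contMDiffAt_const
    (contMDiffAt_finsetProd fun i _ ↦ hA (σ i) i)

theorem SmoothAt.matrix_inv {m : ℕ} {A : M → Matrix (Fin m) (Fin m) ℝ} {y : M}
    (hA : ∀ i j, SmoothAt n (fun z ↦ A z i j) y) (hdet : (A y).det ≠ 0) (i j : Fin m) :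
    SmoothAt n (fun z ↦ (A z)⁻¹ i j) y := by
  simp only [Matrix.inv_def, Matrix.smul_apply, smul_eq_mul, Ring.inverse_eq_inv',
    Matrix.adjugate_apply]
  refine SmoothAt.mul ((contDiffAt_inv ℝ hdet).contMDiffAt.comp y (SmoothAt.matrix_det hA))
    (SmoothAt.matrix_det fun k l ↦ ?_)
  by_cases h : k = j
  · subst h
    simpa only [Matrix.updateRow_self] using contMDiffAt_const
  · simpa only [Matrix.updateRow_ne h] using hA k l

end SmoothMatrices

section MetricDuality

variable {n : ℕ} {M : Type*} [TopologicalSpace M] [ChartedSpace (Euc n) M]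

instance finiteDimensional_tangentSpace (x : M) : FiniteDimensional ℝ (TangentSpace (𝓡 n) x) :=
  inferInstanceAs (FiniteDimensional ℝ (Euc n))

variable [RiemannianBundle (fun x : M ↦ TangentSpace (𝓡 n) x)]

theorem inner_sharp (α : OneForm n M) (x : M) (w : TangentSpace (𝓡 n) x) :
    inner ℝ (sharp α x) w = α x w :=
  InnerProductSpace.toDual_symm_apply

theorem norm_sharp (α : OneForm n M) (x : M) : ‖sharp α x‖ = ‖α x‖ :=
  LinearIsometryEquiv.norm_map _ _

theorem contract_sharp (α : OneForm n M) (x : M) : contract (sharp α) α x = ‖α x‖ ^ 2 := by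
  rw [contract, ← inner_sharp, real_inner_self_eq_norm_sq, norm_sharp]

end MetricDuality

section MetricComponents

variable {n : ℕ} {M : Type*} [TopologicalSpace M] [ChartedSpace (Euc n) M]
  [IsManifold (𝓡 n) ∞ M]

theorem linearIndependent_frame {x₀ y : M} (hy : y ∈ (chartAt (Euc n) x₀).source) :
    LinearIndependent ℝ (fun i ↦ frame (n := n) x₀ i y) := by
  rw [Fintype.linearIndependent_iff]
  intro g hg i
  simpa [coframe_frame hy] using congrArg (coframe x₀ i y) hg

variable [RiemannianBundle (fun x : M ↦ TangentSpace (𝓡 n) x)]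

theorem gram_posDef {x₀ y : M} (hy : y ∈ (chartAt (Euc n) x₀).source) :
    (gram (n := n) x₀ y).PosDef :=
  Matrix.posDef_gram_iff_linearIndependent.2 (linearIndependent_frame hy)

theorem gram_det_pos {x₀ y : M} (hy : y ∈ (chartAt (Euc n) x₀).source) :
    0 < (gram (n := n) x₀ y).det :=
  (gram_posDef hy).det_pos

theorem dens_pos {x₀ y : M} (hy : y ∈ (chartAt (Euc n) x₀).source) : 0 < dens n x₀ y :=
  Real.sqrt_pos.2 (gram_det_pos hy)

theorem gram_comm (x₀ y : M) (i j : Fin n) : gram x₀ y i j = gram x₀ y j i :=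
  real_inner_comm (frame x₀ j y) (frame x₀ i y)

theorem gram_inv_comm (x₀ y : M) (i j : Fin n) : (gram x₀ y)⁻¹ i j = (gram x₀ y)⁻¹ j i := by
  have hsymm : (gram (n := n) x₀ y).transpose = gram x₀ y := by
    ext i j
    exact gram_comm x₀ y j i
  conv_lhs => rw [← hsymm, ← Matrix.transpose_nonsing_inv, Matrix.transpose_apply]

theorem sum_gram_mul_inv {x₀ y : M} (hy : y ∈ (chartAt (Euc n) x₀).source) (i k : Fin n) :
    ∑ j, gram x₀ y i j * (gram x₀ y)⁻¹ j k = if i = k then 1 else 0 := by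
  rw [← Matrix.mul_apply, Matrix.mul_nonsing_inv _ (gram_det_pos hy).ne'.isUnit, Matrix.one_apply]

theorem inner_frame {x₀ y : M} (hy : y ∈ (chartAt (Euc n) x₀).source)
    (w : TangentSpace (𝓡 n) y) (j : Fin n) :
    inner ℝ w (frame x₀ j y) = ∑ i, coframe x₀ i y w * gram x₀ y i j := by
  conv_lhs => rw [← sum_coframe_smul_frame hy w, sum_inner]
  exact Finset.sum_congr rfl fun i _ ↦ real_inner_smul_left _ _ _

theorem form_frame_eq_sum_gram (α : OneForm n M) {x₀ y : M}
    (hy : y ∈ (chartAt (Euc n) x₀).source) (j : Fin n) :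
    α y (frame x₀ j y) = ∑ i, gram x₀ y j i * coframe x₀ i y (sharp α y) := by
  rw [← inner_sharp, inner_frame hy]
  exact Finset.sum_congr rfl fun i _ ↦ by rw [gram_comm, mul_comm]

theorem coframe_sharp (α : OneForm n M) {x₀ y : M}
    (hy : y ∈ (chartAt (Euc n) x₀).source) (i : Fin n) :
    coframe x₀ i y (sharp α y) = ∑ j, (gram x₀ y)⁻¹ i j * α y (frame x₀ j y) := by
  have hgram : (fun j ↦ α y (frame x₀ j y))
      = (gram x₀ y).mulVec fun k ↦ coframe x₀ k y (sharp α y) :=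
    funext (form_frame_eq_sum_gram α hy)
  change _ = (gram x₀ y)⁻¹.mulVec (fun j ↦ α y (frame x₀ j y)) i
  rw [hgram, Matrix.mulVec_mulVec, Matrix.nonsing_inv_mul _ (gram_det_pos hy).ne'.isUnit,
    Matrix.one_mulVec]

end MetricComponents

section TwoFormNorm

variable {n : ℕ} {M : Type*} [TopologicalSpace M] [ChartedSpace (Euc n) M]
  [IsManifold (𝓡 n) ∞ M]

/-- The 1-form `u ↦ dα(u, v)`, i.e. `-ι_v dα`. -/
def extDContract (α : OneForm n M) (v : (x : M) → TangentSpace (𝓡 n) x) : OneForm n M :=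
  fun y ↦ extDLeft α y (v y)

theorem extD_apply_right (α : OneForm n M) (x : M) (u w : TangentSpace (𝓡 n) x) :
    extD α x u w = - extDLeft α x u w := by
  rw [extDLeft_apply, extD_antisymm]

theorem extDLeft_frame (α : OneForm n M) {x₀ z : M} (hz : z ∈ (chartAt (Euc n) x₀).source)
    (v : TangentSpace (𝓡 n) z) (i : Fin n) : extDLeft α z v (frame x₀ i z) =
      ∑ j, coframe x₀ j z v * extD α z (frame x₀ i z) (frame x₀ j z) := by
  rw [extDLeft_apply, extD_apply_right, clm_apply_eq_sum hz, ← Finset.sum_neg_distrib]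
  exact Finset.sum_congr rfl fun j _ ↦ by rw [extD_apply_right, mul_neg]

variable [RiemannianBundle (fun x : M ↦ TangentSpace (𝓡 n) x)] {ι : Type*} [Fintype ι]

theorem sum_gram_inv_mul_mul {x₀ y : M} (hy : y ∈ (chartAt (Euc n) x₀).source)
    (e : OrthonormalBasis ι ℝ (TangentSpace (𝓡 n) y)) (β γ : TangentSpace (𝓡 n) y →L[ℝ] ℝ) :
    ∑ i, ∑ a, (gram x₀ y)⁻¹ i a * β (frame x₀ a y) * γ (frame x₀ i y)
      = ∑ k, β (e k) * γ (e k) := by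
  classical
  let βField : OneForm n M := Function.update 0 y β
  have hβ : βField y = β := Function.update_self ..
  calc ∑ i, ∑ a, (gram x₀ y)⁻¹ i a * β (frame x₀ a y) * γ (frame x₀ i y)
      = γ (sharp βField y) := by
        rw [clm_apply_eq_sum hy γ]
        exact Finset.sum_congr rfl fun i _ ↦ by rw [coframe_sharp βField hy, hβ, Finset.sum_mul]
    _ = ∑ k, β (e k) * γ (e k) := by
        conv_lhs => rw [← e.sum_repr (sharp βField y), map_sum]
        refine Finset.sum_congr rfl fun k _ ↦ ?_
        rw [map_smul, e.repr_apply_apply, real_inner_comm, inner_sharp, hβ, smul_eq_mul]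

/-- Twice the squared norm of the 2-form `dα`: the sum of the squares of all its components in an
orthonormal basis (see `extDSq_eq_sum`). -/
def extDSq (α : OneForm n M) (x : M) : ℝ :=
  ∑ i, ∑ j, raised (extD α) x i j x * extD α x (frame x i x) (frame x j x)

theorem extDSq_eq_sum (α : OneForm n M) (x : M)
    (e : OrthonormalBasis ι ℝ (TangentSpace (𝓡 n) x)) :
    extDSq α x = ∑ l, ∑ k, extD α x (e k) (e l) ^ 2 := by
  have hx := mem_chart_source (Euc n) x
  have hnested : extDSq α x = ∑ j, ∑ b, (gram x x)⁻¹ j b * ∑ i, ∑ a, (gram x x)⁻¹ i a *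
      extDLeft α x (frame x b x) (frame x a x) * extDLeft α x (frame x j x) (frame x i x) := by
    simp only [extDSq, raised, extDLeft_apply, Finset.mul_sum, Finset.sum_mul]
    rw [Finset.sum_comm]
    refine Finset.sum_congr rfl fun j _ ↦ ?_
    rw [Finset.sum_congr rfl fun i _ ↦ Finset.sum_comm, Finset.sum_comm]
    exact Finset.sum_congr rfl fun b _ ↦ Finset.sum_congr rfl fun i _ ↦
      Finset.sum_congr rfl fun a _ ↦ by ring
  have hsq : ∀ k, ∑ j, ∑ b, (gram x x)⁻¹ j b * extDLeft α x (e k) (frame x b x) *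
      extDLeft α x (e k) (frame x j x) = ∑ l, extD α x (e k) (e l) ^ 2 := by
    intro k
    rw [sum_gram_inv_mul_mul hx e]
    exact Finset.sum_congr rfl fun l _ ↦ by rw [extD_apply_right]; ring
  rw [hnested, Finset.sum_comm (f := fun l k ↦ extD α x (e k) (e l) ^ 2)]
  simp only [sum_gram_inv_mul_mul hx e]
  simp only [← hsq, Finset.mul_sum]
  rw [Finset.sum_congr rfl fun j _ ↦ Finset.sum_comm, Finset.sum_comm]
  refine Finset.sum_congr rfl fun k _ ↦ Finset.sum_congr rfl fun j _ ↦
    Finset.sum_congr rfl fun b _ ↦ ?_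
  simp only [extDLeft_apply]
  rw [extD_antisymm α x (e k), extD_antisymm α x (e k)]
  ring

theorem extDSq_nonneg (α : OneForm n M) (x : M) : 0 ≤ extDSq α x := by
  rw [extDSq_eq_sum α x (stdOrthonormalBasis ℝ _)]
  positivity

theorem norm_sharp_extDContract_sq_le (α : OneForm n M) (v : (x : M) → TangentSpace (𝓡 n) x)
    (x : M) : ‖sharp (extDContract α v) x‖ ^ 2 ≤ extDSq α x * ‖v x‖ ^ 2 := by
  have e := stdOrthonormalBasis ℝ (TangentSpace (𝓡 n) x)
  rw [extDSq_eq_sum α x e, ← e.sum_sq_norm_inner_right, ← e.sum_sq_norm_inner_right (v x),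
    Finset.sum_comm, Finset.sum_mul]
  refine Finset.sum_le_sum fun k _ ↦ ?_
  have hcomponent : inner ℝ (e k) (sharp (extDContract α v) x)
      = ∑ l, extD α x (e k) (e l) * inner ℝ (e l) (v x) := by
    rw [real_inner_comm, inner_sharp, extDContract, extDLeft_apply, extD_apply_right]
    conv_lhs => rw [← e.sum_repr (v x), map_sum, ← Finset.sum_neg_distrib]
    refine Finset.sum_congr rfl fun l _ ↦ ?_
    rw [map_smul, extD_apply_right, e.repr_apply_apply, smul_eq_mul]
    ring
  rw [hcomponent, Real.norm_eq_abs, sq_abs]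
  simpa only [Real.norm_eq_abs, sq_abs] using Finset.sum_mul_sq_le_sq_mul_sq Finset.univ
    (fun l ↦ extD α x (e k) (e l)) (fun l ↦ inner ℝ (e l) (v x))

theorem extD_eq_zero_of_extDSq_eq_zero {α : OneForm n M} {x : M} (h : extDSq α x = 0)
    (u w : TangentSpace (𝓡 n) x) : extD α x u w = 0 := by
  classical
  let v : (z : M) → TangentSpace (𝓡 n) z := Function.update 0 x w
  have hsharp : sharp (extDContract α v) x = 0 := by
    have hle := norm_sharp_extDContract_sq_le α v x
    rw [h, zero_mul] at hle
    exact norm_eq_zero.1 (sq_eq_zero_iff.1 (le_antisymm hle (sq_nonneg _)))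
  rw [← extDLeft_apply, ← Function.update_self x w 0]
  change extDContract α v x u = 0
  rw [← inner_sharp, hsharp, inner_zero_left]

end TwoFormNorm

section SmoothMetric

variable {n : ℕ} {M : Type*} [TopologicalSpace M] [ChartedSpace (Euc n) M]
  [IsManifold (𝓡 n) ∞ M]

theorem smoothAt_form_field {α : OneForm n M} {v : (x : M) → TangentSpace (𝓡 n) x}
    (hα : IsSmoothForm α) (hv : IsSmoothField v) (y : M) : SmoothAt n (fun z ↦ α z (v z)) y := by
  have hy := mem_chart_source (Euc n) y
  have hsum : SmoothAt n (fun z ↦ ∑ i, coframe y i z (v z) * α z (frame y i z)) y :=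
    SmoothAt.sum fun i _ ↦ (hv.smoothAt_coframe hy i).mul (hα.smoothAt_frame hy i)
  refine hsum.congr_of_eventuallyEq ?_
  filter_upwards [(chartAt (Euc n) y).open_source.mem_nhds hy] with z hz
  exact clm_apply_eq_sum hz (α z) (v z)

variable [RiemannianBundle (fun x : M ↦ TangentSpace (𝓡 n) x)]

theorem coframe_sharp_extDContract_sharp (α : OneForm n M) {x₀ z : M}
    (hz : z ∈ (chartAt (Euc n) x₀).source) (i : Fin n) :
    coframe x₀ i z (sharp (extDContract α (sharp α)) z) =
      ∑ j, raised (extD α) x₀ i j z * α z (frame x₀ j z) := by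
  simp only [coframe_sharp _ hz, extDContract, extDLeft_frame α hz, raised, Finset.mul_sum,
    Finset.sum_mul]
  rw [Finset.sum_congr rfl fun a _ ↦ Finset.sum_comm, Finset.sum_comm]
  refine Finset.sum_congr rfl fun j _ ↦ Finset.sum_congr rfl fun a _ ↦
    Finset.sum_congr rfl fun b _ ↦ ?_
  rw [gram_inv_comm x₀ z b j]
  ring

variable [IsContMDiffRiemannianBundle (𝓡 n) ∞ (Euc n) (fun x : M ↦ TangentSpace (𝓡 n) x)]

theorem smoothAt_gram {x₀ y : M} (hy : y ∈ (chartAt (Euc n) x₀).source) (i j : Fin n) :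
    SmoothAt n (fun z ↦ gram x₀ z i j) y :=
  ContMDiffAt.inner_bundle (contMDiffAt_frame hy i) (contMDiffAt_frame hy j)

theorem smoothAt_gram_inv {x₀ y : M} (hy : y ∈ (chartAt (Euc n) x₀).source) (i j : Fin n) :
    SmoothAt n (fun z ↦ (gram x₀ z)⁻¹ i j) y :=
  SmoothAt.matrix_inv (smoothAt_gram hy) (gram_det_pos hy).ne' i j

theorem smoothAt_dens {x₀ y : M} (hy : y ∈ (chartAt (Euc n) x₀).source) :
    SmoothAt n (dens n x₀) y :=
  (Real.contDiffAt_sqrt (gram_det_pos hy).ne').contMDiffAt.comp y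
    (SmoothAt.matrix_det (smoothAt_gram hy))

theorem smoothAt_raised {α : OneForm n M} (hα : IsSmoothForm α) {x₀ y : M}
    (hy : y ∈ (chartAt (Euc n) x₀).source) (i j : Fin n) :
    SmoothAt n (raised (extD α) x₀ i j) y :=
  SmoothAt.sum fun a _ ↦ SmoothAt.sum fun b _ ↦ ((smoothAt_gram_inv hy i a).mul
    (smoothAt_gram_inv hy j b)).mul (smoothAt_extD_frame hα hy a b)

theorem isSmoothField_sharp_of_frame {β : OneForm n M}
    (hβ : ∀ (y : M) (i : Fin n), SmoothAt n (fun z ↦ β z (frame y i z)) y) :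
    IsSmoothField (sharp β) := by
  refine isSmoothField_of_coframe fun y i ↦ ?_
  have hy := mem_chart_source (Euc n) y
  have hsum : SmoothAt n (fun z ↦ ∑ j, (gram y z)⁻¹ i j * β z (frame y j z)) y :=
    SmoothAt.sum fun j _ ↦ (smoothAt_gram_inv hy i j).mul (hβ y j)
  refine hsum.congr_of_eventuallyEq ?_
  filter_upwards [(chartAt (Euc n) y).open_source.mem_nhds hy] with z hz
  exact coframe_sharp β hz i

theorem IsSmoothForm.sharp {α : OneForm n M} (hα : IsSmoothForm α) : IsSmoothField (sharp α) :=
  isSmoothField_sharp_of_frame fun y i ↦ hα.smoothAt_frame (mem_chart_source _ y) i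

theorem isSmoothField_sharp_extDContract {α : OneForm n M}
    {v : (x : M) → TangentSpace (𝓡 n) x} (hα : IsSmoothForm α) (hv : IsSmoothField v) :
    IsSmoothField (sharp (extDContract α v)) := by
  refine isSmoothField_sharp_of_frame fun y i ↦ ?_
  have hy := mem_chart_source (Euc n) y
  have hsum : SmoothAt n
      (fun z ↦ ∑ j, coframe y j z (v z) * extD α z (frame y i z) (frame y j z)) y :=
    SmoothAt.sum fun j _ ↦ (hv.smoothAt_coframe hy j).mul (smoothAt_extD_frame hα hy i j)
  refine hsum.congr_of_eventuallyEq ?_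
  filter_upwards [(chartAt (Euc n) y).open_source.mem_nhds hy] with z hz
  exact extDLeft_frame α hz (v z) i

end SmoothMetric

section ChartInverse

variable {n : ℕ} {M : Type*} [TopologicalSpace M] [ChartedSpace (Euc n) M]

variable (n) in
/-- The domain in `ℝⁿ` of the inverse of the preferred chart at `x₀`. -/
abbrev chartTarget (x₀ : M) : Set (Euc n) := (extChartAt (𝓡 n) x₀).target

variable (n) in
/-- The inverse of the preferred chart at `x₀`. -/
abbrev chartSymm (x₀ : M) : Euc n → M := (extChartAt (𝓡 n) x₀).symm

variable (n) in
/-- The change of coordinates from the preferred chart at `x₀` to the one at `x₁`. -/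
abbrev transition (x₀ x₁ : M) : Euc n → Euc n := extChartAt (𝓡 n) x₁ ∘ chartSymm n x₀

theorem isOpen_chartTarget (x₀ : M) : IsOpen (chartTarget n x₀) := isOpen_extChartAt_target x₀

theorem measurableSet_chartTarget (x₀ : M) : MeasurableSet (chartTarget n x₀) :=
  (isOpen_chartTarget x₀).measurableSet

theorem chartSymm_mem_source {x₀ : M} {z : Euc n} (hz : z ∈ chartTarget n x₀) :
    chartSymm n x₀ z ∈ (chartAt (Euc n) x₀).source := by
  simpa only [extChartAt_source] using (extChartAt (𝓡 n) x₀).map_target hz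

theorem continuousOn_chartSymm (x₀ : M) : ContinuousOn (chartSymm n x₀) (chartTarget n x₀) :=
  continuousOn_extChartAt_symm x₀

theorem image_extChartAt {x₀ : M} {A : Set M} (hA : A ⊆ (chartAt (Euc n) x₀).source) :
    extChartAt (𝓡 n) x₀ '' A = chartTarget n x₀ ∩ chartSymm n x₀ ⁻¹' A :=
  (extChartAt (𝓡 n) x₀).image_eq_target_inter_inv_preimage (by rwa [extChartAt_source])

theorem isCompact_image_extChartAt {x₀ : M} {K : Set M} (hK : IsCompact K)
    (hKS : K ⊆ (chartAt (Euc n) x₀).source) : IsCompact (extChartAt (𝓡 n) x₀ '' K) :=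
  hK.image_of_continuousOn ((continuousOn_extChartAt x₀).mono (by rwa [extChartAt_source]))

theorem chartSymm_extChartAt {x₀ y : M} (hy : y ∈ (chartAt (Euc n) x₀).source) :
    chartSymm n x₀ (extChartAt (𝓡 n) x₀ y) = y :=
  (extChartAt (𝓡 n) x₀).left_inv (by rwa [extChartAt_source])

theorem transition_extChartAt {x₀ y : M} (hy : y ∈ (chartAt (Euc n) x₀).source) (x₁ : M) :
    transition n x₀ x₁ (extChartAt (𝓡 n) x₀ y) = extChartAt (𝓡 n) x₁ y :=
  congrArg (extChartAt (𝓡 n) x₁) (chartSymm_extChartAt hy)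

theorem injOn_extChartAt {x₀ : M} {A : Set M} (hA : A ⊆ (chartAt (Euc n) x₀).source) :
    InjOn (extChartAt (𝓡 n) x₀) A :=
  (extChartAt (𝓡 n) x₀).injOn.mono (by rwa [extChartAt_source])

theorem image_transition {x₀ : M} {A : Set M} (hA : A ⊆ (chartAt (Euc n) x₀).source) (x₁ : M) :
    transition n x₀ x₁ '' (extChartAt (𝓡 n) x₀ '' A) = extChartAt (𝓡 n) x₁ '' A := by
  rw [image_image]
  exact image_congr fun y hy ↦ transition_extChartAt (hA hy) x₁

theorem injOn_transition {x₀ x₁ : M} {A : Set M} (h₀ : A ⊆ (chartAt (Euc n) x₀).source)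
    (h₁ : A ⊆ (chartAt (Euc n) x₁).source) :
    InjOn (transition n x₀ x₁) (extChartAt (𝓡 n) x₀ '' A) := by
  rintro - ⟨y, hy, rfl⟩ - ⟨y', hy', rfl⟩ h
  rw [transition_extChartAt (h₀ hy), transition_extChartAt (h₀ hy')] at h
  exact congrArg _ (injOn_extChartAt h₁ hy hy' h)

variable [MeasurableSpace M] [BorelSpace M]

theorem measurableSet_source (x₀ : M) : MeasurableSet (chartAt (Euc n) x₀).source :=
  (chartAt (Euc n) x₀).open_source.measurableSet

theorem measurableEmbedding_chartSymm (x₀ : M) :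
    MeasurableEmbedding ((chartTarget n x₀).domRestrict (chartSymm n x₀)) := by
  have htarget : chartTarget n x₀ = (chartAt (Euc n) x₀).symm.source := by
    simp only [chartTarget, mfld_simps]
  rw [htarget]
  exact (chartAt (Euc n) x₀).symm.isOpenEmbedding_restrict.measurableEmbedding

theorem measurableSet_chartTarget_inter_preimage (x₀ : M) {A : Set M} (hA : MeasurableSet A) :
    MeasurableSet (chartTarget n x₀ ∩ chartSymm n x₀ ⁻¹' A) := by
  have h := (MeasurableEmbedding.subtype_coe (measurableSet_chartTarget x₀)).measurableSet_image.2
    ((measurableEmbedding_chartSymm (n := n) x₀).measurable hA)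
  rwa [domRestrict_eq, preimage_comp, Subtype.image_preimage_coe] at h

end ChartInverse

section TransitionMatrix

variable {n : ℕ} {M : Type*} [TopologicalSpace M] [ChartedSpace (Euc n) M]
  [IsManifold (𝓡 n) ∞ M]

theorem differentiableAt_transition {x₀ x₁ y : M} (hy₀ : y ∈ (chartAt (Euc n) x₀).source)
    (hy₁ : y ∈ (chartAt (Euc n) x₁).source) :
    DifferentiableAt ℝ (transition n x₀ x₁) (extChartAt (𝓡 n) x₀ y) := by
  have h := (mdifferentiableAt_iff_source_of_mem_source (I := 𝓡 n) (I' := 𝓘(ℝ, Euc n)) hy₀).1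
    (mdifferentiableAt_extChartAt hy₁)
  rwa [modelWithCornersSelf_coe, range_id, mdifferentiableWithinAt_univ,
    mdifferentiableAt_iff_differentiableAt] at h

theorem coframe_frame_eq_fderiv {x₀ x₁ y : M} (hy₀ : y ∈ (chartAt (Euc n) x₀).source)
    (hy₁ : y ∈ (chartAt (Euc n) x₁).source) (k i : Fin n) :
    coframe x₁ k y (frame x₀ i y) =
      fderiv ℝ (transition n x₀ x₁) (extChartAt (𝓡 n) x₀ y) (EuclideanSpace.single i 1) k := by
  have hcoord : coord n x₁ k ∘ (extChartAt (𝓡 n) x₀).symm = fun z ↦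
      (EuclideanSpace.proj k : Euc n →L[ℝ] ℝ) (transition n x₀ x₁ z) := rfl
  rw [← mvfderiv_coord hy₁ k]
  change pd x₀ i (coord n x₁ k) y = _
  rw [pd_eq_fderiv hy₀, hcoord, fderiv_fun_comp _
    (ContinuousLinearMap.differentiableAt _) (differentiableAt_transition hy₀ hy₁),
    ContinuousLinearMap.fderiv]
  rfl

theorem det_coframe_frame {x₀ x₁ y : M} (hy₀ : y ∈ (chartAt (Euc n) x₀).source)
    (hy₁ : y ∈ (chartAt (Euc n) x₁).source) :
    (Matrix.of fun k i : Fin n ↦ coframe x₁ k y (frame x₀ i y)).det =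
      (fderiv ℝ (transition n x₀ x₁) (extChartAt (𝓡 n) x₀ y)).det := by
  let b := (EuclideanSpace.basisFun (Fin n) ℝ).toBasis
  set D := fderiv ℝ (transition n x₀ x₁) (extChartAt (𝓡 n) x₀ y)
  have hmatrix : (Matrix.of fun k i : Fin n ↦ coframe x₁ k y (frame x₀ i y)) =
      LinearMap.toMatrix b b D.toLinearMap := by
    ext k i
    rw [LinearMap.toMatrix_apply]
    simp only [b, OrthonormalBasis.coe_toBasis, EuclideanSpace.basisFun_apply]
    exact coframe_frame_eq_fderiv hy₀ hy₁ k i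
  rw [hmatrix, LinearMap.det_toMatrix]

variable [RiemannianBundle (fun x : M ↦ TangentSpace (𝓡 n) x)]

theorem gram_eq_transpose_mul_gram_mul (x₀ : M) {x₁ y : M}
    (hy : y ∈ (chartAt (Euc n) x₁).source) :
    gram x₀ y = (Matrix.of fun k i : Fin n ↦ coframe x₁ k y (frame x₀ i y)).transpose * gram x₁ y *
      Matrix.of fun k i : Fin n ↦ coframe x₁ k y (frame x₀ i y) := by
  ext i j
  change inner ℝ (frame x₀ i y) (frame x₀ j y) = _
  conv_lhs => rw [← sum_coframe_smul_frame hy (frame x₀ j y), inner_sum]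
  rw [Matrix.mul_apply]
  refine Finset.sum_congr rfl fun k _ ↦ ?_
  rw [real_inner_smul_right, inner_frame hy, Matrix.mul_apply, mul_comm]
  rfl

theorem dens_eq_abs_det_mul {x₀ x₁ y : M} (hy₀ : y ∈ (chartAt (Euc n) x₀).source)
    (hy₁ : y ∈ (chartAt (Euc n) x₁).source) :
    dens n x₀ y =
      |(fderiv ℝ (transition n x₀ x₁) (extChartAt (𝓡 n) x₀ y)).det| * dens n x₁ y := by
  rw [dens, dens, gram_eq_transpose_mul_gram_mul x₀ hy₁, Matrix.det_mul, Matrix.det_mul,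
    Matrix.det_transpose, det_coframe_frame hy₀ hy₁, mul_right_comm, ← pow_two,
    Real.sqrt_mul (sq_nonneg _), Real.sqrt_sq_eq_abs]

end TransitionMatrix

section Volume

variable {n : ℕ} {M : Type*} [TopologicalSpace M] [ChartedSpace (Euc n) M]
  [IsManifold (𝓡 n) ∞ M] [RiemannianBundle (fun x : M ↦ TangentSpace (𝓡 n) x)]
  [MeasurableSpace M]

theorem chartVol_le_vol (x₀ : M) : chartVol n x₀ ≤ vol n M :=
  le_iSup (chartVol n) x₀

variable [BorelSpace M]

theorem chartVol_eq_map (x₀ : M) :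
    chartVol n x₀ = Measure.map ((chartTarget n x₀).domRestrict (chartSymm n x₀))
      (Measure.comap (↑) ((volume : Measure (Euc n)).withDensity
        (fun z ↦ ENNReal.ofReal (dens n x₀ (chartSymm n x₀ z))))) := by
  have hT := measurableSet_chartTarget (n := n) x₀
  rw [chartVol, ← restrict_withDensity hT, ← map_comap_subtype_coe hT,
    AEMeasurable.map_map_of_aemeasurable _ measurable_subtype_coe.aemeasurable]
  · rfl
  · rw [map_comap_subtype_coe hT]
    exact (continuousOn_chartSymm x₀).aemeasurable hT

theorem chartVol_apply (x₀ : M) {A : Set M} (hA : MeasurableSet A) :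
    chartVol n x₀ A = ∫⁻ z in chartTarget n x₀ ∩ chartSymm n x₀ ⁻¹' A,
      ENNReal.ofReal (dens n x₀ (chartSymm n x₀ z)) := by
  rw [chartVol_eq_map, (measurableEmbedding_chartSymm x₀).map_apply,
    (MeasurableEmbedding.subtype_coe (measurableSet_chartTarget x₀)).comap_apply, domRestrict_eq,
    preimage_comp, Subtype.image_preimage_coe,
    withDensity_apply _ (measurableSet_chartTarget_inter_preimage x₀ hA)]

theorem chartVol_compl_source (x₀ : M) : chartVol n x₀ (chartAt (Euc n) x₀).sourceᶜ = 0 := by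
  have hempty : chartTarget n x₀ ∩ chartSymm n x₀ ⁻¹' (chartAt (Euc n) x₀).sourceᶜ = ∅ :=
    eq_empty_of_forall_notMem fun _ hz ↦ hz.2 (chartSymm_mem_source hz.1)
  rw [chartVol_apply x₀ (measurableSet_source x₀).compl, hempty, Measure.restrict_empty,
    lintegral_zero_measure]

theorem chartVol_apply_eq_of_subset {x₀ x₁ : M} {A : Set M} (hA : MeasurableSet A)
    (h₀ : A ⊆ (chartAt (Euc n) x₀).source) (h₁ : A ⊆ (chartAt (Euc n) x₁).source) :
    chartVol n x₀ A = chartVol n x₁ A := by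
  have hmeas : MeasurableSet (extChartAt (𝓡 n) x₀ '' A) := by
    rw [image_extChartAt h₀]
    exact measurableSet_chartTarget_inter_preimage x₀ hA
  have hderiv : ∀ z ∈ extChartAt (𝓡 n) x₀ '' A, HasFDerivWithinAt (transition n x₀ x₁)
      (fderiv ℝ (transition n x₀ x₁) z) (extChartAt (𝓡 n) x₀ '' A) z := by
    rintro - ⟨y, hy, rfl⟩
    exact (differentiableAt_transition (h₀ hy) (h₁ hy)).hasFDerivAt.hasFDerivWithinAt
  rw [chartVol_apply x₀ hA, chartVol_apply x₁ hA, ← image_extChartAt h₀, ← image_extChartAt h₁,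
    ← image_transition h₀ x₁,
    lintegral_image_eq_lintegral_abs_det_fderiv_mul volume hmeas hderiv (injOn_transition h₀ h₁)]
  refine setLIntegral_congr_fun hmeas ?_
  rintro - ⟨y, hy, rfl⟩
  simp only [transition_extChartAt (h₀ hy)]
  rw [chartSymm_extChartAt (h₀ hy), chartSymm_extChartAt (h₁ hy),
    dens_eq_abs_det_mul (h₀ hy) (h₁ hy), ENNReal.ofReal_mul (abs_nonneg _)]

theorem chartVol_restrict_source (x₀ : M) :
    (chartVol n x₀).restrict (chartAt (Euc n) x₀).source = chartVol n x₀ :=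
  Measure.restrict_eq_self_of_ae_mem (ae_iff.2 (chartVol_compl_source x₀))

theorem chartVol_restrict_source_le (x₀ x₁ : M) :
    (chartVol n x₁).restrict (chartAt (Euc n) x₀).source ≤ chartVol n x₀ := by
  refine Measure.le_iff.2 fun A hA ↦ ?_
  have hS₀ := measurableSet_source (n := n) x₀
  have hS₁ := measurableSet_source (n := n) x₁
  rw [← chartVol_restrict_source x₁, Measure.restrict_restrict hS₀, Measure.restrict_apply hA,
    ← chartVol_apply_eq_of_subset (hA.inter (hS₀.inter hS₁)) (fun y hy ↦ hy.2.1)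
      (fun y hy ↦ hy.2.2)]
  exact measure_mono inter_subset_left

theorem vol_le_chartVol_add_restrict_compl (x₀ : M) :
    vol n M ≤ chartVol n x₀ + (vol n M).restrict (chartAt (Euc n) x₀).sourceᶜ := by
  refine iSup_le fun x₁ ↦ ?_
  rw [← Measure.restrict_add_restrict_compl (μ := chartVol n x₁)
    (measurableSet_source (n := n) x₀)]
  exact add_le_add (chartVol_restrict_source_le x₀ x₁)
    (Measure.restrict_mono_measure (chartVol_le_vol x₁) _)

theorem vol_restrict_source (x₀ : M) :
    (vol n M).restrict (chartAt (Euc n) x₀).source = chartVol n x₀ := by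
  refine le_antisymm ?_ ?_
  · calc (vol n M).restrict (chartAt (Euc n) x₀).source
        ≤ (chartVol n x₀ + (vol n M).restrict (chartAt (Euc n) x₀).sourceᶜ).restrict
            (chartAt (Euc n) x₀).source :=
          Measure.restrict_mono_measure (vol_le_chartVol_add_restrict_compl x₀) _
      _ = chartVol n x₀ := by
        rw [Measure.restrict_add, chartVol_restrict_source,
          Measure.restrict_restrict (measurableSet_source x₀), inter_compl_self,
          Measure.restrict_empty, add_zero]
  · rw [← chartVol_restrict_source]
    exact Measure.restrict_mono_measure (chartVol_le_vol x₀) _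

end Volume

section SmoothVolume

variable {n : ℕ} {M : Type*} [TopologicalSpace M] [ChartedSpace (Euc n) M]
  [IsManifold (𝓡 n) ∞ M] [RiemannianBundle (fun x : M ↦ TangentSpace (𝓡 n) x)]
  [IsContMDiffRiemannianBundle (𝓡 n) ∞ (Euc n) (fun x : M ↦ TangentSpace (𝓡 n) x)]

theorem continuousOn_dens_chartSymm (x₀ : M) :
    ContinuousOn (fun z ↦ dens n x₀ (chartSymm n x₀ z)) (chartTarget n x₀) := fun z hz ↦
  (smoothAt_dens (chartSymm_mem_source hz)).continuousAt.comp_continuousWithinAt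
    (continuousOn_chartSymm x₀ z hz)

theorem aemeasurable_dens (x₀ : M) :
    AEMeasurable (fun z ↦ dens n x₀ (chartSymm n x₀ z)) (volume.restrict (chartTarget n x₀)) :=
  (continuousOn_dens_chartSymm x₀).aemeasurable (measurableSet_chartTarget x₀)

variable [MeasurableSpace M] [BorelSpace M]

theorem integral_chartVol (x₀ : M) (f : M → ℝ) :
    ∫ y, f y ∂(chartVol n x₀) = ∫ z in chartTarget n x₀,
      dens n x₀ (chartSymm n x₀ z) * f (chartSymm n x₀ z) := by
  have hT := measurableSet_chartTarget (n := n) x₀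
  rw [chartVol_eq_map, (measurableEmbedding_chartSymm x₀).integral_map]
  simp only [Set.domRestrict_apply]
  rw [← (MeasurableEmbedding.subtype_coe hT).integral_map
    (fun z ↦ f (chartSymm n x₀ z)), map_comap_subtype_coe hT]
  refine (setIntegral_withDensity_eq_setIntegral_smul₀ (aemeasurable_dens x₀).real_toNNReal _
    hT).trans (setIntegral_congr_fun hT fun z hz ↦ ?_)
  simp only [NNReal.smul_def, smul_eq_mul]
  rw [Real.coe_toNNReal _ (dens_pos (chartSymm_mem_source hz)).le]

theorem integrable_chartVol_iff (x₀ : M) (f : M → ℝ) :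
    Integrable f (chartVol n x₀) ↔ IntegrableOn (fun z ↦
      dens n x₀ (chartSymm n x₀ z) * f (chartSymm n x₀ z)) (chartTarget n x₀) := by
  have hT := measurableSet_chartTarget (n := n) x₀
  have hcomp : f ∘ (chartTarget n x₀).domRestrict (chartSymm n x₀) =
    (fun z ↦ f (chartSymm n x₀ z)) ∘ (↑) := rfl
  rw [chartVol_eq_map, (measurableEmbedding_chartSymm x₀).integrable_map_iff, hcomp,
    ← (MeasurableEmbedding.subtype_coe hT).integrable_map_iff, map_comap_subtype_coe hT,
    restrict_withDensity hT]
  refine (integrable_withDensity_iff_integrable_coe_smul₀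
    (aemeasurable_dens x₀).real_toNNReal).trans (integrable_congr ?_)
  filter_upwards [ae_restrict_mem hT] with z hz
  rw [smul_eq_mul, Real.coe_toNNReal _ (dens_pos (chartSymm_mem_source hz)).le]

theorem setIntegral_vol (x₀ : M) (f : M → ℝ) :
    ∫ y in (chartAt (Euc n) x₀).source, f y ∂(vol n M) = ∫ z in chartTarget n x₀,
      dens n x₀ (chartSymm n x₀ z) * f (chartSymm n x₀ z) := by
  rw [vol_restrict_source, integral_chartVol]

theorem integrableOn_vol_iff (x₀ : M) (f : M → ℝ) :
    IntegrableOn f (chartAt (Euc n) x₀).source (vol n M) ↔ IntegrableOn (fun z ↦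
      dens n x₀ (chartSymm n x₀ z) * f (chartSymm n x₀ z)) (chartTarget n x₀) := by
  rw [IntegrableOn, vol_restrict_source, integrable_chartVol_iff]

theorem chartVol_lt_top_of_image_subset {x₀ : M} {A : Set M} (hA : MeasurableSet A)
    (hAs : A ⊆ (chartAt (Euc n) x₀).source) {K : Set (Euc n)} (hK : IsCompact K)
    (hAK : extChartAt (𝓡 n) x₀ '' A ⊆ K) (hKT : K ⊆ chartTarget n x₀) :
    chartVol n x₀ A < ⊤ := by
  rw [chartVol_apply x₀ hA, ← image_extChartAt hAs]
  exact (lintegral_mono_set hAK).trans_lt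
    (((continuousOn_dens_chartSymm x₀).mono hKT).integrableOn_compact hK).lintegral_lt_top

instance isLocallyFiniteMeasure_vol : IsLocallyFiniteMeasure (vol n M) := by
  refine ⟨fun y ↦ ?_⟩
  obtain ⟨K, hKy, hKT, hK⟩ := local_compact_nhds (extChartAt_target_mem_nhds (I := 𝓡 n) y)
  set U := (chartAt (Euc n) y).source ∩ extChartAt (𝓡 n) y ⁻¹' interior K
  have hUs : U ⊆ (chartAt (Euc n) y).source := inter_subset_left
  have hU : IsOpen U := by
    have h := (continuousOn_extChartAt (I := 𝓡 n) y).isOpen_inter_preimage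
      (isOpen_extChartAt_source y) (isOpen_interior (s := K))
    rwa [extChartAt_source] at h
  have hUK : extChartAt (𝓡 n) y '' U ⊆ K := by
    rintro - ⟨z, hz, rfl⟩
    exact interior_subset hz.2
  refine ⟨U, hU.mem_nhds ⟨mem_chart_source _ y, mem_interior_iff_mem_nhds.2 hKy⟩, ?_⟩
  rw [← Measure.restrict_eq_self _ hUs, vol_restrict_source]
  exact chartVol_lt_top_of_image_subset hU.measurableSet hUs hK hUK hKT

instance isOpenPosMeasure_vol : (vol n M).IsOpenPosMeasure := by
  refine ⟨fun U hU ⟨y, hy⟩ hU0 ↦ ?_⟩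
  have hchart : chartVol n y U = 0 := le_antisymm ((chartVol_le_vol y U).trans hU0.le) zero_le
  have hopen : IsOpen (chartTarget n y ∩ chartSymm n y ⁻¹' U) :=
    (continuousOn_chartSymm y).isOpen_inter_preimage (isOpen_chartTarget y) hU
  have hne : (chartTarget n y ∩ chartSymm n y ⁻¹' U).Nonempty :=
    ⟨extChartAt (𝓡 n) y y, mem_extChartAt_target y, by
      rwa [mem_preimage, chartSymm_extChartAt (mem_chart_source _ y)]⟩
  refine (hopen.measure_pos volume hne).ne' ?_
  rw [chartVol_apply y hU.measurableSet, setLIntegral_eq_zero_iff' hopen.measurableSet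
    ((aemeasurable_dens y).mono_measure
      (Measure.restrict_mono inter_subset_left le_rfl)).ennreal_ofReal] at hchart
  refine measure_eq_zero_iff_ae_notMem.2 ?_
  filter_upwards [hchart] with z hz hzU
  exact (dens_pos (chartSymm_mem_source hzU.1)).not_ge (ENNReal.ofReal_eq_zero.1 (hz hzU))

end SmoothVolume

section EuclideanIntegration

variable {n : ℕ}

theorem integrable_mul_fderiv_of_lipschitzWith {ψ : Euc n → ℝ} {C : NNReal}
    (hψ : LipschitzWith C ψ) {F : Euc n → ℝ} (hF : Integrable F) (i : Fin n) :
    Integrable (fun z ↦ F z * fderiv ℝ ψ z (EuclideanSpace.single i 1)) := by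
  refine hF.mul_bdd (c := C) (measurable_fderiv_apply_const ℝ ψ _).aestronglyMeasurable
    (Filter.Eventually.of_forall fun z ↦ ((fderiv ℝ ψ z).le_opNorm _).trans ?_)
  rw [PiLp.norm_single, norm_one, mul_one]
  exact norm_fderiv_le_of_lipschitz ℝ hψ

theorem integrable_mul_fderiv_of_hasCompactSupport {ψ F : Euc n → ℝ} (hψ : Continuous ψ)
    (hF : ContDiff ℝ 1 F) (hFc : HasCompactSupport F) (i : Fin n) :
    Integrable (fun z ↦ ψ z * fderiv ℝ F z (EuclideanSpace.single i 1)) := by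
  have hcont : Continuous fun z ↦ fderiv ℝ F z (EuclideanSpace.single i 1) :=
    (hF.continuous_fderiv one_ne_zero).clm_apply continuous_const
  exact (hψ.mul hcont).integrable_of_hasCompactSupport (hFc.fderiv_apply ℝ _).mul_left

theorem integral_lipschitz_mul_fderiv {ψ : Euc n → ℝ} {C : NNReal}
    (hψ : LipschitzWith C ψ) {F : Euc n → ℝ} (hF : ContDiff ℝ 1 F) (hFc : HasCompactSupport F)
    (i : Fin n) :
    ∫ z, ψ z * fderiv ℝ F z (EuclideanSpace.single i 1) =
      - ∫ z, F z * fderiv ℝ ψ z (EuclideanSpace.single i 1) := by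
  set e : Euc n := EuclideanSpace.single i 1
  obtain ⟨D, hD⟩ := hF.lipschitzWith_of_hasCompactSupport hFc one_ne_zero
  have hψline : ∫ z, lineDeriv ℝ ψ z e * F z = ∫ z, F z * fderiv ℝ ψ z e := by
    refine integral_congr_ae ?_
    filter_upwards [hψ.ae_differentiableAt (μ := volume)] with z hz
    rw [hz.lineDeriv_eq_fderiv, mul_comm]
  have hFline : ∫ z, lineDeriv ℝ F z (-e) * ψ z = - ∫ z, ψ z * fderiv ℝ F z e := by
    rw [← integral_neg]
    refine integral_congr_ae (Filter.Eventually.of_forall fun z ↦ ?_)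
    simp only
    rw [lineDeriv_neg, ((hF.differentiable one_ne_zero) z).lineDeriv_eq_fderiv]
    ring
  rw [← hψline, hψ.integral_lineDeriv_mul_eq (μ := volume) hD hFc e, hFline, neg_neg]

theorem integral_lipschitz_mul_divergence {ψ : Euc n → ℝ} {C : NNReal}
    (hψ : LipschitzWith C ψ) {F : Fin n → Euc n → ℝ} (hF : ∀ i, ContDiff ℝ 1 (F i))
    (hFc : ∀ i, HasCompactSupport (F i)) :
    ∫ z, ψ z * ∑ i, fderiv ℝ (F i) z (EuclideanSpace.single i 1) =
      - ∫ z, ∑ i, F i z * fderiv ℝ ψ z (EuclideanSpace.single i 1) := by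
  simp only [Finset.mul_sum]
  rw [integral_finsetSum _ fun i _ ↦ integrable_mul_fderiv_of_lipschitzWith hψ
      ((hF i).continuous.integrable_of_hasCompactSupport (hFc i)) i,
    integral_finsetSum _ fun i _ ↦
      integrable_mul_fderiv_of_hasCompactSupport hψ.continuous (hF i) (hFc i) i,
    ← Finset.sum_neg_distrib]
  exact Finset.sum_congr rfl fun i _ ↦ integral_lipschitz_mul_fderiv hψ (hF i) (hFc i) i

end EuclideanIntegration

section ChartDivergence

variable {n : ℕ} {M : Type*} [TopologicalSpace M] [ChartedSpace (Euc n) M]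
  [IsManifold (𝓡 n) ∞ M]

theorem IsSmoothField.smul {v : (x : M) → TangentSpace (𝓡 n) x} (hv : IsSmoothField v)
    {f : M → ℝ} (hf : ∀ y, SmoothAt n f y) : IsSmoothField (fun z ↦ f z • v z) := by
  refine isSmoothField_of_coframe fun y i ↦ ?_
  simp only [map_smul, smul_eq_mul]
  exact (hf y).mul (hv.smoothAt_coframe (mem_chart_source _ y) i)

theorem continuous_mvfderiv_apply {v : (x : M) → TangentSpace (𝓡 n) x} (hv : IsSmoothField v)
    {f : M → ℝ} (hf : ∀ y, SmoothAt n f y) : Continuous fun y ↦ mvfderiv (𝓡 n) f y (v y) := by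
  refine continuous_iff_continuousAt.2 fun y ↦ ?_
  have hy := mem_chart_source (Euc n) y
  have hsum : SmoothAt n (fun z ↦ ∑ i, coframe y i z (v z) * pd y i f z) y :=
    SmoothAt.sum fun i _ ↦ (hv.smoothAt_coframe hy i).mul ((hf y).pd hy i)
  refine hsum.continuousAt.congr ?_
  filter_upwards [(chartAt (Euc n) y).open_source.mem_nhds hy] with z hz
  exact (mvfderiv_eq_sum_pd hz f (v z)).symm

variable [RiemannianBundle (fun x : M ↦ TangentSpace (𝓡 n) x)]

/-- The Riemannian divergence of a vector field, computed in the preferred chart at `x₀`; the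
divergence `dvg` uses at each point the chart preferred there. -/
def chartDvg (x₀ : M) (v : (x : M) → TangentSpace (𝓡 n) x) (y : M) : ℝ :=
  (dens n x₀ y)⁻¹ * ∑ i, pd x₀ i (fun z ↦ dens n x₀ z * coframe x₀ i z (v z)) y

theorem chartDvg_eq_zero_of_eventually_eq_zero (x₀ : M) {v : (x : M) → TangentSpace (𝓡 n) x}
    {y : M} (h : ∀ᶠ z in nhds y, v z = 0) : chartDvg x₀ v y = 0 := by
  have hpd : ∀ i, pd x₀ i (fun z ↦ dens n x₀ z * coframe x₀ i z (v z)) y = 0 := fun i ↦ by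
    rw [pd_congr (g := fun _ ↦ 0), pd_const]
    filter_upwards [h] with z hz
    rw [hz, map_zero, mul_zero]
  rw [chartDvg, Finset.sum_eq_zero fun i _ ↦ hpd i, mul_zero]

variable [IsContMDiffRiemannianBundle (𝓡 n) ∞ (Euc n) (fun x : M ↦ TangentSpace (𝓡 n) x)]

theorem smoothAt_dens_mul_coframe {v : (x : M) → TangentSpace (𝓡 n) x} (hv : IsSmoothField v)
    {x₀ y : M} (hy : y ∈ (chartAt (Euc n) x₀).source) (i : Fin n) :
    SmoothAt n (fun z ↦ dens n x₀ z * coframe x₀ i z (v z)) y :=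
  (smoothAt_dens hy).mul (hv.smoothAt_coframe hy i)

theorem smoothAt_chartDvg {v : (x : M) → TangentSpace (𝓡 n) x} (hv : IsSmoothField v)
    {x₀ y : M} (hy : y ∈ (chartAt (Euc n) x₀).source) : SmoothAt n (chartDvg x₀ v) y :=
  SmoothAt.mul ((contDiffAt_inv ℝ (dens_pos hy).ne').contMDiffAt.comp y (smoothAt_dens hy))
    (SmoothAt.sum fun i _ ↦ (smoothAt_dens_mul_coframe hv hy i).pd hy i)

theorem chartDvg_smul {v : (x : M) → TangentSpace (𝓡 n) x} (hv : IsSmoothField v)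
    {f : M → ℝ} {x₀ y : M} (hy : y ∈ (chartAt (Euc n) x₀).source) (hf : SmoothAt n f y) :
    chartDvg x₀ (fun z ↦ f z • v z) y = f y * chartDvg x₀ v y + mvfderiv (𝓡 n) f y (v y) := by
  have hdens := (dens_pos (n := n) hy).ne'
  simp only [chartDvg, map_smul, smul_eq_mul, mul_left_comm _ (f _),
    pd_mul hf.mdifferentiableAt (smoothAt_dens_mul_coframe hv hy _).mdifferentiableAt]
  rw [Finset.sum_add_distrib, ← Finset.mul_sum, mul_add, mul_left_comm, mvfderiv_eq_sum_pd hy]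
  congr 1
  rw [Finset.mul_sum]
  refine Finset.sum_congr rfl fun i _ ↦ ?_
  field_simp

end ChartDivergence

section ChartFlux

variable {n : ℕ} {M : Type*} [TopologicalSpace M] [ChartedSpace (Euc n) M]
  [IsManifold (𝓡 n) ∞ M] [RiemannianBundle (fun x : M ↦ TangentSpace (𝓡 n) x)]

/-- The function `√det (g_ij) vⁱ` in the coordinates of the preferred chart at `x₀`, extended by
zero to `ℝⁿ`. -/
def chartFlux (x₀ : M) (v : (x : M) → TangentSpace (𝓡 n) x) (i : Fin n) : Euc n → ℝ :=
  (chartTarget n x₀).indicator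
    ((fun y ↦ dens n x₀ y * coframe x₀ i y (v y)) ∘ chartSymm n x₀)

theorem chartFlux_eventuallyEq {x₀ y : M} (hy : y ∈ (chartAt (Euc n) x₀).source)
    (v : (x : M) → TangentSpace (𝓡 n) x) (i : Fin n) :
    chartFlux x₀ v i =ᶠ[nhds (extChartAt (𝓡 n) x₀ y)]
      (fun y ↦ dens n x₀ y * coframe x₀ i y (v y)) ∘ chartSymm n x₀ :=
  eqOn_indicator.eventuallyEq_of_mem ((isOpen_chartTarget x₀).mem_nhds
    ((extChartAt (𝓡 n) x₀).map_source (mem_extChartAt_source_of_mem hy)))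

theorem chartFlux_extChartAt {x₀ y : M} (hy : y ∈ (chartAt (Euc n) x₀).source)
    (v : (x : M) → TangentSpace (𝓡 n) x) (i : Fin n) :
    chartFlux x₀ v i (extChartAt (𝓡 n) x₀ y) = dens n x₀ y * coframe x₀ i y (v y) := by
  rw [(chartFlux_eventuallyEq hy v i).eq_of_nhds, Function.comp_apply, chartSymm_extChartAt hy]

theorem dens_mul_chartDvg {x₀ y : M} (hy : y ∈ (chartAt (Euc n) x₀).source)
    (v : (x : M) → TangentSpace (𝓡 n) x) :
    dens n x₀ y * chartDvg x₀ v y =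
      ∑ i, fderiv ℝ (chartFlux x₀ v i) (extChartAt (𝓡 n) x₀ y) (EuclideanSpace.single i 1) := by
  rw [chartDvg, mul_inv_cancel_left₀ (dens_pos hy).ne']
  refine Finset.sum_congr rfl fun i _ ↦ ?_
  rw [pd_eq_fderiv hy, (chartFlux_eventuallyEq hy v i).fderiv_eq]

theorem dens_mul_mvfderiv {x₀ y : M} (hy : y ∈ (chartAt (Euc n) x₀).source)
    (v : (x : M) → TangentSpace (𝓡 n) x) {ψ : M → ℝ} {φ : Euc n → ℝ}
    (h : ψ ∘ chartSymm n x₀ =ᶠ[nhds (extChartAt (𝓡 n) x₀ y)] φ) :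
    dens n x₀ y * mvfderiv (𝓡 n) ψ y (v y) = ∑ i, chartFlux x₀ v i (extChartAt (𝓡 n) x₀ y) *
      fderiv ℝ φ (extChartAt (𝓡 n) x₀ y) (EuclideanSpace.single i 1) := by
  rw [mvfderiv_eq_sum_pd hy, Finset.mul_sum]
  refine Finset.sum_congr rfl fun i _ ↦ ?_
  rw [pd_eq_fderiv hy, h.fderiv_eq, chartFlux_extChartAt hy, mul_assoc]

theorem chartFlux_eq_zero {x₀ : M} {K : Set M} {v : (x : M) → TangentSpace (𝓡 n) x}
    (hv : ∀ y ∉ K, v y = 0) (i : Fin n) {z : Euc n} (hz : z ∉ extChartAt (𝓡 n) x₀ '' K) :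
    chartFlux x₀ v i z = 0 := by
  refine indicator_apply_eq_zero.2 fun hzT ↦ ?_
  have hzK : chartSymm n x₀ z ∉ K := fun h ↦ hz ⟨_, h, (extChartAt (𝓡 n) x₀).right_inv hzT⟩
  rw [Function.comp_apply, hv _ hzK, map_zero, mul_zero]

theorem chartFlux_eventuallyEq_zero {x₀ : M} {K : Set M} (hK : IsCompact K)
    (hKS : K ⊆ (chartAt (Euc n) x₀).source) {v : (x : M) → TangentSpace (𝓡 n) x}
    (hv : ∀ y ∉ K, v y = 0) (i : Fin n) {z : Euc n} (hz : z ∉ extChartAt (𝓡 n) x₀ '' K) :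
    chartFlux x₀ v i =ᶠ[nhds z] fun _ ↦ 0 := by
  filter_upwards [(isCompact_image_extChartAt hK hKS).isClosed.isOpen_compl.mem_nhds hz]
    with w hw using chartFlux_eq_zero hv i hw

theorem hasCompactSupport_chartFlux {x₀ : M} {K : Set M} (hK : IsCompact K)
    (hKS : K ⊆ (chartAt (Euc n) x₀).source) {v : (x : M) → TangentSpace (𝓡 n) x}
    (hv : ∀ y ∉ K, v y = 0) (i : Fin n) : HasCompactSupport (chartFlux x₀ v i) :=
  HasCompactSupport.intro (isCompact_image_extChartAt hK hKS) fun _ ↦ chartFlux_eq_zero hv i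

variable [IsContMDiffRiemannianBundle (𝓡 n) ∞ (Euc n) (fun x : M ↦ TangentSpace (𝓡 n) x)]

theorem contDiff_chartFlux {x₀ : M} {K : Set M} (hK : IsCompact K)
    (hKS : K ⊆ (chartAt (Euc n) x₀).source) {v : (x : M) → TangentSpace (𝓡 n) x}
    (hvsm : IsSmoothField v) (hv : ∀ y ∉ K, v y = 0) (i : Fin n) :
    ContDiff ℝ ∞ (chartFlux x₀ v i) := by
  refine contDiff_iff_contDiffAt.2 fun z ↦ ?_
  by_cases hz : z ∈ extChartAt (𝓡 n) x₀ '' K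
  · obtain ⟨y, hy, rfl⟩ := hz
    exact ((smoothAt_iff_contDiffAt_chart (hKS hy)).1
      (smoothAt_dens_mul_coframe hvsm (hKS hy) i)).congr_of_eventuallyEq
      (chartFlux_eventuallyEq (hKS hy) v i)
  · exact contDiffAt_const.congr_of_eventuallyEq (chartFlux_eventuallyEq_zero hK hKS hv i hz)

end ChartFlux

section ChartIntegration

variable {n : ℕ} {M : Type*} [TopologicalSpace M] [ChartedSpace (Euc n) M]
  [IsManifold (𝓡 n) ∞ M] [RiemannianBundle (fun x : M ↦ TangentSpace (𝓡 n) x)]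
  {v : (x : M) → TangentSpace (𝓡 n) x} {x₀ : M}
  {K : Set M} {ψ : M → ℝ} {φ : Euc n → ℝ} {C : NNReal}

theorem dens_mul_mvfderiv_chartSymm (hvK : ∀ y ∉ K, v y = 0)
    (hψ : ∀ y ∈ K, ψ ∘ chartSymm n x₀ =ᶠ[nhds (extChartAt (𝓡 n) x₀ y)] φ)
    {z : Euc n} (hz : z ∈ chartTarget n x₀) :
    dens n x₀ (chartSymm n x₀ z) * mvfderiv (𝓡 n) ψ (chartSymm n x₀ z) (v (chartSymm n x₀ z)) =
      ∑ i, chartFlux x₀ v i z * fderiv ℝ φ z (EuclideanSpace.single i 1) := by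
  have hzS := chartSymm_mem_source hz
  have hzz : extChartAt (𝓡 n) x₀ (chartSymm n x₀ z) = z := (extChartAt (𝓡 n) x₀).right_inv hz
  by_cases hzK : chartSymm n x₀ z ∈ K
  · rw [dens_mul_mvfderiv hzS v (hψ _ hzK), hzz]
  · have hflux : ∀ i, chartFlux x₀ v i z = 0 := fun i ↦ by
      rw [← hzz, chartFlux_extChartAt hzS, hvK _ hzK, map_zero, mul_zero]
    simp only [hvK _ hzK, map_zero, mul_zero, hflux, zero_mul, Finset.sum_const_zero]

theorem dens_mul_mul_chartDvg_chartSymm (hK : IsCompact K)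
    (hKS : K ⊆ (chartAt (Euc n) x₀).source) (hvK : ∀ y ∉ K, v y = 0)
    (hψ : ∀ y ∈ K, ψ ∘ chartSymm n x₀ =ᶠ[nhds (extChartAt (𝓡 n) x₀ y)] φ)
    {z : Euc n} (hz : z ∈ chartTarget n x₀) :
    dens n x₀ (chartSymm n x₀ z) * (ψ (chartSymm n x₀ z) * chartDvg x₀ v (chartSymm n x₀ z)) =
      φ z * ∑ i, fderiv ℝ (chartFlux x₀ v i) z (EuclideanSpace.single i 1) := by
  have hzz : extChartAt (𝓡 n) x₀ (chartSymm n x₀ z) = z := (extChartAt (𝓡 n) x₀).right_inv hz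
  rw [mul_left_comm, dens_mul_chartDvg (chartSymm_mem_source hz), hzz]
  by_cases hzK : z ∈ extChartAt (𝓡 n) x₀ '' K
  · obtain ⟨y, hy, rfl⟩ := hzK
    rw [← (hψ y hy).eq_of_nhds, Function.comp_apply]
  · simp only [(chartFlux_eventuallyEq_zero hK hKS hvK _ hzK).fderiv_eq, fderiv_fun_const,
      Pi.zero_apply, zero_apply, Finset.sum_const_zero, mul_zero]

variable [IsContMDiffRiemannianBundle (𝓡 n) ∞ (Euc n) (fun x : M ↦ TangentSpace (𝓡 n) x)]
  [MeasurableSpace M] [BorelSpace M]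

theorem integrableOn_mvfderiv_apply (hv : IsSmoothField v) (hK : IsCompact K)
    (hKS : K ⊆ (chartAt (Euc n) x₀).source) (hvK : ∀ y ∉ K, v y = 0) (hφ : LipschitzWith C φ)
    (hψ : ∀ y ∈ K, ψ ∘ chartSymm n x₀ =ᶠ[nhds (extChartAt (𝓡 n) x₀ y)] φ) :
    IntegrableOn (fun y ↦ mvfderiv (𝓡 n) ψ y (v y)) (chartAt (Euc n) x₀).source (vol n M) := by
  rw [integrableOn_vol_iff, integrableOn_congr_fun
    (fun z hz ↦ dens_mul_mvfderiv_chartSymm hvK hψ hz) (measurableSet_chartTarget x₀)]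
  refine (integrable_finsetSum _ fun i _ ↦ ?_).integrableOn
  exact integrable_mul_fderiv_of_lipschitzWith hφ
    ((contDiff_chartFlux hK hKS hv hvK i).continuous.integrable_of_hasCompactSupport
      (hasCompactSupport_chartFlux hK hKS hvK i)) i

theorem setIntegral_mul_chartDvg (hv : IsSmoothField v) (hK : IsCompact K)
    (hKS : K ⊆ (chartAt (Euc n) x₀).source) (hvK : ∀ y ∉ K, v y = 0) (hφ : LipschitzWith C φ)
    (hψ : ∀ y ∈ K, ψ ∘ chartSymm n x₀ =ᶠ[nhds (extChartAt (𝓡 n) x₀ y)] φ) :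
    ∫ y in (chartAt (Euc n) x₀).source, ψ y * chartDvg x₀ v y ∂(vol n M) =
      - ∫ y in (chartAt (Euc n) x₀).source, mvfderiv (𝓡 n) ψ y (v y) ∂(vol n M) := by
  have hT := measurableSet_chartTarget (n := n) x₀
  have hnotMem : ∀ z ∉ chartTarget n x₀, z ∉ extChartAt (𝓡 n) x₀ '' K := by
    rintro - hz ⟨y, hy, rfl⟩
    exact hz ((extChartAt (𝓡 n) x₀).map_source (mem_extChartAt_source_of_mem (hKS hy)))
  rw [setIntegral_vol, setIntegral_vol,
    setIntegral_congr_fun hT fun z hz ↦ dens_mul_mul_chartDvg_chartSymm hK hKS hvK hψ hz,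
    setIntegral_congr_fun hT fun z hz ↦ dens_mul_mvfderiv_chartSymm hvK hψ hz,
    setIntegral_eq_integral_of_forall_compl_eq_zero fun z hz ↦ ?_,
    setIntegral_eq_integral_of_forall_compl_eq_zero fun z hz ↦ ?_,
    integral_lipschitz_mul_divergence hφ
      (fun i ↦ (contDiff_chartFlux hK hKS hv hvK i).of_le (by simp))
      (hasCompactSupport_chartFlux hK hKS hvK)]
  · exact Finset.sum_eq_zero fun i _ ↦ by rw [chartFlux_eq_zero hvK i (hnotMem z hz), zero_mul]
  · rw [Finset.sum_eq_zero fun i _ ↦ ?_, mul_zero]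
    rw [(chartFlux_eventuallyEq_zero hK hKS hvK i (hnotMem z hz)).fderiv_eq, fderiv_fun_const]
    rfl

theorem setIntegral_chartDvg_eq_zero (hv : IsSmoothField v) (hK : IsCompact K)
    (hKS : K ⊆ (chartAt (Euc n) x₀).source) (hvK : ∀ y ∉ K, v y = 0) :
    ∫ y in (chartAt (Euc n) x₀).source, chartDvg x₀ v y ∂(vol n M) = 0 := by
  simpa [mvfderiv_const] using setIntegral_mul_chartDvg (ψ := fun _ ↦ (1 : ℝ)) hv hK hKS hvK
    (LipschitzWith.const (1 : ℝ)) fun _ _ ↦ Filter.EventuallyEq.rfl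

end ChartIntegration

section Divergence

variable {n : ℕ} {M : Type*} [TopologicalSpace M] [ChartedSpace (Euc n) M]
  [IsManifold (𝓡 n) ∞ M] [RiemannianBundle (fun x : M ↦ TangentSpace (𝓡 n) x)]
  [IsContMDiffRiemannianBundle (𝓡 n) ∞ (Euc n) (fun x : M ↦ TangentSpace (𝓡 n) x)]

theorem dvg_smul {v : (x : M) → TangentSpace (𝓡 n) x} (hv : IsSmoothField v)
    {f : M → ℝ} {y : M} (hf : SmoothAt n f y) :
    dvg (fun z ↦ f z • v z) y = f y * dvg v y + mvfderiv (𝓡 n) f y (v y) :=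
  chartDvg_smul hv (mem_chart_source _ y) hf

theorem sum_dvg_smul_of_sum_eventuallyEq_one {v : (x : M) → TangentSpace (𝓡 n) x}
    (hv : IsSmoothField v) {ι : Type*} {s : Finset ι} {ρ : ι → M → ℝ} {y : M}
    (hρ : ∀ i ∈ s, SmoothAt n (ρ i) y) (hs : (fun z ↦ ∑ i ∈ s, ρ i z) =ᶠ[nhds y] fun _ ↦ 1) :
    ∑ i ∈ s, dvg (fun z ↦ ρ i z • v z) y = dvg v y := by
  rw [Finset.sum_congr rfl fun i hi ↦ dvg_smul hv (hρ i hi), Finset.sum_add_distrib,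
    ← Finset.sum_mul, hs.eq_of_nhds, one_mul,
    ← mvfderiv_sum s fun i hi ↦ (hρ i hi).mdifferentiableAt, mvfderiv_congr hs, mvfderiv_const]
  exact add_zero _

variable [MeasurableSpace M] [BorelSpace M]

theorem integrable_mul_chartDvg {v : (x : M) → TangentSpace (𝓡 n) x} (hv : IsSmoothField v)
    {x₀ : M} {g : M → ℝ} (hg : ∀ y, SmoothAt n g y) (hgc : HasCompactSupport g)
    (hgS : tsupport g ⊆ (chartAt (Euc n) x₀).source) :
    Integrable (fun y ↦ g y * chartDvg x₀ v y) (vol n M) := by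
  have hcont : Continuous fun y ↦ g y * chartDvg x₀ v y := continuous_of_tsupport fun y hy ↦
    (hg y).continuousAt.mul
      (smoothAt_chartDvg hv (hgS (tsupport_mul_subset_left hy))).continuousAt
  exact hcont.integrable_of_hasCompactSupport hgc.mul_right

variable [T2Space M]

theorem integral_mul_chartDvg {v : (x : M) → TangentSpace (𝓡 n) x} (hv : IsSmoothField v)
    {x₀ : M} {g : M → ℝ} (hg : ∀ y, SmoothAt n g y) (hgc : HasCompactSupport g)
    (hgS : tsupport g ⊆ (chartAt (Euc n) x₀).source) :
    ∫ y, g y * chartDvg x₀ v y ∂(vol n M) = - ∫ y, mvfderiv (𝓡 n) g y (v y) ∂(vol n M) := by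
  have hg0 : ∀ y ∉ tsupport g, g y = 0 := fun y ↦ image_eq_zero_of_notMem_tsupport
  have hd0 : ∀ y ∉ tsupport g, mvfderiv (𝓡 n) g y (v y) = 0 := fun y hy ↦ by
    rw [mvfderiv_eq_zero_of_notMem_tsupport hy]
    rfl
  have hd : Integrable (fun y ↦ mvfderiv (𝓡 n) g y (v y)) (vol n M) :=
    (continuous_mvfderiv_apply hv hg).integrable_of_hasCompactSupport
      (HasCompactSupport.intro hgc hd0)
  have hzero := setIntegral_chartDvg_eq_zero (hv.smul hg) hgc hgS (fun y hy ↦ by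
    rw [hg0 y hy, zero_smul])
  rw [setIntegral_congr_fun (measurableSet_source x₀) fun y hy ↦ chartDvg_smul hv hy (hg y),
    integral_add (integrable_mul_chartDvg hv hg hgc hgS).integrableOn hd.integrableOn,
    setIntegral_eq_integral_of_forall_compl_eq_zero fun y hy ↦ ?_,
    setIntegral_eq_integral_of_forall_compl_eq_zero fun y hy ↦ hd0 y fun h ↦ hy (hgS h)] at hzero
  · exact eq_neg_of_add_eq_zero_left hzero
  · rw [hg0 y fun h ↦ hy (hgS h), zero_mul]

variable [SigmaCompactSpace M]

theorem chartDvg_eq_chartDvg {v : (x : M) → TangentSpace (𝓡 n) x} (hv : IsSmoothField v)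
    {x₀ x₁ y : M} (hy₀ : y ∈ (chartAt (Euc n) x₀).source)
    (hy₁ : y ∈ (chartAt (Euc n) x₁).source) : chartDvg x₀ v y = chartDvg x₁ v y := by
  set W := (chartAt (Euc n) x₀).source ∩ (chartAt (Euc n) x₁).source
  have hW : IsOpen W := (chartAt (Euc n) x₀).open_source.inter (chartAt (Euc n) x₁).open_source
  have hcont : ContinuousOn (fun z ↦ chartDvg x₀ v z - chartDvg x₁ v z) W := fun z hz ↦
    ((smoothAt_chartDvg hv hz.1).continuousAt.sub
      (smoothAt_chartDvg hv hz.2).continuousAt).continuousWithinAt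
  have hae : ∀ᵐ z ∂vol n M, z ∈ W → chartDvg x₀ v z - chartDvg x₁ v z = 0 := by
    refine hW.ae_eq_zero_of_integral_contMDiff_smul_eq_zero (𝓡 n)
      (hcont.locallyIntegrableOn hW.measurableSet) fun g hg hgc hgW ↦ ?_
    have hg₀ := hgW.trans inter_subset_left
    have hg₁ := hgW.trans inter_subset_right
    simp only [smul_eq_mul, mul_sub]
    rw [integral_sub (integrable_mul_chartDvg hv hg hgc hg₀)
        (integrable_mul_chartDvg hv hg hgc hg₁), integral_mul_chartDvg hv hg hgc hg₀,
      integral_mul_chartDvg hv hg hgc hg₁, sub_self]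
  have hEqOn : EqOn (fun z ↦ chartDvg x₀ v z - chartDvg x₁ v z) 0 W :=
    Measure.eqOn_open_of_ae_eq ((ae_restrict_iff' hW.measurableSet).2 hae) hW hcont
      continuousOn_const
  exact sub_eq_zero.1 (hEqOn ⟨hy₀, hy₁⟩)

theorem dvg_eq_chartDvg {v : (x : M) → TangentSpace (𝓡 n) x} (hv : IsSmoothField v)
    {x₀ y : M} (hy : y ∈ (chartAt (Euc n) x₀).source) : dvg v y = chartDvg x₀ v y :=
  chartDvg_eq_chartDvg hv (mem_chart_source _ y) hy

theorem smoothAt_dvg {v : (x : M) → TangentSpace (𝓡 n) x} (hv : IsSmoothField v) (y : M) :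
    SmoothAt n (dvg v) y := by
  have hy := mem_chart_source (Euc n) y
  refine (smoothAt_chartDvg hv hy).congr_of_eventuallyEq ?_
  filter_upwards [(chartAt (Euc n) y).open_source.mem_nhds hy] with z hz
    using dvg_eq_chartDvg hv hz

end Divergence

section LipschitzTestFunctions

variable {n : ℕ} {M : Type*} [TopologicalSpace M] [ChartedSpace (Euc n) M]

/-- A function on `M` that is locally Lipschitz when read in the preferred charts: each point has
a neighbourhood on which the chart preferred there makes the function Lipschitz. -/
def LipschitzInCharts (n : ℕ) {M : Type*} [TopologicalSpace M] [ChartedSpace (Euc n) M]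
    (ψ : M → ℝ) : Prop :=
  ∀ x : M, ∃ V : Set (Euc n), IsOpen V ∧ extChartAt (𝓡 n) x x ∈ V ∧
    ∃ C : NNReal, LipschitzOnWith C (ψ ∘ chartSymm n x) V

theorem LipschitzInCharts.continuous {ψ : M → ℝ} (hψ : LipschitzInCharts n ψ) :
    Continuous ψ := by
  refine continuous_iff_continuousAt.2 fun x ↦ ?_
  obtain ⟨V, hV, hxV, C, hC⟩ := hψ x
  have hcomp : ContinuousAt ((ψ ∘ chartSymm n x) ∘ extChartAt (𝓡 n) x) x :=
    (hC.continuousOn.continuousAt (hV.mem_nhds hxV)).comp (continuousAt_extChartAt x)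
  refine hcomp.congr ?_
  filter_upwards [(chartAt (Euc n) x).open_source.mem_nhds (mem_chart_source _ x)] with y hy
  simp only [Function.comp_apply, chartSymm_extChartAt hy]

theorem LipschitzInCharts.exists_lipschitzWith {ψ : M → ℝ} (hψ : LipschitzInCharts n ψ) (x : M) :
    ∃ U K : Set M, IsOpen U ∧ x ∈ U ∧ IsCompact K ∧ U ⊆ K ∧ K ⊆ (chartAt (Euc n) x).source ∧
      ∃ (C : NNReal) (φ : Euc n → ℝ), LipschitzWith C φ ∧
        ∀ y ∈ K, ψ ∘ chartSymm n x =ᶠ[nhds (extChartAt (𝓡 n) x y)] φ := by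
  obtain ⟨V, hV, hxV, C, hC⟩ := hψ x
  obtain ⟨φ, hφ, hφeq⟩ := hC.extend_real
  obtain ⟨L, hL, hLV, hLc⟩ := local_compact_nhds
    (Filter.inter_mem (extChartAt_target_mem_nhds x) (hV.mem_nhds hxV))
  refine ⟨(extChartAt (𝓡 n) x).source ∩ extChartAt (𝓡 n) x ⁻¹' interior L, chartSymm n x '' L,
    (continuousOn_extChartAt x).isOpen_inter_preimage (isOpen_extChartAt_source x) isOpen_interior,
    ⟨mem_extChartAt_source x, mem_interior_iff_mem_nhds.2 hL⟩,
    hLc.image_of_continuousOn ((continuousOn_chartSymm x).mono (hLV.trans inter_subset_left)),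
    fun y hy ↦ ⟨_, interior_subset hy.2, (extChartAt (𝓡 n) x).left_inv hy.1⟩,
    image_subset_iff.2 fun z hz ↦ chartSymm_mem_source (hLV hz).1, C, φ, hφ, ?_⟩
  rintro - ⟨z, hz, rfl⟩
  rw [(extChartAt (𝓡 n) x).right_inv (hLV hz).1]
  exact hφeq.eventuallyEq_of_mem (hV.mem_nhds (hLV hz).2)

end LipschitzTestFunctions

section PartitionOfUnity

variable {n : ℕ} {M : Type*} [TopologicalSpace M] [ChartedSpace (Euc n) M]

theorem exists_finset_sum_eventuallyEq_one {ι : Type*} (ρ : SmoothPartitionOfUnity ι (𝓡 n) M)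
    {A : Set M} (hA : IsCompact A) :
    ∃ s : Finset ι, ∀ y ∈ A, (fun z ↦ ∑ i ∈ s, ρ i z) =ᶠ[nhds y] fun _ ↦ 1 := by
  classical
  obtain ⟨t, -, ht⟩ := hA.elim_nhds_subcover
    (fun y ↦ interior {z | ρ.finsupport z ⊆ ρ.fintsupport y})
    (fun y _ ↦ interior_mem_nhds.2 (ρ.eventually_finsupport_subset y))
  refine ⟨t.biUnion fun y ↦ ρ.fintsupport y, fun y hy ↦ ?_⟩
  obtain ⟨w, hw, hyw⟩ := mem_iUnion₂.1 (ht hy)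
  filter_upwards [isOpen_interior.mem_nhds hyw] with z hz
  exact ρ.sum_finsupport' z (mem_univ z)
    ((interior_subset hz : ρ.finsupport z ⊆ ρ.fintsupport w).trans
      (Finset.subset_biUnion_of_mem (fun y ↦ ρ.fintsupport y) hw))

end PartitionOfUnity

section DivergenceTheorem

variable {n : ℕ} {M : Type*} [TopologicalSpace M] [ChartedSpace (Euc n) M]
  [IsManifold (𝓡 n) ∞ M] [RiemannianBundle (fun x : M ↦ TangentSpace (𝓡 n) x)]
  [IsContMDiffRiemannianBundle (𝓡 n) ∞ (Euc n) (fun x : M ↦ TangentSpace (𝓡 n) x)]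
  [MeasurableSpace M] [BorelSpace M]

theorem integrable_mvfderiv_apply_of_eq_zero_off {v : (x : M) → TangentSpace (𝓡 n) x}
    (hv : IsSmoothField v) {x₀ : M} {K : Set M} (hK : IsCompact K)
    (hKS : K ⊆ (chartAt (Euc n) x₀).source) (hvK : ∀ y ∉ K, v y = 0) {ψ : M → ℝ} {φ : Euc n → ℝ}
    {C : NNReal} (hφ : LipschitzWith C φ)
    (hψ : ∀ y ∈ K, ψ ∘ chartSymm n x₀ =ᶠ[nhds (extChartAt (𝓡 n) x₀ y)] φ) :
    Integrable (fun y ↦ mvfderiv (𝓡 n) ψ y (v y)) (vol n M) := by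
  refine (integrableOn_iff_integrable_of_support_subset fun y hy ↦ hKS ?_).1
    (integrableOn_mvfderiv_apply hv hK hKS hvK hφ hψ)
  by_contra hyK
  exact hy (by simp only [hvK y hyK, map_zero])

variable [T2Space M] [SigmaCompactSpace M]

theorem integral_mul_dvg_of_eq_zero_off {v : (x : M) → TangentSpace (𝓡 n) x}
    (hv : IsSmoothField v) {x₀ : M} {K : Set M} (hK : IsCompact K)
    (hKS : K ⊆ (chartAt (Euc n) x₀).source) (hvK : ∀ y ∉ K, v y = 0) {ψ : M → ℝ} {φ : Euc n → ℝ}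
    {C : NNReal} (hφ : LipschitzWith C φ)
    (hψ : ∀ y ∈ K, ψ ∘ chartSymm n x₀ =ᶠ[nhds (extChartAt (𝓡 n) x₀ y)] φ) :
    ∫ y, ψ y * dvg v y ∂(vol n M) = - ∫ y, mvfderiv (𝓡 n) ψ y (v y) ∂(vol n M) := by
  have hdvg : ∀ y ∉ K, dvg v y = 0 := fun y hy ↦
    chartDvg_eq_zero_of_eventually_eq_zero y
      (Filter.eventually_of_mem (hK.isClosed.isOpen_compl.mem_nhds hy) hvK)
  rw [← setIntegral_eq_integral_of_forall_compl_eq_zero (s := (chartAt (Euc n) x₀).source)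
      fun y hy ↦ by rw [hdvg y fun h ↦ hy (hKS h), mul_zero],
    ← setIntegral_eq_integral_of_forall_compl_eq_zero (s := (chartAt (Euc n) x₀).source)
      (f := fun y ↦ mvfderiv (𝓡 n) ψ y (v y))
      fun y hy ↦ by rw [hvK y fun h ↦ hy (hKS h), map_zero],
    ← setIntegral_mul_chartDvg hv hK hKS hvK hφ hψ]
  exact setIntegral_congr_fun (measurableSet_source x₀) fun y hy ↦ by rw [dvg_eq_chartDvg hv hy]

theorem integral_mul_dvg {v : (x : M) → TangentSpace (𝓡 n) x} (hv : IsSmoothField v)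
    {ψ : M → ℝ} (hψc : HasCompactSupport ψ) (hψ : LipschitzInCharts n ψ) :
    Integrable (fun y ↦ mvfderiv (𝓡 n) ψ y (v y)) (vol n M) ∧
    ∫ y, ψ y * dvg v y ∂(vol n M) = - ∫ y, mvfderiv (𝓡 n) ψ y (v y) ∂(vol n M) := by
  choose U K hU hxU hK hUK hKS C φ hφ hψφ using hψ.exists_lipschitzWith
  obtain ⟨ρ, hρ⟩ := SmoothPartitionOfUnity.exists_isSubordinate (𝓡 n) (isClosed_univ (X := M)) U hU
    fun x _ ↦ mem_iUnion.2 ⟨x, hxU x⟩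
  obtain ⟨s, hs⟩ := exists_finset_sum_eventuallyEq_one ρ hψc
  have hρv : ∀ i, IsSmoothField fun y ↦ ρ i y • v y := fun i ↦ hv.smul (ρ i).contMDiff
  have hρK : ∀ i, ∀ y ∉ K i, ρ i y • v y = 0 := fun i y hy ↦ by
    rw [image_eq_zero_of_notMem_tsupport fun h ↦ hy (hUK i (hρ i h)), zero_smul]
  have hint : ∀ i, Integrable (fun y ↦ mvfderiv (𝓡 n) ψ y (ρ i y • v y)) (vol n M) := fun i ↦
    integrable_mvfderiv_apply_of_eq_zero_off (hρv i) (hK i) (hKS i) (hρK i) (hφ i) (hψφ i)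
  have hint' : ∀ i, Integrable (fun y ↦ ψ y * dvg (fun z ↦ ρ i z • v z) y) (vol n M) := fun i ↦
    (hψ.continuous.mul (continuous_iff_continuousAt.2 fun y ↦
      (smoothAt_dvg (hρv i) y).continuousAt)).integrable_of_hasCompactSupport hψc.mul_right
  have hsum : (fun y ↦ mvfderiv (𝓡 n) ψ y (v y)) =
      fun y ↦ ∑ i ∈ s, mvfderiv (𝓡 n) ψ y (ρ i y • v y) := funext fun y ↦ by
    by_cases hy : y ∈ tsupport ψ
    · rw [← map_sum, ← Finset.sum_smul, (hs y hy).eq_of_nhds, one_smul]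
    · simp only [mvfderiv_eq_zero_of_notMem_tsupport hy, zero_apply, Finset.sum_const_zero]
  have hsum' : (fun y ↦ ψ y * dvg v y) =
      fun y ↦ ∑ i ∈ s, ψ y * dvg (fun z ↦ ρ i z • v z) y := funext fun y ↦ by
    rw [← Finset.mul_sum]
    by_cases hy : y ∈ tsupport ψ
    · rw [sum_dvg_smul_of_sum_eventuallyEq_one hv (fun i _ ↦ (ρ i).contMDiff y) (hs y hy)]
    · rw [image_eq_zero_of_notMem_tsupport hy, zero_mul, zero_mul]
  rw [hsum, hsum', integral_finsetSum s fun i _ ↦ hint i, integral_finsetSum s fun i _ ↦ hint' i,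
    ← Finset.sum_neg_distrib]
  exact ⟨integrable_finsetSum s fun i _ ↦ hint i, Finset.sum_congr rfl fun i _ ↦
    integral_mul_dvg_of_eq_zero_off (hρv i) (hK i) (hKS i) (hρK i) (hφ i) (hψφ i)⟩

end DivergenceTheorem

section LengthSpace

/-- An extended metric space in which the distance between two points can be split arbitrarily,
up to an arbitrarily small error. Length spaces have this property, and it is what makes
Hopf–Rinow work without geodesics. -/
def HasApproxSplitting (X : Type*) [EMetricSpace X] : Prop :=
  ∀ (x y : X) (r : NNReal) (s : ℝ≥0∞), edist x y < r + s → 0 < s →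
    ∃ z, edist x z ≤ r ∧ edist z y < s

variable {X : Type*} [EMetricSpace X]

theorem HasApproxSplitting.exists_mem_closedEBall_edist_lt (hX : HasApproxSplitting X)
    {x y : X} {r s : NNReal} (hs : 0 < s) (hy : edist y x < r + s) :
    ∃ z ∈ Metric.closedEBall x (r : ℝ≥0∞), edist y z < s := by
  obtain ⟨z, hxz, hzy⟩ := hX x y r s (by rwa [edist_comm]) (by exact_mod_cast hs)
  exact ⟨z, by rwa [Metric.mem_closedEBall, edist_comm], by rwa [edist_comm]⟩

theorem HasApproxSplitting.isCompact_closedEBall_of_forall_lt [CompleteSpace X]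
    (hX : HasApproxSplitting X) (x : X) {R : NNReal}
    (h : ∀ r < R, IsCompact (Metric.closedEBall x (r : ℝ≥0∞))) :
    IsCompact (Metric.closedEBall x (R : ℝ≥0∞)) := by
  rcases eq_zero_or_pos R with rfl | hR
  · rw [ENNReal.coe_zero, Metric.closedEBall_zero]
    exact isCompact_singleton
  rw [isCompact_iff_totallyBounded_isComplete]
  refine ⟨EMetric.totallyBounded_iff.2 fun ε hε ↦ ?_, Metric.isClosed_closedEBall.isComplete⟩
  obtain ⟨δ, hδ, hδε⟩ := ENNReal.lt_iff_exists_nnreal_btwn.1 hε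
  have hδ3 : 0 < δ / 3 := div_pos (by exact_mod_cast hδ) three_pos
  obtain ⟨t, ht, hcov⟩ := EMetric.totallyBounded_iff.1
    (h (R - δ / 3) (tsub_lt_self hR hδ3)).totallyBounded ((δ / 3 : NNReal) : ℝ≥0∞)
    (by exact_mod_cast hδ3)
  refine ⟨t, ht, fun y hy ↦ ?_⟩
  have hR_lt : R < R - δ / 3 + 2 * (δ / 3) :=
    calc R ≤ R - δ / 3 + δ / 3 := le_tsub_add
      _ < R - δ / 3 + δ / 3 + δ / 3 := lt_add_of_pos_right _ hδ3
      _ = R - δ / 3 + 2 * (δ / 3) := by ring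
  obtain ⟨z, hz, hyz⟩ := hX.exists_mem_closedEBall_edist_lt (mul_pos two_pos hδ3)
    (lt_of_le_of_lt hy (by exact_mod_cast hR_lt))
  obtain ⟨p, hp, hzp⟩ := mem_iUnion₂.1 (hcov hz)
  refine mem_iUnion₂.2 ⟨p, hp, lt_trans ?_ hδε⟩
  calc edist y p ≤ edist y z + edist z p := edist_triangle _ _ _
    _ < ((2 * (δ / 3) : NNReal) : ℝ≥0∞) + ((δ / 3 : NNReal) : ℝ≥0∞) :=
        ENNReal.add_lt_add hyz hzp
    _ = δ := by
        rw [← ENNReal.coe_add]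
        congr 1
        ring

theorem HasApproxSplitting.isCompact_closedEBall [CompleteSpace X] [LocallyCompactSpace X]
    (hX : HasApproxSplitting X) (x : X) (r : NNReal) :
    IsCompact (Metric.closedEBall x (r : ℝ≥0∞)) := by
  by_contra hr
  set S : Set NNReal := {r | ¬ IsCompact (Metric.closedEBall x (r : ℝ≥0∞))}
  have hK := hX.isCompact_closedEBall_of_forall_lt x (R := sInf S) fun r hr ↦
    not_not.1 (notMem_of_lt_csInf hr (OrderBot.bddBelow S))
  obtain ⟨K, hKc, hKi⟩ := exists_compact_superset hK
  obtain ⟨δ, hδ, hth⟩ := hK.exists_thickening_subset_open isOpen_interior hKi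
  lift δ to NNReal using hδ.le
  have hδ₀ : 0 < δ := hδ
  obtain ⟨s, hs, hsδ⟩ := exists_lt_of_csInf_lt (s := S) ⟨r, hr⟩ (lt_add_of_pos_right (sInf S) hδ₀)
  refine hs (hKc.of_isClosed_subset Metric.isClosed_closedEBall fun y hy ↦ ?_)
  obtain ⟨z, hz, hyz⟩ := hX.exists_mem_closedEBall_edist_lt hδ₀
    (lt_of_le_of_lt hy (by exact_mod_cast hsδ))
  refine interior_subset (hth ?_)
  rw [Metric.mem_thickening_iff_infEDist_lt, ENNReal.ofReal_coe_nnreal, Metric.infEDist_lt_iff]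
  exact ⟨z, hz, hyz⟩

end LengthSpace

section Distance

variable {n : ℕ} {M : Type*} [EMetricSpace M] [ChartedSpace (Euc n) M]
  [RiemannianBundle (fun x : M ↦ TangentSpace (𝓡 n) x)] [IsRiemannianManifold (𝓡 n) M]

theorem edist_le_pathELength {γ : ℝ → M} {a b : ℝ} (hab : a ≤ b)
    (hγ : ContMDiffOn 𝓘(ℝ, ℝ) (𝓡 n) 1 γ (Icc a b)) :
    edist (γ a) (γ b) ≤ pathELength (𝓡 n) γ a b := by
  rw [IsRiemannianManifold.out (I := 𝓡 n) (γ a) (γ b)]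
  exact riemannianEDist_le_pathELength hγ rfl rfl hab

theorem hasApproxSplitting (n : ℕ) (M : Type*) [EMetricSpace M] [ChartedSpace (Euc n) M]
    [RiemannianBundle (fun x : M ↦ TangentSpace (𝓡 n) x)] [IsRiemannianManifold (𝓡 n) M] :
    HasApproxSplitting M := by
  intro x y r s h hs
  rcases le_or_gt (edist x y) r with hr | hr
  · exact ⟨y, hr, by rwa [edist_self]⟩
  rw [IsRiemannianManifold.out (I := 𝓡 n) x y] at h
  obtain ⟨γ, rfl, rfl, hγ, hlen⟩ := exists_lt_of_riemannianEDist_lt h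
  have hc : ContinuousOn (fun t ↦ edist (γ 0) (γ t)) (Icc 0 1) :=
    (continuous_const.edist continuous_id).comp_continuousOn hγ.continuousOn
  obtain ⟨t, ht, hrt⟩ := intermediate_value_Icc (zero_le_one' ℝ) hc
    (show (r : ℝ≥0∞) ∈ Icc _ _ from ⟨by simp, hr.le⟩)
  refine ⟨γ t, hrt.le, ?_⟩
  have hleft := edist_le_pathELength ht.1 (hγ.mono (Icc_subset_Icc_right ht.2))
  have hright := edist_le_pathELength ht.2 (hγ.mono (Icc_subset_Icc_left ht.1))
  rw [← pathELength_add ht.1 ht.2] at hlen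
  have hsum : (r : ℝ≥0∞) + edist (γ t) (γ 1) < r + s :=
    lt_of_le_of_lt (add_le_add (hrt.ge.trans hleft) hright) hlen
  exact lt_of_add_lt_add_left hsum

theorem isCompact_closedEBall (n : ℕ) {M : Type*} [EMetricSpace M] [ChartedSpace (Euc n) M]
    [RiemannianBundle (fun x : M ↦ TangentSpace (𝓡 n) x)] [IsRiemannianManifold (𝓡 n) M]
    [CompleteSpace M] (x : M) (r : NNReal) :
    IsCompact (Metric.closedEBall x (r : ℝ≥0∞)) :=
  haveI : LocallyCompactSpace M := Manifold.locallyCompact_of_finiteDimensional (𝓡 n)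
  (hasApproxSplitting n M).isCompact_closedEBall x r

end Distance

section ChartMetric

variable {n : ℕ} {M : Type*} [TopologicalSpace M] [ChartedSpace (Euc n) M]
  [IsManifold (𝓡 n) ∞ M] [RiemannianBundle (fun x : M ↦ TangentSpace (𝓡 n) x)]

/-- The squared length at `y` of the tangent vector with coordinates `u` in the preferred chart
at `x₀`. -/
def gramSq (x₀ y : M) (u : Euc n) : ℝ := ∑ i, ∑ j, u i * u j * gram x₀ y i j

theorem gramSq_smul (x₀ y : M) (t : ℝ) (u : Euc n) :
    gramSq x₀ y (t • u) = t ^ 2 * gramSq x₀ y u := by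
  simp only [gramSq, Finset.mul_sum, PiLp.smul_apply, smul_eq_mul]
  exact Finset.sum_congr rfl fun i _ ↦ Finset.sum_congr rfl fun j _ ↦ by ring

theorem gramSq_le {x₀ y : M} {B : ℝ} (hB : ∀ i j : Fin n, |gram x₀ y i j| ≤ B) (u : Euc n) :
    gramSq x₀ y u ≤ n * n * B * ‖u‖ ^ 2 := by
  have hu : ∀ i, |u i| ≤ ‖u‖ := fun i ↦ PiLp.norm_apply_le u i
  calc gramSq x₀ y u ≤ ∑ _i : Fin n, ∑ _j : Fin n, ‖u‖ * ‖u‖ * B := by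
        refine Finset.sum_le_sum fun i _ ↦ Finset.sum_le_sum fun j _ ↦ (le_abs_self _).trans ?_
        rw [abs_mul, abs_mul]
        exact mul_le_mul (mul_le_mul (hu i) (hu j) (abs_nonneg _) (norm_nonneg _))
          (hB i j) (abs_nonneg _) (by positivity)
    _ = n * n * B * ‖u‖ ^ 2 := by
        simp only [Finset.sum_const, Finset.card_univ, Fintype.card_fin, nsmul_eq_mul]
        ring

theorem norm_symmL_sq (x₀ y : M) (u : Euc n) :
    ‖(trivializationAt (Euc n) (TangentSpace (𝓡 n)) x₀).symmL ℝ y u‖ ^ 2 = gramSq x₀ y u := by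
  have hu : u = ∑ i, u i • EuclideanSpace.single i (1 : ℝ) := by
    ext i
    simp [WithLp.ofLp_sum, Pi.single_apply]
  have h : (trivializationAt (Euc n) (TangentSpace (𝓡 n)) x₀).symmL ℝ y u
      = ∑ i, u i • frame x₀ i y := by
    conv_lhs => rw [hu]
    rw [map_sum]
    exact Finset.sum_congr rfl fun i _ ↦ map_smul _ _ _
  rw [← real_inner_self_eq_norm_sq, h, sum_inner]
  refine Finset.sum_congr rfl fun i _ ↦ ?_
  rw [inner_sum]
  refine Finset.sum_congr rfl fun j _ ↦ ?_
  rw [real_inner_smul_left, real_inner_smul_right, mul_assoc]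
  rfl

theorem norm_mfderivWithin_chartSymm_sq {x₀ : M} {z : Euc n} (hz : z ∈ chartTarget n x₀)
    (u : Euc n) :
    ‖mfderivWithin 𝓘(ℝ, Euc n) (𝓡 n) (chartSymm n x₀) (range (𝓡 n)) z u‖ ^ 2
      = gramSq x₀ (chartSymm n x₀ z) u := by
  have h : (trivializationAt (Euc n) (TangentSpace (𝓡 n)) x₀).symmL ℝ (chartSymm n x₀ z) u
      = mfderivWithin 𝓘(ℝ, Euc n) (𝓡 n) (chartSymm n x₀) (range (𝓡 n)) z u := by
    refine (congrArg (fun L : Euc n →L[ℝ] Euc n ↦ L u)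
      (TangentBundle.symmL_trivializationAt (I := 𝓡 n) (chartSymm_mem_source hz))).trans ?_
    exact congrArg (fun q ↦ (mfderivWithin 𝓘(ℝ, Euc n) (𝓡 n) (chartSymm n x₀) (range (𝓡 n)) q :
      Euc n →L[ℝ] Euc n) u) ((extChartAt (𝓡 n) x₀).right_inv hz)
  rw [← norm_symmL_sq, h]

theorem norm_mfderivWithin_chartSymm_lineMap_sq {x₀ : M} {z z' : Euc n} {t : ℝ}
    (ht : t ∈ Icc (0 : ℝ) 1) (hz : AffineMap.lineMap z z' t ∈ chartTarget n x₀) :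
    ‖mfderivWithin 𝓘(ℝ, ℝ) (𝓡 n) (chartSymm n x₀ ∘ AffineMap.lineMap z z') (Icc 0 1) t 1‖ ^ 2
      = gramSq x₀ (chartSymm n x₀ (AffineMap.lineMap z z' t)) (z' - z) := by
  let η : ℝ → Euc n := AffineMap.lineMap z z'
  have hη : HasDerivAt η (z' - z) t := AffineMap.hasDerivAt_lineMap
  have hu : UniqueDiffWithinAt ℝ (Icc (0 : ℝ) 1) t := uniqueDiffOn_Icc zero_lt_one t ht
  have hcomp : mfderivWithin 𝓘(ℝ, ℝ) (𝓡 n) (chartSymm n x₀ ∘ η) (Icc 0 1) t =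
      (mfderivWithin 𝓘(ℝ, Euc n) (𝓡 n) (chartSymm n x₀) (range (𝓡 n)) (η t)) ∘L
        (mfderivWithin 𝓘(ℝ, ℝ) 𝓘(ℝ, Euc n) η (Icc 0 1) t) := by
    refine mfderivWithin_comp _ (mdifferentiableWithinAt_extChartAt_symm hz)
      hη.differentiableAt.mdifferentiableAt.mdifferentiableWithinAt (fun s _ ↦ by simp) ?_
    rwa [uniqueMDiffWithinAt_iff_uniqueDiffWithinAt]
  have hline : mfderivWithin 𝓘(ℝ, ℝ) 𝓘(ℝ, Euc n) η (Icc 0 1) t 1 = z' - z := by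
    rw [mfderivWithin_eq_fderivWithin]
    change fderivWithin ℝ η (Icc 0 1) t 1 = z' - z
    rw [hη.hasFDerivAt.hasFDerivWithinAt.fderivWithin hu]
    simp
  have hspeed : mfderivWithin 𝓘(ℝ, ℝ) (𝓡 n) (chartSymm n x₀ ∘ η) (Icc 0 1) t 1 =
      (mfderivWithin 𝓘(ℝ, Euc n) (𝓡 n) (chartSymm n x₀) (range (𝓡 n)) (η t)) (z' - z) :=
    (DFunLike.congr_fun hcomp 1).trans (congrArg
      (mfderivWithin 𝓘(ℝ, Euc n) (𝓡 n) (chartSymm n x₀) (range (𝓡 n)) (η t)) hline)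
  exact (congrArg (fun u : TangentSpace (𝓡 n) (chartSymm n x₀ (η t)) ↦ ‖u‖ ^ 2) hspeed).trans
    (norm_mfderivWithin_chartSymm_sq hz (z' - z))

theorem pathELength_chartSymm_lineMap_le {x₀ : M} {z z' : Euc n} {c : ℝ} (hc : 0 ≤ c)
    (hT : ∀ t ∈ Icc (0 : ℝ) 1, AffineMap.lineMap z z' t ∈ chartTarget n x₀)
    (hb : ∀ t ∈ Icc (0 : ℝ) 1,
      gramSq x₀ (chartSymm n x₀ (AffineMap.lineMap z z' t)) (z' - z) ≤ c ^ 2) :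
    pathELength (𝓡 n) (chartSymm n x₀ ∘ AffineMap.lineMap z z') 0 1 ≤ ENNReal.ofReal c := by
  rw [pathELength_eq_lintegral_mfderivWithin_Icc]
  have hspeed : ∀ t ∈ Icc (0 : ℝ) 1, ‖mfderivWithin 𝓘(ℝ, ℝ) (𝓡 n)
      (chartSymm n x₀ ∘ AffineMap.lineMap z z') (Icc 0 1) t 1‖ₑ ≤ ENNReal.ofReal c := by
    intro t ht
    rw [← ofReal_norm]
    refine ENNReal.ofReal_le_ofReal (le_of_sq_le_sq ?_ hc)
    exact (norm_mfderivWithin_chartSymm_lineMap_sq ht (hT t ht)).le.trans (hb t ht)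
  exact (setLIntegral_mono' measurableSet_Icc hspeed).trans (by simp)

end ChartMetric

section ContinuousMetric

variable {n : ℕ} {M : Type*} [TopologicalSpace M] [ChartedSpace (Euc n) M]
  [IsManifold (𝓡 n) ∞ M] [RiemannianBundle (fun x : M ↦ TangentSpace (𝓡 n) x)]
  [IsContMDiffRiemannianBundle (𝓡 n) ∞ (Euc n) (fun x : M ↦ TangentSpace (𝓡 n) x)]

theorem continuousOn_gram_chartSymm (x₀ : M) (i j : Fin n) :
    ContinuousOn (fun z ↦ gram x₀ (chartSymm n x₀ z) i j) (chartTarget n x₀) := fun z hz ↦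
  (smoothAt_gram (chartSymm_mem_source hz) i j).continuousAt.comp_continuousWithinAt
    (continuousOn_chartSymm x₀ z hz)

theorem continuousOn_gramSq_chartSymm (x₀ : M) (u : Euc n) :
    ContinuousOn (fun z ↦ gramSq x₀ (chartSymm n x₀ z) u) (chartTarget n x₀) :=
  continuousOn_finsetSum _ fun i _ ↦ continuousOn_finsetSum _ fun j _ ↦
    continuousOn_const.mul (continuousOn_gram_chartSymm x₀ i j)

theorem exists_eventually_abs_gram_le (x : M) : ∃ B : ℝ, 0 ≤ B ∧
    ∀ᶠ z in nhds (extChartAt (𝓡 n) x x), ∀ i j : Fin n, |gram x (chartSymm n x z) i j| ≤ B := by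
  refine ⟨∑ i : Fin n, ∑ j : Fin n, |gram x x i j| + 1, by positivity,
    Filter.eventually_all.2 fun i ↦ Filter.eventually_all.2 fun j ↦ ?_⟩
  have hc := ((continuousOn_gram_chartSymm x i j).continuousAt (extChartAt_target_mem_nhds x)).abs
  refine (hc.eventually_lt_const (lt_of_le_of_lt ?_ (lt_add_one _))).mono fun z hz ↦ hz.le
  change |gram x (chartSymm n x (extChartAt (𝓡 n) x x)) i j| ≤ _
  rw [chartSymm_extChartAt (mem_chart_source (Euc n) x)]
  exact (Finset.single_le_sum (f := fun j ↦ |gram x x i j|) (fun _ _ ↦ abs_nonneg _)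
    (Finset.mem_univ j)).trans (Finset.single_le_sum (f := fun i ↦ ∑ j, |gram x x i j|)
    (fun _ _ ↦ Finset.sum_nonneg fun _ _ ↦ abs_nonneg _) (Finset.mem_univ i))

end ContinuousMetric

section LipschitzFunctions

variable {n : ℕ} {M : Type*} [EMetricSpace M] [ChartedSpace (Euc n) M]
  [IsManifold (𝓡 n) ∞ M] [RiemannianBundle (fun x : M ↦ TangentSpace (𝓡 n) x)]
  [IsRiemannianManifold (𝓡 n) M]

theorem edist_chartSymm_le {x₀ : M} {V : Set (Euc n)} (hV : Convex ℝ V)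
    (hVT : V ⊆ chartTarget n x₀) {z z' : Euc n} (hz : z ∈ V) (hz' : z' ∈ V) {c : ℝ} (hc : 0 ≤ c)
    (hb : ∀ p ∈ V, gramSq x₀ (chartSymm n x₀ p) (z' - z) ≤ c ^ 2) :
    edist (chartSymm n x₀ z) (chartSymm n x₀ z') ≤ ENNReal.ofReal c := by
  have hmem : ∀ t ∈ Icc (0 : ℝ) 1, AffineMap.lineMap z z' t ∈ V := fun t ht ↦
    hV.lineMap_mem hz hz' ht
  have hγ : ContMDiffOn 𝓘(ℝ, ℝ) (𝓡 n) 1 (chartSymm n x₀ ∘ AffineMap.lineMap z z')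
      (Icc (0 : ℝ) 1) :=
    (contMDiffOn_extChartAt_symm (n := 1) x₀).comp (t := chartTarget n x₀)
      (contMDiff_iff_contDiff.2
        (ContinuousAffineMap.lineMap (R := ℝ) z z').contDiff).contMDiffOn
      fun t ht ↦ hVT (hmem t ht)
  have hle := (edist_le_pathELength zero_le_one hγ).trans
    (pathELength_chartSymm_lineMap_le hc (fun t ht ↦ hVT (hmem t ht)) fun t ht ↦ hb _ (hmem t ht))
  simpa using hle

variable [IsContMDiffRiemannianBundle (𝓡 n) ∞ (Euc n) (fun x : M ↦ TangentSpace (𝓡 n) x)]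

theorem eventually_edist_chartSymm_line_le {x : M} {u : Euc n} {C : ℝ} (hC : 0 ≤ C)
    (hu : gramSq x x u < C ^ 2) :
    ∀ᶠ t in nhds (0 : ℝ), edist x (chartSymm n x (extChartAt (𝓡 n) x x + t • u)) ≤
      ENNReal.ofReal (C * |t|) := by
  set z := extChartAt (𝓡 n) x x
  have hz : chartSymm n x z = x := chartSymm_extChartAt (mem_chart_source (Euc n) x)
  have hT : chartTarget n x ∈ nhds z := extChartAt_target_mem_nhds x
  have hlt : ∀ᶠ p in nhds z, gramSq x (chartSymm n x p) u < C ^ 2 :=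
    ((continuousOn_gramSq_chartSymm x u).continuousAt hT).eventually_lt_const
      ((congrArg (gramSq x · u) hz).trans_lt hu)
  obtain ⟨r, hr, hball⟩ := Metric.mem_nhds_iff.1 (Filter.inter_mem hT hlt)
  have hline : Filter.Tendsto (fun t : ℝ ↦ z + t • u) (nhds 0) (nhds z) := by
    have hcont : Continuous fun t : ℝ ↦ z + t • u := by fun_prop
    simpa using hcont.tendsto 0
  filter_upwards [hline.eventually (Metric.ball_mem_nhds _ hr)] with t ht
  refine (congrArg (edist · _) hz).ge.trans ?_
  refine edist_chartSymm_le (convex_ball z r) (fun p hp ↦ (hball hp).1)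
    (Metric.mem_ball_self hr) ht (by positivity) fun p hp ↦ ?_
  rw [add_sub_cancel_left, gramSq_smul, mul_pow, sq_abs, mul_comm]
  exact mul_le_mul_of_nonneg_right (hball hp).2.le (sq_nonneg t)

theorem abs_mvfderiv_le_mul {ψ : M → ℝ} {x : M} {c C : ℝ} (hc : 0 ≤ c)
    (h : ∀ᶠ y in nhds x, edist (ψ y) (ψ x) ≤ ENNReal.ofReal c * edist y x)
    {w : TangentSpace (𝓡 n) x} (hw : ‖w‖ < C) : |mvfderiv (𝓡 n) ψ x w| ≤ c * C := by
  have hC : 0 ≤ C := (norm_nonneg w).trans hw.le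
  by_cases hψ : MDifferentiableAt (𝓡 n) 𝓘(ℝ, ℝ) ψ x
  swap
  · have h₀ : mvfderiv (𝓡 n) ψ x w = 0 :=
      congrArg (fun L : TangentSpace (𝓡 n) x →L[ℝ] ℝ ↦ L w)
        (mfderiv_zero_of_not_mdifferentiableAt hψ)
    rw [h₀, abs_zero]
    positivity
  have hx := mem_chart_source (Euc n) x
  set z := extChartAt (𝓡 n) x x
  have hz : chartSymm n x z = x := chartSymm_extChartAt hx
  set u : Euc n := (trivializationAt (Euc n) (TangentSpace (𝓡 n)) x).continuousLinearMapAt ℝ x w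
    with hu
  have hux : gramSq x x u = ‖w‖ ^ 2 := by
    rw [← norm_symmL_sq, hu, (trivializationAt (Euc n)
      (TangentSpace (𝓡 n)) x).symmL_continuousLinearMapAt (R := ℝ) (b := x) hx w]
  have hline : HasDerivAt (fun t : ℝ ↦ z + t • u) u 0 := by
    simpa using ((hasDerivAt_id (0 : ℝ)).smul_const u).const_add z
  have hline₀ : z + (0 : ℝ) • u = z := by rw [zero_smul, add_zero]
  have hder : HasDerivAt (fun t : ℝ ↦ ψ (chartSymm n x (z + t • u))) (mvfderiv (𝓡 n) ψ x w) 0 := by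
    rw [mvfderiv_eq_fderiv_chart hx ψ w]
    refine HasFDerivAt.comp_hasDerivAt (0 : ℝ) (l := ψ ∘ chartSymm n x) ?_ hline
    rw [hline₀]
    exact ((mdifferentiableAt_iff_differentiableAt_chart hx).1 hψ).hasFDerivAt
  have hsymm : Filter.Tendsto (fun t : ℝ ↦ chartSymm n x (z + t • u)) (nhds 0) (nhds x) := by
    have hcont : ContinuousAt (fun t : ℝ ↦ chartSymm n x (z + t • u)) 0 :=
      ContinuousAt.comp (g := chartSymm n x)
        (by rw [hline₀]; exact continuousAt_extChartAt_symm x) hline.continuousAt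
    simpa only [hline₀, hz] using hcont.tendsto
  refine hder.le_of_lip' (mul_nonneg hc hC) ?_
  filter_upwards [hsymm.eventually h, eventually_edist_chartSymm_line_le hC
    (hux.trans_lt (pow_lt_pow_left₀ hw (norm_nonneg w) two_ne_zero))] with t ht hd
  rw [edist_comm] at hd
  have hψt := ht.trans (mul_le_mul_right hd (ENNReal.ofReal c))
  rw [← ENNReal.ofReal_mul hc, edist_dist, ENNReal.ofReal_le_ofReal_iff (by positivity),
    Real.dist_eq, ← mul_assoc] at hψt
  simpa only [hline₀, hz, sub_zero, Real.norm_eq_abs] using hψt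

theorem abs_mvfderiv_le {ψ : M → ℝ} {x : M} {G : ℝ} (hG : 0 ≤ G)
    (h : ∀ c : ℝ, G < c → ∀ᶠ y in nhds x, edist (ψ y) (ψ x) ≤ ENNReal.ofReal c * edist y x)
    (w : TangentSpace (𝓡 n) x) : |mvfderiv (𝓡 n) ψ x w| ≤ G * ‖w‖ := by
  have hbound : ∀ c : ℝ, G < c → |mvfderiv (𝓡 n) ψ x w| ≤ c * (‖w‖ + (c - G)) := fun c hc ↦
    abs_mvfderiv_le_mul (hG.trans hc.le) (h c hc) (lt_add_of_pos_right _ (sub_pos.2 hc))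
  have hlim : Filter.Tendsto (fun c : ℝ ↦ c * (‖w‖ + (c - G))) (nhdsWithin G (Ioi G))
      (nhds (G * ‖w‖)) := by
    have hcont : Continuous fun c : ℝ ↦ c * (‖w‖ + (c - G)) := by fun_prop
    simpa using (hcont.tendsto G).mono_left (nhdsWithin_le_nhds (s := Ioi G))
  exact ge_of_tendsto hlim (by filter_upwards [self_mem_nhdsWithin] with c hc using hbound c hc)

theorem lipschitzInCharts_of_lipschitzWith {ψ : M → ℝ} {K : NNReal} (hψ : LipschitzWith K ψ) :
    LipschitzInCharts n ψ := by
  intro x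
  obtain ⟨B, hB₀, hB⟩ := exists_eventually_abs_gram_le (n := n) x
  obtain ⟨r, hr, hball⟩ :=
    Metric.mem_nhds_iff.1 (Filter.inter_mem (extChartAt_target_mem_nhds x) hB)
  refine ⟨Metric.ball (extChartAt (𝓡 n) x x) r, Metric.isOpen_ball, Metric.mem_ball_self hr,
    K * (√(n * n * B)).toNNReal, fun z hz z' hz' ↦ ?_⟩
  have hd : edist (chartSymm n x z) (chartSymm n x z') ≤
      ENNReal.ofReal (√(n * n * B) * ‖z' - z‖) := by
    refine edist_chartSymm_le (convex_ball _ r) (fun p hp ↦ (hball hp).1) hz hz' (by positivity)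
      fun p hp ↦ ?_
    rw [mul_pow, Real.sq_sqrt (by positivity)]
    exact gramSq_le (hball hp).2 _
  refine (hψ _ _).trans ?_
  rw [ENNReal.coe_mul, mul_assoc]
  refine mul_le_mul_right (hd.trans ?_) _
  rw [ENNReal.ofReal_mul (Real.sqrt_nonneg _), edist_dist, dist_eq_norm, norm_sub_rev]
  rfl

end LipschitzFunctions

section ExhaustingCutoff

variable {X : Type*} [EMetricSpace X]

theorem hasCompactSupport_thickenedIndicator {F : Set X} (hF : F.Finite) {δ : NNReal}
    (hδ : 0 < (δ : ℝ)) (hX : ∀ x : X, IsCompact (Metric.closedEBall x (δ : ℝ≥0∞))) :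
    HasCompactSupport fun y ↦ (thickenedIndicator hδ F y : ℝ) := by
  refine HasCompactSupport.intro (hF.isCompact_biUnion fun x _ ↦ hX x) fun y hy ↦ ?_
  rw [thickenedIndicator_zero hδ F fun hyF ↦ hy ?_, NNReal.coe_zero]
  rw [Metric.mem_thickening_iff_infEDist_lt, ENNReal.ofReal_coe_nnreal,
    Metric.infEDist_lt_iff] at hyF
  obtain ⟨x, hx, hyx⟩ := hyF
  exact mem_iUnion₂.2 ⟨x, hx, hyx.le⟩

/-- A sequence of compactly supported cutoff functions that converges to `1`, with slopes
tending to zero. On a complete manifold it replaces the compactness needed for Stokes' theorem. -/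
structure IsExhaustingCutoff (φ : ℕ → X → ℝ) : Prop where
  lipschitz : ∀ k : ℕ, LipschitzWith ((k : NNReal) + 1)⁻¹ (φ k)
  nonneg : ∀ k x, 0 ≤ φ k x
  le_one : ∀ k x, φ k x ≤ 1
  hasCompactSupport : ∀ k, HasCompactSupport (φ k)
  tendsto : ∀ x, Filter.Tendsto (fun k ↦ φ k x) Filter.atTop (nhds 1)

theorem exists_isExhaustingCutoff_of_isCompact [SecondCountableTopology X]
    (hX : ∀ (x : X) (r : NNReal), IsCompact (Metric.closedEBall x (r : ℝ≥0∞))) :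
    ∃ φ : ℕ → X → ℝ, IsExhaustingCutoff φ := by
  rcases isEmpty_or_nonempty X with hX₀ | hX₀
  · exact ⟨fun _ _ ↦ 0, fun _ x ↦ hX₀.elim x, fun _ x ↦ hX₀.elim x, fun _ x ↦ hX₀.elim x,
      fun _ ↦ HasCompactSupport.zero, fun x ↦ hX₀.elim x⟩
  let F : ℕ → Set X := fun k ↦ TopologicalSpace.denseSeq X '' Iic k
  have hδ : ∀ k : ℕ, 0 < (((k : NNReal) + 1 : NNReal) : ℝ) := fun k ↦ by positivity
  have hlip : ∀ k : ℕ, LipschitzWith ((k : NNReal) + 1)⁻¹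
      fun y ↦ (thickenedIndicator (hδ k) (F k) y : ℝ) := fun k ↦ by
    have := lipschitzWith_thickenedIndicator (hδ k) (F k)
    rwa [Real.toNNReal_coe] at this
  refine ⟨fun k y ↦ thickenedIndicator (hδ k) (F k) y, hlip, fun k y ↦ NNReal.coe_nonneg _,
    fun k y ↦ NNReal.coe_le_one.2 (thickenedIndicator_le_one _ _ y),
    fun k ↦ hasCompactSupport_thickenedIndicator ((finite_Iic k).image _) (hδ k)
      fun x ↦ hX x _, fun x ↦ ?_⟩
  obtain ⟨j, hj⟩ := (TopologicalSpace.denseRange_denseSeq X).exists_mem_open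
    Metric.isOpen_eball ⟨x, Metric.mem_eball_self (zero_lt_one' ℝ≥0∞)⟩
  set p := TopologicalSpace.denseSeq X j
  have hxp : edist x p ≠ ⊤ := edist_comm x p ▸ (lt_trans hj ENNReal.one_lt_top).ne
  have hslope : Filter.Tendsto (fun k : ℕ ↦ ((((k : NNReal) + 1)⁻¹ : NNReal) : ℝ≥0∞) * edist x p)
      Filter.atTop (nhds 0) := by
    have hinv : Filter.Tendsto (fun k : ℕ ↦ ((((k : NNReal) + 1)⁻¹ : NNReal) : ℝ≥0∞))
        Filter.atTop (nhds 0) := by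
      simpa only [one_div, ENNReal.coe_zero] using
        ENNReal.tendsto_coe.2 (tendsto_one_div_add_atTop_nhds_zero_nat (𝕜 := NNReal))
    simpa only [zero_mul] using ENNReal.Tendsto.mul_const hinv (Or.inr hxp)
  refine tendsto_iff_edist_tendsto_0.2 (tendsto_of_tendsto_of_tendsto_of_le_of_le'
    tendsto_const_nhds hslope (Filter.Eventually.of_forall fun k ↦ zero_le) ?_)
  filter_upwards [Filter.eventually_ge_atTop j] with k hk
  have hp : (thickenedIndicator (hδ k) (F k) p : ℝ) = 1 := by
    rw [thickenedIndicator_one (hδ k) (F k) (mem_image_of_mem _ hk), NNReal.coe_one]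
  exact hp ▸ hlip k x p

end ExhaustingCutoff

section LipschitzGradient

variable {n : ℕ} {M : Type*} [EMetricSpace M] [ChartedSpace (Euc n) M]
  [IsManifold (𝓡 n) ∞ M] [RiemannianBundle (fun x : M ↦ TangentSpace (𝓡 n) x)]
  [IsContMDiffRiemannianBundle (𝓡 n) ∞ (Euc n) (fun x : M ↦ TangentSpace (𝓡 n) x)]
  [IsRiemannianManifold (𝓡 n) M]

theorem abs_mvfderiv_le_of_lipschitzWith {ψ : M → ℝ} {K : NNReal} (hψ : LipschitzWith K ψ)
    (x : M) (w : TangentSpace (𝓡 n) x) : |mvfderiv (𝓡 n) ψ x w| ≤ K * ‖w‖ := by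
  refine abs_mvfderiv_le K.coe_nonneg (fun c hc ↦ Filter.Eventually.of_forall fun y ↦ ?_) w
  refine (hψ y x).trans (mul_le_mul_left ?_ _)
  rw [← ENNReal.ofReal_coe_nnreal]
  exact ENNReal.ofReal_le_ofReal hc.le

theorem edist_sq_sq {a b : ℝ} (hab : 0 ≤ a + b) :
    edist (a ^ 2) (b ^ 2) = ENNReal.ofReal (a + b) * edist a b := by
  rw [edist_dist, edist_dist, Real.dist_eq, Real.dist_eq, ← ENNReal.ofReal_mul hab,
    sq_sub_sq, abs_mul, abs_of_nonneg hab]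

theorem lipschitzWith_sq {X : Type*} [EMetricSpace X] {φ : X → ℝ} {K : NNReal}
    (hφ : LipschitzWith K φ) (hφ₀ : ∀ x, 0 ≤ φ x) (hφ₁ : ∀ x, φ x ≤ 1) :
    LipschitzWith (2 * K) fun x ↦ φ x ^ 2 := by
  intro y x
  rw [edist_sq_sq (add_nonneg (hφ₀ y) (hφ₀ x)), ENNReal.coe_mul, mul_assoc]
  refine mul_le_mul' ?_ (hφ y x)
  rw [← ENNReal.ofReal_coe_nnreal]
  exact ENNReal.ofReal_le_ofReal ((add_le_add (hφ₁ y) (hφ₁ x)).trans_eq one_add_one_eq_two)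

theorem abs_mvfderiv_sq_le {φ : M → ℝ} {K : NNReal} (hφ : LipschitzWith K φ)
    (hφ₀ : ∀ x, 0 ≤ φ x) (x : M) (w : TangentSpace (𝓡 n) x) :
    |mvfderiv (𝓡 n) (fun y ↦ φ y ^ 2) x w| ≤ 2 * φ x * K * ‖w‖ := by
  refine abs_mvfderiv_le (mul_nonneg (mul_nonneg zero_le_two (hφ₀ x)) K.coe_nonneg)
    (fun c hc ↦ ?_) w
  have hcont : ContinuousAt (fun y ↦ (φ y + φ x) * K) x := by
    have := hφ.continuous
    fun_prop
  filter_upwards [hcont.eventually_lt_const (u := c) (by linarith)] with y hy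
  have hsum := add_nonneg (hφ₀ y) (hφ₀ x)
  calc edist (φ y ^ 2) (φ x ^ 2) ≤ ENNReal.ofReal (φ y + φ x) * (K * edist y x) := by
        rw [edist_sq_sq hsum]
        exact mul_le_mul_right (hφ y x) _
    _ = ENNReal.ofReal ((φ y + φ x) * K) * edist y x := by
        rw [ENNReal.ofReal_mul hsum, ENNReal.ofReal_coe_nnreal, mul_assoc]
    _ ≤ ENNReal.ofReal c * edist y x := mul_le_mul_left (ENNReal.ofReal_le_ofReal hy.le) _

end LipschitzGradient

section HodgeIdentities

variable {n : ℕ} {M : Type*} [TopologicalSpace M] [ChartedSpace (Euc n) M]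
  [IsManifold (𝓡 n) ∞ M]

theorem IsSmoothField.add {u w : (x : M) → TangentSpace (𝓡 n) x} (hu : IsSmoothField u)
    (hw : IsSmoothField w) : IsSmoothField fun y ↦ u y + w y := by
  refine isSmoothField_of_coframe fun y i ↦ ?_
  have hy := mem_chart_source (Euc n) y
  simp only [map_add]
  exact ContMDiffAt.add (hu.smoothAt_coframe hy i) (hw.smoothAt_coframe hy i)

variable [RiemannianBundle (fun x : M ↦ TangentSpace (𝓡 n) x)]

theorem codiff₂_apply_sharp (α : OneForm n M)
    (η : (x : M) → TangentSpace (𝓡 n) x → TangentSpace (𝓡 n) x → ℝ) (x : M) :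
    codiff₂ η x (sharp α x) = - ∑ j, α x (frame x j x) * ((dens n x x)⁻¹ *
      ∑ i, pd x i (fun y ↦ dens n x y * raised η x i j y) x) := by
  have hx := mem_chart_source (Euc n) x
  have hcodiff : codiff₂ η x (sharp α x) = ∑ k, (- ∑ j, gram x x k j * ((dens n x x)⁻¹ *
      ∑ i, pd x i (fun y ↦ dens n x y * raised η x i j y) x)) * coframe x k x (sharp α x) := by
    rw [codiff₂, sum_apply]
    rfl
  rw [hcodiff]
  simp only [form_frame_eq_sum_gram α hx, neg_mul, Finset.sum_mul, Finset.sum_neg_distrib]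
  rw [Finset.sum_comm]
  congr 1
  refine Finset.sum_congr rfl fun j _ ↦ Finset.sum_congr rfl fun k _ ↦ ?_
  rw [gram_comm x x j k]
  ring

theorem raised_extD_antisymm (α : OneForm n M) (x₀ : M) (i j : Fin n) (y : M) :
    raised (extD α) x₀ j i y = - raised (extD α) x₀ i j y := by
  rw [raised, raised, Finset.sum_comm, ← Finset.sum_neg_distrib]
  refine Finset.sum_congr rfl fun a _ ↦ ?_
  rw [← Finset.sum_neg_distrib]
  refine Finset.sum_congr rfl fun b _ ↦ ?_
  rw [extD_antisymm α y (frame x₀ b y)]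
  ring

theorem sum_raised_mul_pd {α : OneForm n M} (hα : IsSmoothForm α) (x : M) :
    ∑ i, ∑ j, raised (extD α) x i j x * pd x i (fun y ↦ α y (frame x j y)) x
      = extDSq α x / 2 := by
  have hx := mem_chart_source (Euc n) x
  have htwice : extDSq α x =
      ∑ i, ∑ j, raised (extD α) x i j x * pd x i (fun y ↦ α y (frame x j y)) x
      + ∑ i, ∑ j, raised (extD α) x i j x * pd x i (fun y ↦ α y (frame x j y)) x := by
    nth_rewrite 2 [Finset.sum_comm]
    rw [extDSq, ← Finset.sum_add_distrib]
    refine Finset.sum_congr rfl fun i _ ↦ ?_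
    rw [← Finset.sum_add_distrib]
    refine Finset.sum_congr rfl fun j _ ↦ ?_
    rw [extD_frame hα hx, raised_extD_antisymm α x i j]
    ring
  rw [htwice, add_self_div_two]

variable [IsContMDiffRiemannianBundle (𝓡 n) ∞ (Euc n) (fun x : M ↦ TangentSpace (𝓡 n) x)]

theorem dvg_add {u w : (x : M) → TangentSpace (𝓡 n) x} (hu : IsSmoothField u)
    (hw : IsSmoothField w) (x : M) : dvg (fun y ↦ u y + w y) x = dvg u x + dvg w x := by
  have hx := mem_chart_source (Euc n) x
  have hdiff : ∀ {v : (x : M) → TangentSpace (𝓡 n) x}, IsSmoothField v → ∀ i : Fin n,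
      MDifferentiableAt (𝓡 n) 𝓘(ℝ, ℝ) (fun y ↦ dens n x y * coframe x i y (v y)) x :=
    fun hv i ↦ ((smoothAt_dens hx).mul (hv.smoothAt_coframe hx i)).mdifferentiableAt
  simp only [dvg, map_add, mul_add]
  rw [← mul_add, ← Finset.sum_add_distrib]
  congr 1
  exact Finset.sum_congr rfl fun i _ ↦ pd_add (hdiff hu i) (hdiff hw i) i

theorem pd_dens_mul_coframe_sharp_extDContract_sharp {α : OneForm n M} (hα : IsSmoothForm α)
    (x : M) (i : Fin n) :
    pd x i (fun y ↦ dens n x y * coframe x i y (sharp (extDContract α (sharp α)) y)) x =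
      ∑ j, (dens n x x * (raised (extD α) x i j x * pd x i (fun y ↦ α y (frame x j y)) x)
        + α x (frame x j x) * pd x i (fun y ↦ dens n x y * raised (extD α) x i j y) x) := by
  have hx := mem_chart_source (Euc n) x
  have hraised : ∀ j, SmoothAt n (fun y ↦ dens n x y * raised (extD α) x i j y) x := fun j ↦
    (smoothAt_dens hx).mul (smoothAt_raised hα hx i j)
  have hcoframe : (fun y ↦ dens n x y * coframe x i y (sharp (extDContract α (sharp α)) y))
      =ᶠ[nhds x] fun y ↦ ∑ j, (dens n x y * raised (extD α) x i j y) * α y (frame x j y) := by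
    filter_upwards [(chartAt (Euc n) x).open_source.mem_nhds hx] with z hz
    rw [coframe_sharp_extDContract_sharp α hz, Finset.mul_sum]
    simp only [mul_assoc]
  rw [pd_congr hcoframe,
    pd_sum _ fun j _ ↦ ((hraised j).mul (hα.smoothAt_frame hx j)).mdifferentiableAt]
  refine Finset.sum_congr rfl fun j _ ↦ ?_
  rw [pd_mul (hraised j).mdifferentiableAt (hα.smoothAt_frame hx j).mdifferentiableAt]
  ring

theorem dvg_sharp_extDContract_sharp {α : OneForm n M} (hα : IsSmoothForm α) (x : M) :
    dvg (sharp (extDContract α (sharp α))) x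
      = extDSq α x / 2 - codiff₂ (extD α) x (sharp α x) := by
  have hdens := (dens_pos (n := n) (mem_chart_source _ x)).ne'
  rw [dvg, codiff₂_apply_sharp, ← sum_raised_mul_pd hα x]
  simp only [pd_dens_mul_coframe_sharp_extDContract_sharp hα, Finset.sum_add_distrib, mul_add,
    sub_neg_eq_add, ← Finset.mul_sum]
  rw [← mul_assoc, inv_mul_cancel₀ hdens, one_mul]
  congr 1
  rw [Finset.sum_comm, Finset.mul_sum]
  refine Finset.sum_congr rfl fun j _ ↦ ?_
  rw [← Finset.mul_sum]
  ring

end HodgeIdentities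

section ChristoffelAlgebra

variable {ι : Type*} [Fintype ι] [DecidableEq ι] {v : ι → ℝ} {g gi dv da : ι → ι → ℝ}
  {dg : ι → ι → ι → ℝ}

theorem sum_mul_sum_inv_mul (hgi : ∀ l p, ∑ k, g l k * gi k p = if l = p then 1 else 0)
    (c : ι → ℝ) (l : ι) : ∑ k, g l k * ∑ p, gi k p * c p = c l := by
  simp only [Finset.mul_sum]
  rw [Finset.sum_comm]
  simp only [← mul_assoc, ← Finset.sum_mul, hgi, ite_mul, one_mul, zero_mul, Finset.sum_ite_eq,
    Finset.mem_univ, if_true]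

theorem sum_christoffel_mul_metric (hg : ∀ i j, g i j = g j i)
    (hdg : ∀ l i j, dg l i j = dg l j i)
    (hgi : ∀ l p, ∑ k, g l k * gi k p = if l = p then 1 else 0) (l : ι) :
    ∑ k, (∑ i, ∑ j, (1 / 2 * ∑ p, gi k p * (dg i j p + dg j i p - dg p i j)) * v i * v j) * g k l
      = ∑ i, ∑ j, v i * v j * dg i l j - 1 / 2 * ∑ i, ∑ j, v i * v j * dg l i j := by
  have hswap : ∑ i, ∑ j, v i * v j * dg j l i = ∑ i, ∑ j, v i * v j * dg i l j := by
    rw [Finset.sum_comm]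
    simp only [mul_comm (v _) (v _)]
  calc _ = ∑ i, ∑ j, v i * v j *
          (1 / 2 * ∑ k, g l k * ∑ p, gi k p * (dg i j p + dg j i p - dg p i j)) := by
        simp only [Finset.sum_mul, Finset.mul_sum]
        rw [Finset.sum_comm]
        refine Finset.sum_congr rfl fun i _ ↦ ?_
        rw [Finset.sum_comm]
        refine Finset.sum_congr rfl fun j _ ↦ Finset.sum_congr rfl fun k _ ↦
          Finset.sum_congr rfl fun p _ ↦ ?_
        rw [hg k l]
        ring
    _ = ∑ i, ∑ j, v i * v j * (1 / 2 * (dg i j l + dg j i l - dg l i j)) :=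
        Finset.sum_congr rfl fun i _ ↦ Finset.sum_congr rfl fun j _ ↦ by
          rw [sum_mul_sum_inv_mul hgi fun p ↦ dg i j p + dg j i p - dg p i j]
    _ = 1 / 2 * ∑ i, ∑ j, v i * v j * dg i l j + 1 / 2 * ∑ i, ∑ j, v i * v j * dg j l i
          - 1 / 2 * ∑ i, ∑ j, v i * v j * dg l i j := by
        simp only [Finset.mul_sum, ← Finset.sum_add_distrib, ← Finset.sum_sub_distrib]
        refine Finset.sum_congr rfl fun i _ ↦ Finset.sum_congr rfl fun j _ ↦ ?_
        rw [hdg i j l, hdg j i l]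
        ring
    _ = _ := by
        rw [hswap]
        ring

theorem sum_covariant_derivative_mul_metric (hg : ∀ i j, g i j = g j i)
    (hdg : ∀ l i j, dg l i j = dg l j i)
    (hgi : ∀ l p, ∑ k, g l k * gi k p = if l = p then 1 else 0)
    (hda : ∀ i l, da i l = ∑ k, (g l k * dv i k + v k * dg i l k))
    (hclosed : ∀ i l, da i l = da l i) (l : ι) :
    ∑ k, (∑ i, v i * dv i k + ∑ i, ∑ j, (1 / 2 * ∑ p, gi k p *
        (dg i j p + dg j i p - dg p i j)) * v i * v j) * g k l =
      1 / 2 * ∑ i, (v i * da l i + (∑ k, g i k * v k) * dv l i) := by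
  have hda_left : ∑ i, v i * da l i =
      ∑ i, ∑ k, v i * g i k * dv l k + ∑ i, ∑ k, v i * v k * dg l i k := by
    simp only [hda l, Finset.mul_sum, ← Finset.sum_add_distrib]
    exact Finset.sum_congr rfl fun i _ ↦ Finset.sum_congr rfl fun k _ ↦ by ring
  have hda_right : ∑ i, v i * da l i =
      ∑ k, (∑ i, v i * dv i k) * g k l + ∑ i, ∑ k, v i * v k * dg i l k := by
    simp only [← hclosed _ l, hda _ l, Finset.mul_sum, Finset.sum_mul]
    rw [Finset.sum_comm (f := fun k i ↦ v i * dv i k * g k l)]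
    simp only [← Finset.sum_add_distrib]
    refine Finset.sum_congr rfl fun i _ ↦ Finset.sum_congr rfl fun k _ ↦ ?_
    rw [hg k l]
    ring
  have hlower : ∑ i, (∑ k, g i k * v k) * dv l i = ∑ i, ∑ k, v i * g i k * dv l k := by
    simp only [Finset.sum_mul]
    rw [Finset.sum_comm]
    refine Finset.sum_congr rfl fun i _ ↦ Finset.sum_congr rfl fun k _ ↦ ?_
    rw [hg k i]
    ring
  simp only [add_mul, Finset.sum_add_distrib]
  rw [sum_christoffel_mul_metric hg hdg hgi, hlower]
  linarith

end ChristoffelAlgebra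

section ClosedForms

variable {n : ℕ} {M : Type*} [TopologicalSpace M] [ChartedSpace (Euc n) M]

theorem inner_grad [RiemannianBundle (fun x : M ↦ TangentSpace (𝓡 n) x)] (p : M → ℝ) (x : M)
    (w : TangentSpace (𝓡 n) x) : inner ℝ (grad p x) w = mvfderiv (𝓡 n) p x w :=
  inner_sharp (show OneForm n M from mvfderiv (𝓡 n) p) x w

variable [IsManifold (𝓡 n) ∞ M]

theorem pd_comm_of_extD_eq_zero {α : OneForm n M} (hα : IsSmoothForm α)
    {x : M} (hclosed : ∀ u w, extD α x u w = 0) (i j : Fin n) :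
    pd x i (fun y ↦ α y (frame x j y)) x = pd x j (fun y ↦ α y (frame x i y)) x := by
  rw [← sub_eq_zero, ← extD_frame hα (mem_chart_source (Euc n) x), hclosed]

variable [RiemannianBundle (fun x : M ↦ TangentSpace (𝓡 n) x)]

theorem eq_of_inner_frame_eq {x₀ y : M} (hy : y ∈ (chartAt (Euc n) x₀).source)
    {u w : TangentSpace (𝓡 n) y}
    (h : ∀ l, inner ℝ u (frame x₀ l y) = inner ℝ w (frame x₀ l y)) : u = w := by
  refine ext_inner_right ℝ fun z ↦ ?_
  rw [← sum_coframe_smul_frame hy z, inner_sum, inner_sum]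
  simp only [real_inner_smul_right, h]

variable [IsContMDiffRiemannianBundle (𝓡 n) ∞ (Euc n) (fun x : M ↦ TangentSpace (𝓡 n) x)]

theorem pd_contract_sharp {α : OneForm n M} (hα : IsSmoothForm α) (x : M) (l : Fin n) :
    pd x l (contract (sharp α) α) x =
      ∑ i, (coframe x i x (sharp α x) * pd x l (fun y ↦ α y (frame x i y)) x
        + α x (frame x i x) * pd x l (fun y ↦ coframe x i y (sharp α y)) x) := by
  have hx := mem_chart_source (Euc n) x
  have hexpand : contract (sharp α) α =ᶠ[nhds x]
      fun y ↦ ∑ i, coframe x i y (sharp α y) * α y (frame x i y) := by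
    filter_upwards [(chartAt (Euc n) x).open_source.mem_nhds hx] with z hz
      using clm_apply_eq_sum hz (α z) (sharp α z)
  rw [pd_congr hexpand, pd_sum _ fun i _ ↦
    ((hα.sharp.smoothAt_coframe hx i).mul (hα.smoothAt_frame hx i)).mdifferentiableAt]
  exact Finset.sum_congr rfl fun i _ ↦ pd_mul (hα.sharp.smoothAt_coframe hx i).mdifferentiableAt
    (hα.smoothAt_frame hx i).mdifferentiableAt l

theorem pd_form_frame_eq_sum_gram {α : OneForm n M} (hα : IsSmoothForm α) (x : M)
    (i l : Fin n) :
    pd x i (fun y ↦ α y (frame x l y)) x =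
      ∑ k, (gram x x l k * pd x i (fun y ↦ coframe x k y (sharp α y)) x
        + coframe x k x (sharp α x) * pd x i (fun y ↦ gram x y l k) x) := by
  have hx := mem_chart_source (Euc n) x
  have hexpand : (fun y ↦ α y (frame x l y)) =ᶠ[nhds x]
      fun y ↦ ∑ k, gram x y l k * coframe x k y (sharp α y) := by
    filter_upwards [(chartAt (Euc n) x).open_source.mem_nhds hx] with z hz
      using form_frame_eq_sum_gram α hz l
  rw [pd_congr hexpand, pd_sum _ fun k _ ↦
    ((smoothAt_gram hx l k).mul (hα.sharp.smoothAt_coframe hx k)).mdifferentiableAt]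
  exact Finset.sum_congr rfl fun k _ ↦ pd_mul (smoothAt_gram hx l k).mdifferentiableAt
    (hα.sharp.smoothAt_coframe hx k).mdifferentiableAt i

theorem lieD_sharp_eq_mvfderiv {α : OneForm n M} (hα : IsSmoothForm α)
    {x : M} (hclosed : ∀ u w, extD α x u w = 0) :
    lieD (sharp α) α x = mvfderiv (𝓡 n) (contract (sharp α) α) x := by
  have hx := mem_chart_source (Euc n) x
  have hlieD : ∀ l, lieD (sharp α) α x (frame x l x) =
      ∑ j, (∑ i, (coframe x i x (sharp α x) * pd x i (fun y ↦ α y (frame x j y)) x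
        + α x (frame x i x) * pd x j (fun y ↦ coframe x i y (sharp α y)) x)) *
        coframe x j x (frame x l x) := fun l ↦ by
    rw [lieD, sum_apply]
    rfl
  refine clm_ext_frame hx fun l ↦ Eq.trans ?_ (pd_contract_sharp hα x l).symm
  simp only [hlieD, coframe_frame hx, mul_ite, mul_one, mul_zero, Finset.sum_ite_eq',
    Finset.mem_univ, if_true]
  exact Finset.sum_congr rfl fun i _ ↦ by rw [pd_comm_of_extD_eq_zero hα hclosed i l]

theorem covD_sharp_eq_grad {α : OneForm n M} (hα : IsSmoothForm α)
    {x : M} (hclosed : ∀ u w, extD α x u w = 0) :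
    covD (sharp α) (sharp α) x = - grad (fun y ↦ -(1 / 2) * contract (sharp α) α y) x := by
  have hx := mem_chart_source (Euc n) x
  have hcontract : SmoothAt n (contract (sharp α) α) x := smoothAt_form_field hα hα.sharp x
  have hpressure : ∀ l, mvfderiv (𝓡 n) (fun y ↦ -(1 / 2) * contract (sharp α) α y) x
      (frame x l x) = -(1 / 2) * pd x l (contract (sharp α) α) x := fun l ↦ by
    have := pd_mul (x₀ := x) (f := fun _ ↦ -(1 / 2 : ℝ)) mdifferentiableAt_const
      hcontract.mdifferentiableAt l
    rwa [pd_const, mul_zero, add_zero] at this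
  refine eq_of_inner_frame_eq hx fun l ↦ ?_
  rw [inner_neg_left, inner_grad, hpressure, pd_contract_sharp hα, covD, sum_inner]
  simp only [real_inner_smul_left, form_frame_eq_sum_gram α hx]
  rw [neg_mul, neg_neg]
  exact sum_covariant_derivative_mul_metric (v := fun i ↦ coframe x i x (sharp α x))
    (g := fun i j ↦ gram x x i j) (gi := fun i j ↦ (gram x x)⁻¹ i j)
    (dv := fun i k ↦ pd x i (fun y ↦ coframe x k y (sharp α y)) x)
    (da := fun i l ↦ pd x i (fun y ↦ α y (frame x l y)) x)
    (dg := fun l i j ↦ pd x l (fun y ↦ gram x y i j) x)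
    (gram_comm x x) (fun l i j ↦ by simp only [fun y : M ↦ gram_comm x y i j])
    (sum_gram_mul_inv hx) (pd_form_frame_eq_sum_gram hα x)
    (pd_comm_of_extD_eq_zero hα hclosed) l

end ClosedForms

section HodgeField

variable {n : ℕ} {M : Type*} [TopologicalSpace M] [ChartedSpace (Euc n) M]
  [IsManifold (𝓡 n) ∞ M] [RiemannianBundle (fun x : M ↦ TangentSpace (𝓡 n) x)]

/-- The energy density `|δα|² + |dα|²` of a 1-form. -/
def hodgeEnergy (α : OneForm n M) (x : M) : ℝ := dvg (sharp α) x ^ 2 + extDSq α x / 2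

/-- The vector field `ι_v dα + (div v) v`, up to sign conventions, where `v = α^♯`. Its divergence
is the energy density if `α` is harmonic. -/
def hodgeField (α : OneForm n M) (x : M) : TangentSpace (𝓡 n) x :=
  sharp (extDContract α (sharp α)) x + dvg (sharp α) x • sharp α x

theorem hodgeEnergy_nonneg (α : OneForm n M) (x : M) : 0 ≤ hodgeEnergy α x :=
  add_nonneg (sq_nonneg _) (div_nonneg (extDSq_nonneg α x) zero_le_two)

theorem hodgeEnergy_eq_zero_iff {α : OneForm n M} {x : M} :
    hodgeEnergy α x = 0 ↔ dvg (sharp α) x = 0 ∧ extDSq α x = 0 := by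
  rw [hodgeEnergy, add_eq_zero_iff_of_nonneg (sq_nonneg _)
    (div_nonneg (extDSq_nonneg α x) zero_le_two), sq_eq_zero_iff,
    div_eq_zero_iff, or_iff_left two_ne_zero]

theorem norm_hodgeField_le (α : OneForm n M) (x : M) :
    ‖hodgeField α x‖ ≤ 2 * (‖α x‖ * √(hodgeEnergy α x)) := by
  have hcontract := norm_sharp_extDContract_sq_le α (sharp α) x
  have hdiv : ‖dvg (sharp α) x • sharp α x‖ ^ 2 = dvg (sharp α) x ^ 2 * ‖α x‖ ^ 2 := by
    rw [norm_smul, mul_pow, norm_sharp, Real.norm_eq_abs, sq_abs]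
  rw [norm_sharp α] at hcontract
  refine le_of_sq_le_sq ?_ (by positivity)
  calc ‖hodgeField α x‖ ^ 2
      ≤ (‖sharp (extDContract α (sharp α)) x‖ + ‖dvg (sharp α) x • sharp α x‖) ^ 2 :=
        pow_le_pow_left₀ (norm_nonneg _) (norm_add_le _ _) 2
    _ ≤ 2 * (extDSq α x * ‖α x‖ ^ 2 + dvg (sharp α) x ^ 2 * ‖α x‖ ^ 2) := by
        rw [← hdiv]
        exact add_sq_le.trans (by linarith)
    _ ≤ 4 * (‖α x‖ ^ 2 * hodgeEnergy α x) := by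
        rw [hodgeEnergy]
        nlinarith [mul_nonneg (sq_nonneg (dvg (sharp α) x)) (sq_nonneg ‖α x‖)]
    _ = (2 * (‖α x‖ * √(hodgeEnergy α x))) ^ 2 := by
        rw [mul_pow, mul_pow, Real.sq_sqrt (hodgeEnergy_nonneg α x)]
        norm_num

variable [IsContMDiffRiemannianBundle (𝓡 n) ∞ (Euc n) (fun x : M ↦ TangentSpace (𝓡 n) x)]
  [MeasurableSpace M] [BorelSpace M] [T2Space M] [SigmaCompactSpace M] {α : OneForm n M}

theorem isSmoothField_hodgeField (hα : IsSmoothForm α) : IsSmoothField (hodgeField α) :=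
  (isSmoothField_sharp_extDContract hα hα.sharp).add (hα.sharp.smul (smoothAt_dvg hα.sharp))

theorem dvg_hodgeField (hα : IsHarmonicForm α) (x : M) :
    dvg (hodgeField α) x = hodgeEnergy α x := by
  obtain ⟨hs, hΔ⟩ := hα
  have hdvg := smoothAt_dvg hs.sharp
  have hcodiff : mvfderiv (𝓡 n) (codiff₁ α) x (sharp α x)
      = - mvfderiv (𝓡 n) (dvg (sharp α)) x (sharp α x) :=
    congrArg (fun L : TangentSpace (𝓡 n) x →L[ℝ] ℝ ↦ L (sharp α x)) mvfderiv_neg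
  have hharm : mvfderiv (𝓡 n) (codiff₁ α) x (sharp α x) + codiff₂ (extD α) x (sharp α x) = 0 :=
    congrArg (fun L : TangentSpace (𝓡 n) x →L[ℝ] ℝ ↦ L (sharp α x)) (hΔ x)
  have hsum : dvg (hodgeField α) x = _ :=
    dvg_add (isSmoothField_sharp_extDContract hs hs.sharp) (hs.sharp.smul hdvg) x
  rw [hsum, dvg_sharp_extDContract_sharp hs, dvg_smul hs.sharp (hdvg x), hodgeEnergy]
  linarith

theorem continuous_hodgeEnergy (hα : IsHarmonicForm α) : Continuous (hodgeEnergy α) := by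
  rw [← funext (dvg_hodgeField hα)]
  exact continuous_iff_continuousAt.2 fun x ↦
    (smoothAt_dvg (isSmoothField_hodgeField hα.1) x).continuousAt

theorem integrable_cutoff_sq_mul_hodgeEnergy (hα : IsHarmonicForm α) {φ : M → ℝ}
    (hφ : Continuous φ) (hc : HasCompactSupport φ) :
    Integrable (fun x ↦ φ x ^ 2 * hodgeEnergy α x) (vol n M) :=
  ((hφ.pow 2).mul (continuous_hodgeEnergy hα)).integrable_of_hasCompactSupport
    (hc.comp_left (zero_pow two_ne_zero)).mul_right

end HodgeField

section CutoffLimits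

variable {X : Type*} [EMetricSpace X] [MeasurableSpace X] {μ : Measure X} {φ : ℕ → X → ℝ}

theorem IsExhaustingCutoff.tendsto_integral_mul [OpensMeasurableSpace X]
    (hφ : IsExhaustingCutoff φ) {f : X → ℝ} (hf : Integrable f μ) :
    Filter.Tendsto (fun k ↦ ∫ x, φ k x * f x ∂μ) Filter.atTop (nhds (∫ x, f x ∂μ)) := by
  refine tendsto_integral_of_dominated_convergence (fun x ↦ |f x|) (fun k ↦ ?_) hf.abs
    (fun k ↦ Filter.Eventually.of_forall fun x ↦ ?_) (Filter.Eventually.of_forall fun x ↦ ?_)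
  · exact (hφ.lipschitz k).continuous.aestronglyMeasurable.mul hf.aestronglyMeasurable
  · rw [norm_mul, Real.norm_eq_abs, Real.norm_eq_abs, abs_of_nonneg (hφ.nonneg k x)]
    exact mul_le_of_le_one_left (abs_nonneg _) (hφ.le_one k x)
  · simpa only [one_mul] using (hφ.tendsto x).mul_const (f x)

theorem lintegral_eq_zero_of_tendsto {X : Type*} [MeasurableSpace X] {μ : Measure X}
    {g : ℕ → X → ℝ≥0∞} {f : X → ℝ≥0∞} {c : ℕ → ℝ≥0∞} (hg : ∀ k, Measurable (g k))
    (hgf : ∀ x, Filter.Tendsto (fun k ↦ g k x) Filter.atTop (nhds (f x)))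
    (hgc : ∀ k, ∫⁻ x, g k x ∂μ ≤ c k) (hc : Filter.Tendsto c Filter.atTop (nhds 0)) :
    ∫⁻ x, f x ∂μ = 0 := by
  refine le_antisymm ?_ zero_le
  calc ∫⁻ x, f x ∂μ = ∫⁻ x, Filter.liminf (fun k ↦ g k x) Filter.atTop ∂μ :=
        lintegral_congr fun x ↦ (hgf x).liminf_eq.symm
    _ ≤ Filter.liminf (fun k ↦ ∫⁻ x, g k x ∂μ) Filter.atTop := lintegral_liminf_le hg
    _ ≤ Filter.liminf c Filter.atTop :=
        Filter.liminf_le_liminf (Filter.Eventually.of_forall hgc)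
    _ = 0 := hc.liminf_eq

theorem IsExhaustingCutoff.eq_zero_of_integral_sq_mul_le [BorelSpace X] [μ.IsOpenPosMeasure]
    (hφ : IsExhaustingCutoff φ) {f : X → ℝ} {c : ℕ → ℝ} (hf : Continuous f) (hf₀ : ∀ x, 0 ≤ f x)
    (hint : ∀ k, Integrable (fun x ↦ φ k x ^ 2 * f x) μ)
    (hle : ∀ k, ∫ x, φ k x ^ 2 * f x ∂μ ≤ c k)
    (hc : Filter.Tendsto c Filter.atTop (nhds 0)) : f = 0 := by
  have hzero : ∫⁻ x, ENNReal.ofReal (f x) ∂μ = 0 := by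
    refine lintegral_eq_zero_of_tendsto (g := fun k x ↦ ENNReal.ofReal (φ k x ^ 2 * f x))
      (c := fun k ↦ ENNReal.ofReal (c k)) (fun k ↦ ?_) (fun x ↦ ENNReal.tendsto_ofReal ?_)
      (fun k ↦ ?_) ?_
    · exact (((hφ.lipschitz k).continuous.pow 2).mul hf).measurable.ennreal_ofReal
    · simpa only [one_pow, one_mul] using ((hφ.tendsto x).pow 2).mul_const (f x)
    · rw [← ofReal_integral_eq_lintegral_ofReal (hint k)
        (Filter.Eventually.of_forall fun x ↦ mul_nonneg (sq_nonneg _) (hf₀ x))]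
      exact ENNReal.ofReal_le_ofReal (hle k)
    · simpa only [ENNReal.ofReal_zero] using ENNReal.tendsto_ofReal hc
  rw [lintegral_eq_zero_iff hf.measurable.ennreal_ofReal] at hzero
  refine (hf.ae_eq_iff_eq μ continuous_const).1 ?_
  filter_upwards [hzero] with x hx
  exact le_antisymm (ENNReal.ofReal_eq_zero.1 hx) (hf₀ x)

end CutoffLimits

section HodgeBound

variable {n : ℕ} {M : Type*} [EMetricSpace M] [ChartedSpace (Euc n) M]
  [IsManifold (𝓡 n) ∞ M] [RiemannianBundle (fun x : M ↦ TangentSpace (𝓡 n) x)]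
  [IsContMDiffRiemannianBundle (𝓡 n) ∞ (Euc n) (fun x : M ↦ TangentSpace (𝓡 n) x)]
  [IsRiemannianManifold (𝓡 n) M]

theorem abs_mvfderiv_sq_hodgeField_le (α : OneForm n M) {φ : M → ℝ} {K : NNReal}
    (hφ : LipschitzWith K φ) (hφ₀ : ∀ x, 0 ≤ φ x) (x : M) :
    |mvfderiv (𝓡 n) (fun y ↦ φ y ^ 2) x (hodgeField α x)| ≤
      1 / 2 * (φ x ^ 2 * hodgeEnergy α x) + 8 * K ^ 2 * ‖α x‖ ^ 2 := by
  have hslope : 0 ≤ 2 * φ x * K := mul_nonneg (mul_nonneg zero_le_two (hφ₀ x)) K.coe_nonneg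
  calc |mvfderiv (𝓡 n) (fun y ↦ φ y ^ 2) x (hodgeField α x)|
      ≤ 2 * φ x * K * (2 * (‖α x‖ * √(hodgeEnergy α x))) :=
        (abs_mvfderiv_sq_le hφ hφ₀ x _).trans
          (mul_le_mul_of_nonneg_left (norm_hodgeField_le α x) hslope)
    _ = 1 / 2 * (2 * (φ x * √(hodgeEnergy α x)) * (4 * (K * ‖α x‖))) := by ring
    _ ≤ 1 / 2 * ((φ x * √(hodgeEnergy α x)) ^ 2 + (4 * (K * ‖α x‖)) ^ 2) :=
        mul_le_mul_of_nonneg_left (two_mul_le_add_sq _ _) one_half_pos.le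
    _ = 1 / 2 * (φ x ^ 2 * hodgeEnergy α x) + 8 * K ^ 2 * ‖α x‖ ^ 2 := by
        rw [mul_pow, Real.sq_sqrt (hodgeEnergy_nonneg α x)]
        ring

variable [MeasurableSpace M] [BorelSpace M] [SigmaCompactSpace M]

theorem integral_cutoff_sq_mul_hodgeEnergy_le {α : OneForm n M} (hα : IsHarmonicForm α)
    (h2 : MemLp (fun x ↦ ‖α x‖) 2 (vol n M)) {φ : M → ℝ} {K : NNReal} (hφ : LipschitzWith K φ)
    (hφ₀ : ∀ x, 0 ≤ φ x) (hφ₁ : ∀ x, φ x ≤ 1) (hc : HasCompactSupport φ) :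
    ∫ x, φ x ^ 2 * hodgeEnergy α x ∂(vol n M) ≤ 16 * K ^ 2 * ∫ x, ‖α x‖ ^ 2 ∂(vol n M) := by
  have hE := (integrable_cutoff_sq_mul_hodgeEnergy hα hφ.continuous hc).const_mul (1 / 2)
  have hα2 := h2.integrable_sq.const_mul (8 * (K : ℝ) ^ 2)
  obtain ⟨hint, hparts⟩ := integral_mul_dvg (isSmoothField_hodgeField hα.1)
    (hc.comp_left (zero_pow two_ne_zero))
    (lipschitzInCharts_of_lipschitzWith (lipschitzWith_sq hφ hφ₀ hφ₁))
  have hle : ∫ x, φ x ^ 2 * dvg (hodgeField α) x ∂(vol n M) ≤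
      ∫ x, 1 / 2 * (φ x ^ 2 * hodgeEnergy α x) + 8 * K ^ 2 * ‖α x‖ ^ 2 ∂(vol n M) := by
    refine hparts.le.trans ?_
    rw [← integral_neg]
    exact integral_mono hint.neg (hE.add hα2) fun x ↦
      (neg_le_abs _).trans (abs_mvfderiv_sq_hodgeField_le α hφ hφ₀ x)
  rw [integral_add hE hα2, integral_const_mul, integral_const_mul] at hle
  simp only [dvg_hodgeField hα] at hle
  linarith

theorem norm_integral_mul_dvg_le {v : (x : M) → TangentSpace (𝓡 n) x} (hv : IsSmoothField v)
    (hint : Integrable (fun x ↦ ‖v x‖) (vol n M)) {φ : M → ℝ} {K : NNReal}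
    (hφ : LipschitzWith K φ) (hc : HasCompactSupport φ) :
    ‖∫ x, φ x * dvg v x ∂(vol n M)‖ ≤ K * ∫ x, ‖v x‖ ∂(vol n M) := by
  rw [(integral_mul_dvg hv hc (lipschitzInCharts_of_lipschitzWith hφ)).2, norm_neg,
    ← integral_const_mul]
  exact norm_integral_le_of_norm_le (hint.const_mul _)
    (Filter.Eventually.of_forall fun x ↦ abs_mvfderiv_le_of_lipschitzWith hφ x _)

end HodgeBound

section Complete

theorem sigmaCompactSpace (n : ℕ) (M : Type*) [TopologicalSpace M] [SecondCountableTopology M]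
    [ChartedSpace (Euc n) M] : SigmaCompactSpace M :=
  have := ChartedSpace.locallyCompactSpace (Euc n) M
  inferInstance

theorem tendsto_natCast_add_one_inv_toReal :
    Filter.Tendsto (fun k : ℕ ↦ ((((k : NNReal) + 1)⁻¹ : NNReal) : ℝ)) Filter.atTop (nhds 0) := by
  simpa only [one_div, NNReal.coe_inv, NNReal.coe_add, NNReal.coe_natCast, NNReal.coe_one] using
    tendsto_one_div_add_atTop_nhds_zero_nat (𝕜 := ℝ)

variable {n : ℕ} {M : Type*} [EMetricSpace M] [SecondCountableTopology M]
  [ChartedSpace (Euc n) M] [IsManifold (𝓡 n) ∞ M]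
  [RiemannianBundle (fun x : M ↦ TangentSpace (𝓡 n) x)]
  [IsContMDiffRiemannianBundle (𝓡 n) ∞ (Euc n) (fun x : M ↦ TangentSpace (𝓡 n) x)]
  [IsRiemannianManifold (𝓡 n) M] [CompleteSpace M] [MeasurableSpace M] [BorelSpace M]

theorem hodgeEnergy_eq_zero {α : OneForm n M} (hα : IsHarmonicForm α)
    (h2 : MemLp (fun x ↦ ‖α x‖) 2 (vol n M)) : hodgeEnergy α = 0 := by
  have := sigmaCompactSpace n M
  obtain ⟨φ, hφ⟩ := exists_isExhaustingCutoff_of_isCompact (isCompact_closedEBall n (M := M))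
  refine hφ.eq_zero_of_integral_sq_mul_le (μ := vol n M) (continuous_hodgeEnergy hα)
    (hodgeEnergy_nonneg α)
    (fun k ↦ integrable_cutoff_sq_mul_hodgeEnergy hα (hφ.lipschitz k).continuous
      (hφ.hasCompactSupport k))
    (fun k ↦ integral_cutoff_sq_mul_hodgeEnergy_le hα h2 (hφ.lipschitz k) (hφ.nonneg k)
      (hφ.le_one k) (hφ.hasCompactSupport k)) ?_
  simpa only [zero_pow two_ne_zero, mul_zero, zero_mul] using
    ((tendsto_natCast_add_one_inv_toReal.pow 2).const_mul 16).mul_const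
      (∫ x, ‖α x‖ ^ 2 ∂(vol n M))

theorem dvg_sharp_eq_zero {α : OneForm n M} (hα : IsHarmonicForm α)
    (h2 : MemLp (fun x ↦ ‖α x‖) 2 (vol n M)) (x : M) : dvg (sharp α) x = 0 :=
  (hodgeEnergy_eq_zero_iff.1 (congrFun (hodgeEnergy_eq_zero hα h2) x)).1

theorem extD_eq_zero {α : OneForm n M} (hα : IsHarmonicForm α)
    (h2 : MemLp (fun x ↦ ‖α x‖) 2 (vol n M)) (x : M) (u w : TangentSpace (𝓡 n) x) :
    extD α x u w = 0 :=
  extD_eq_zero_of_extDSq_eq_zero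
    (hodgeEnergy_eq_zero_iff.1 (congrFun (hodgeEnergy_eq_zero hα h2) x)).2 u w

theorem integral_dvg_eq_zero {v : (x : M) → TangentSpace (𝓡 n) x} (hv : IsSmoothField v)
    (hint : Integrable (fun x ↦ ‖v x‖) (vol n M)) (hdvg : Integrable (dvg v) (vol n M)) :
    ∫ x, dvg v x ∂(vol n M) = 0 := by
  have := sigmaCompactSpace n M
  obtain ⟨φ, hφ⟩ := exists_isExhaustingCutoff_of_isCompact (isCompact_closedEBall n (M := M))
  have hbound := tendsto_natCast_add_one_inv_toReal.mul_const (∫ x, ‖v x‖ ∂(vol n M))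
  rw [zero_mul] at hbound
  exact tendsto_nhds_unique (hφ.tendsto_integral_mul hdvg) (squeeze_zero_norm
    (fun k ↦ norm_integral_mul_dvg_le hv hint (hφ.lipschitz k) (hφ.hasCompactSupport k)) hbound)

theorem integral_mvfderiv_eq_zero {f : M → ℝ} (hf : ∀ x, SmoothAt n f x)
    (hf2 : MemLp f 2 (vol n M)) {w : (x : M) → TangentSpace (𝓡 n) x} (hw : IsSmoothField w)
    (hdiv : ∀ x, dvg w x = 0) (hw2 : MemLp (fun x ↦ ‖w x‖) 2 (vol n M))
    (hint : Integrable (fun x ↦ mvfderiv (𝓡 n) f x (w x)) (vol n M)) :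
    ∫ x, mvfderiv (𝓡 n) f x (w x) ∂(vol n M) = 0 := by
  have hdvg : dvg (fun y ↦ f y • w y) = fun x ↦ mvfderiv (𝓡 n) f x (w x) := funext fun x ↦ by
    rw [dvg_smul hw (hf x), hdiv, mul_zero, zero_add]
  have hfw : Integrable (fun x ↦ ‖f x • w x‖) (vol n M) := by
    simp only [norm_smul]
    exact hf2.norm.integrable_mul hw2
  rw [← hdvg] at hint ⊢
  exact integral_dvg_eq_zero (hw.smul hf) hfw hint

end Complete

section EulerEquation

variable {n : ℕ} {M : Type*} [TopologicalSpace M] [ChartedSpace (Euc n) M]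
  [IsManifold (𝓡 n) ∞ M] [RiemannianBundle (fun x : M ↦ TangentSpace (𝓡 n) x)]
  [MeasurableSpace M] {α : OneForm n M}

theorem memLp_contract_sharp (h4 : MemLp (fun x ↦ ‖α x‖) 4 (vol n M)) :
    MemLp (contract (sharp α) α) 2 (vol n M) := by
  have h := h4.norm_rpow_div 2
  have hexp : (4 : ℝ≥0∞) / 2 = 2 :=
    ((ENNReal.eq_div_iff two_ne_zero ENNReal.ofNat_ne_top).2 (by norm_num)).symm
  rw [hexp] at h
  simpa [funext (contract_sharp α)] using h

theorem mk_eq_zero_of_isL2Exact (hα : IsL2Exact α) (h : α ∈ L2Form n M) :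
    (Submodule.Quotient.mk ⟨α, h⟩ : EulerDual n M) = 0 := by
  refine (Submodule.Quotient.mk_eq_zero _).2 fun ε _ ↦ ⟨⟨α, h⟩, hα, ?_⟩
  rw [sub_self]
  exact L2Bound.zero

theorem mem_l2Form [BorelSpace M] (hα : IsSmoothForm α)
    (h2 : MemLp (fun x ↦ ‖α x‖) 2 (vol n M)) : α ∈ L2Form n M := by
  refine ⟨fun x₀ i ↦ ?_, (eLpNorm (fun x ↦ ‖α x‖) 2 (vol n M)).toReal, ENNReal.toReal_nonneg,
    fun x ↦ ‖α x‖, h2, ?_, Filter.Eventually.of_forall fun x ↦ le_rfl⟩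
  · exact ContinuousOn.aemeasurable (fun y hy ↦
      (hα.smoothAt_frame hy i).continuousAt.continuousWithinAt) (measurableSet_source x₀)
  · rw [ENNReal.ofReal_toReal h2.2.ne]

end EulerEquation

section SteadyFlow

variable {n : ℕ} {M : Type*} [TopologicalSpace M] [ChartedSpace (Euc n) M]
  [IsManifold (𝓡 n) ∞ M] [RiemannianBundle (fun x : M ↦ TangentSpace (𝓡 n) x)]
  [IsContMDiffRiemannianBundle (𝓡 n) ∞ (Euc n) (fun x : M ↦ TangentSpace (𝓡 n) x)]
  {α : OneForm n M}

theorem contMDiff_contract_sharp (hα : IsSmoothForm α) :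
    ContMDiff (𝓡 n) 𝓘(ℝ, ℝ) ∞ (contract (sharp α) α) :=
  smoothAt_form_field hα hα.sharp

theorem isSteadyEulerSolution_sharp (hα : IsSmoothForm α)
    (hclosed : ∀ x u w, extD α x u w = 0) (hdiv : ∀ x, dvg (sharp α) x = 0) :
    IsSteadyEulerSolution (sharp α) := by
  refine ⟨hα.sharp, fun y ↦ -(1 / 2) * contract (sharp α) α y,
    contMDiff_const.mul (contMDiff_contract_sharp hα),
    fun t x ↦ ⟨differentiableAt_const _, ?_, hdiv x⟩⟩
  rw [deriv_const, zero_add]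
  exact covD_sharp_eq_grad hα (hclosed x)

end SteadyFlow

end Riem

end

theorem proposition1 {n : ℕ} {M : Type*} [EMetricSpace M] [SecondCountableTopology M]
    [ChartedSpace (Riem.Euc n) M] [IsManifold (𝓡 n) ∞ M]
    [RiemannianBundle (fun x : M ↦ TangentSpace (𝓡 n) x)]
    [IsContMDiffRiemannianBundle (𝓡 n) ∞ (Riem.Euc n) (fun x : M ↦ TangentSpace (𝓡 n) x)]
    [IsRiemannianManifold (𝓡 n) M] [CompleteSpace M]
    [MeasurableSpace M] [BorelSpace M]
    (α : Riem.OneForm n M)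
    (hα : Riem.IsHarmonicForm α)
    (h2 : MemLp (fun x ↦ ‖α x‖) 2 (Riem.vol n M))
    (h4 : MemLp (fun x ↦ ‖α x‖) 4 (Riem.vol n M)) :
    -- `v = α^♯` is a steady solution of the Euler equations
    Riem.IsSteadyEulerSolution (Riem.sharp α) ∧
    -- `L_v α = d (ι_v α)`, where `ι_v α` is a smooth function in `L²`
    (∀ x, Riem.lieD (Riem.sharp α) α x
      = mvfderiv (𝓡 n) (Riem.contract (Riem.sharp α) α) x) ∧
    ContMDiff (𝓡 n) 𝓘(ℝ, ℝ) ∞ (Riem.contract (Riem.sharp α) α) ∧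
    MemLp (Riem.contract (Riem.sharp α) α) 2 (Riem.vol n M) ∧
    Riem.IsL2Exact (Riem.lieD (Riem.sharp α) α) ∧
    -- `α ∈ Ω¹_{L²}`, and the coset of `L_v α` vanishes
    α ∈ Riem.L2Form n M ∧
    (∀ h : Riem.lieD (Riem.sharp α) α ∈ Riem.L2Form n M,
      (Submodule.Quotient.mk ⟨Riem.lieD (Riem.sharp α) α, h⟩ : Riem.EulerDual n M) = 0) ∧
    -- the pairing of `L_v α` with divergence-free `L²` vector fields vanishes
    (∀ w : (x : M) → TangentSpace (𝓡 n) x, Riem.IsSmoothField w →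
      (∀ x, Riem.dvg w x = 0) → MemLp (fun x ↦ ‖w x‖) 2 (Riem.vol n M) →
      Integrable (fun x ↦ Riem.lieD (Riem.sharp α) α x (w x)) (Riem.vol n M) →
      ∫ x, Riem.lieD (Riem.sharp α) α x (w x) ∂(Riem.vol n M) = 0) := by
  have hs := hα.1
  have hdiv := Riem.dvg_sharp_eq_zero hα h2
  have hclosed := Riem.extD_eq_zero hα h2
  have hsmooth := Riem.contMDiff_contract_sharp hs
  have hL2 := Riem.memLp_contract_sharp h4
  have hlie : ∀ x, Riem.lieD (Riem.sharp α) α x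
      = mvfderiv (𝓡 n) (Riem.contract (Riem.sharp α) α) x :=
    fun x ↦ Riem.lieD_sharp_eq_mvfderiv hs (hclosed x)
  have hexact : Riem.IsL2Exact (Riem.lieD (Riem.sharp α) α) := ⟨_, hsmooth, hL2, hlie⟩
  refine ⟨Riem.isSteadyEulerSolution_sharp hs hclosed hdiv, hlie, hsmooth, hL2, hexact,
    Riem.mem_l2Form hs h2, Riem.mk_eq_zero_of_isL2Exact hexact, fun w hw hwdiv hw2 hint ↦ ?_⟩
  simp only [hlie] at hint ⊢
  exact Riem.integral_mvfderiv_eq_zero hsmooth hL2 hw hwdiv hw2 hint
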